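/- All bornological vector spaces are complex, convex and complete; $\hat\otimes$ is the completed bornological tensor product, and $M(A)$ denotes the algebra of (bounded, two-sided) multipliers of a bornological algebra $A$. A homomorphism $f\colon A\to M(B)$ is essential if it induces isomorphisms $A\hat\otimes_A B\cong B\cong B\hat\otimes_A A$; it then extends canonically to $M(A)\to M(B)$, and the extension is denoted by the same symbol. Let $H$ be a bornological quantum group: a nonzero essential bornological algebra ($H\hat\otimes_H H\cong H$) with the approximation property, together with a comultiplication, i.e. a coassociative essential homomorphism $\Delta\colon H\to M(H\hat\otimes H)$, all of whose Galois maps $$f\otimes g\mapsto \Delta(f)(g\otimes 1),\quad \Delta(f)(1\otimes g),\quad (f\otimes 1)\Delta(g),\quad (1\otimes f)\Delta(g)$$ are bornological isomorphisms of $H\hat\otimes H$, denoted $\gamma_l,\gamma_r,\rho_l,\rho_r$ respectively, and with a faithful bounded functional $\phi\colon H\to\mathbb C$ that is left invariant, $(\mathrm{id}\hat\otimes\phi)\Delta(f)=\phi(f)1$ for all $f\in H$. Here, for a bounded functional $\omega$, the multipliers $(\mathrm{id}\hat\otimes\omega)\Delta(f)$ and $(\omega\hat\otimes\mathrm{id})\Delta(f)$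 of $H$ are defined by $$(\mathrm{id}\hat\otimes\omega)\Delta(f)\cdot g=(\mathrm{id}\hat\otimes\omega)\gamma_l(f\otimes g),\qquad g\cdot(\mathrm{id}\hat\otimes\omega)\Delta(f)=(\mathrm{id}\hat\otimes\omega)\rho_l(g\otimes f),$$ $$(\omega\hat\otimes\mathrm{id})\Delta(f)\cdot g=(\omega\hat\otimes\mathrm{id})\gamma_r(f\otimes g),\qquad g\cdot(\omega\hat\otimes\mathrm{id})\Delta(f)=(\omega\hat\otimes\mathrm{id})\rho_r(g\otimes f).$$ Then: 1. $H$ has a unique counit and antipode: there are a unique essential algebra homomorphism $\epsilon\colon H\to\mathbb C$ and a unique bornological linear isomorphism $S\colon H\to H$ such that $S$ is an antihomomorphism of algebras and of coalgebras, $(\epsilon\hat\otimes\mathrm{id})\Delta=\mathrm{id}=(\mathrm{id}\hat\otimes\epsilon)\Delta$, $\mu(S\hat\otimes\mathrm{id})\gamma_r=\epsilon\hat\otimes\mathrm{id}$ and $\mu(\mathrm{id}\hat\otimes S)\rho_l=\mathrm{id}\hat\otimes\epsilon$, where $\mu$ is the multiplication of $H$. 2. There is a unique multiplier $\delta\in M(H)$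 (the modular element) such that $(\phi\hat\otimes\mathrm{id})\Delta(f)=\phi(f)\,\delta$ for all $f\in H$. 3. The modular element $\delta$ is invertible in $M(H)$, and, for the canonical extensions of $\Delta$, $\epsilon$ and $S$ to multipliers, $$\Delta(\delta)=\delta\otimes\delta,\qquad \epsilon(\delta)=1,\qquad S(\delta)=\delta^{-1}.$$ -/

import Mathlib

noncomputable section

open Bornology Set Filter
open scoped Pointwise

namespace BornQG

/-! ### Complete convex bornological vector spaces -/

section Disks

variable {V : Type*} [AddCommGroup V] [Module ℂ V]

/-- A disk: a (nonempty) circled and convex subset of a complex vector space. -/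
def IsDisk (T : Set V) : Prop :=
  T.Nonempty ∧ ∀ x ∈ T, ∀ y ∈ T, ∀ a b : ℂ, ‖a‖ + ‖b‖ ≤ 1 → a • x + b • y ∈ T

/-- A completant disk: its linear span, with the Minkowski functional of `T` as norm, is a
Banach space. The two last clauses say that the Minkowski functional is a norm and that it is
complete. -/
def IsCompletantDisk (T : Set V) : Prop :=
  IsDisk T ∧ (∀ x : V, (∀ ε : ℝ, 0 < ε → x ∈ (ε : ℂ) • T) → x = 0) ∧
    ∀ u : ℕ → V, (∀ n, u n ∈ Submodule.span ℂ T) →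
      (∀ ε : ℝ, 0 < ε → ∃ N, ∀ m ≥ N, ∀ n ≥ N, u m - u n ∈ (ε : ℂ) • T) →
      ∃ x, ∀ ε : ℝ, 0 < ε → ∃ N, ∀ n ≥ N, u n - x ∈ (ε : ℂ) • T

theorem IsDisk.zero_mem {T : Set V} (h : IsDisk T) : (0 : V) ∈ T := by
  obtain ⟨x, hx⟩ := h.1
  simpa using h.2 x hx x hx 0 0 (by simp)

theorem IsDisk.smul_mem {T : Set V} (h : IsDisk T) {a : ℂ} (ha : ‖a‖ ≤ 1) {x : V} (hx : x ∈ T) :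
    a • x ∈ T := by
  simpa using h.2 x hx x hx a 0 (by simpa using ha)

theorem IsDisk.zero_mem_scale {T : Set V} (h : IsDisk T) (ε : ℝ) : (0 : V) ∈ (ε : ℂ) • T :=
  ⟨0, h.zero_mem, by simp⟩

theorem IsDisk.scale_smul {T : Set V} (h : IsDisk T) {ε δ : ℝ} (hδ : 0 ≤ δ) {c : ℂ}
    (hc : ‖c‖ * ε ≤ δ) (hε : 0 ≤ ε) {x : V} (hx : x ∈ (ε : ℂ) • T) : c • x ∈ (δ : ℂ) • T := by
  obtain ⟨t, ht, rfl⟩ := hx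
  rcases hδ.eq_or_lt with h0 | hpos
  · subst h0
    have h1 : ‖c‖ * ε = 0 := le_antisymm hc (by positivity)
    have h2 : c * (ε : ℂ) = 0 := by
      rw [← norm_eq_zero, norm_mul, Complex.norm_real, Real.norm_of_nonneg hε, h1]
    refine ⟨0, h.zero_mem, ?_⟩
    change ((0 : ℝ) : ℂ) • (0 : V) = c • (ε : ℂ) • t
    rw [smul_smul, h2, zero_smul, smul_zero]
  · refine ⟨(c * ε / δ) • t, h.smul_mem ?_ ht, ?_⟩
    · rw [norm_div, norm_mul, Complex.norm_real, Complex.norm_real, Real.norm_of_nonneg hε,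
        Real.norm_of_nonneg hpos.le]
      exact div_le_one_of_le₀ hc hpos.le
    · have : (δ : ℂ) ≠ 0 := by exact_mod_cast hpos.ne'
      simp only [smul_smul]
      congr 1
      field_simp

theorem IsDisk.scale_mono {T : Set V} (h : IsDisk T) {ε δ : ℝ} (hε : 0 ≤ ε) (hεδ : ε ≤ δ)
    {x : V} (hx : x ∈ (ε : ℂ) • T) : x ∈ (δ : ℂ) • T := by
  simpa using h.scale_smul (hε.trans hεδ) (c := 1) (by simpa using hεδ) hε hx

theorem IsDisk.scale_neg {T : Set V} (h : IsDisk T) {ε : ℝ} (hε : 0 ≤ ε)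
    {x : V} (hx : x ∈ (ε : ℂ) • T) : -x ∈ (ε : ℂ) • T := by
  simpa using h.scale_smul hε (c := -1) (by simp) hε hx

theorem IsDisk.scale_add {T : Set V} (h : IsDisk T) {ε δ : ℝ} (hε : 0 ≤ ε) (hδ : 0 ≤ δ)
    {x y : V} (hx : x ∈ (ε : ℂ) • T) (hy : y ∈ (δ : ℂ) • T) :
    x + y ∈ ((ε + δ : ℝ) : ℂ) • T := by
  obtain ⟨t, ht, rfl⟩ := hx
  obtain ⟨s, hs, rfl⟩ := hy
  rcases (add_nonneg hε hδ).eq_or_lt with h0 | hpos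
  · have h1 : ε = 0 := by linarith
    have h2 : δ = 0 := by linarith
    exact ⟨0, h.zero_mem, by simp [h1, h2]⟩
  · refine ⟨((ε / (ε + δ) : ℝ) : ℂ) • t + ((δ / (ε + δ) : ℝ) : ℂ) • s,
      h.2 t ht s hs _ _ ?_, ?_⟩
    · rw [Complex.norm_real, Complex.norm_real, Real.norm_of_nonneg (by positivity),
        Real.norm_of_nonneg (by positivity), ← add_div, div_self hpos.ne']
    · have : ((ε : ℂ) + δ) ≠ 0 := by exact_mod_cast hpos.ne'
      simp only [smul_add, smul_smul]
      push_cast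
      congr 2 <;> field_simp

theorem IsDisk.scale_sub {T : Set V} (h : IsDisk T) {ε δ : ℝ} (hε : 0 ≤ ε) (hδ : 0 ≤ δ)
    {x y : V} (hx : x ∈ (ε : ℂ) • T) (hy : y ∈ (δ : ℂ) • T) :
    x - y ∈ ((ε + δ : ℝ) : ℂ) • T := by
  rw [sub_eq_add_neg]
  exact h.scale_add hε hδ hx (h.scale_neg hδ hy)

theorem IsDisk.scale_sum {ι : Type*} {T : Set V} (h : IsDisk T) (c : ι → ℂ) (b : ι → V)
    (s : Finset ι) (hb : ∀ i ∈ s, c i ≠ 0 → b i ∈ T) :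
    ∑ i ∈ s, c i • b i ∈ ((∑ i ∈ s, ‖c i‖ : ℝ) : ℂ) • T := by
  classical
  induction s using Finset.induction_on with
  | empty => simpa using h.zero_mem_scale 0
  | insert i s hi ih =>
    rw [Finset.sum_insert hi, Finset.sum_insert hi]
    refine h.scale_add (norm_nonneg _) (Finset.sum_nonneg fun _ _ => norm_nonneg _) ?_
      (ih fun j hj => hb j (Finset.mem_insert_of_mem hj))
    by_cases hc : c i = 0
    · simpa [hc] using h.zero_mem_scale 0
    · refine h.scale_smul (norm_nonneg _) (ε := 1) (by simp) zero_le_one ?_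
      simpa using hb i (Finset.mem_insert_self _ _) hc

end Disks

/-- A complete convex bornological vector space over `ℂ`: a vector bornology such that every
small (i.e. bounded) set is contained in a small completant disk. -/
class CompleteBornSpace (V : Type*) [AddCommGroup V] [Module ℂ V] [Bornology V] : Prop where
  isBounded_add : ∀ {S T : Set V}, IsBounded S → IsBounded T → IsBounded (S + T)
  isBounded_smul : ∀ (c : ℂ) {S : Set V}, IsBounded S → IsBounded (c • S)
  exists_completant : ∀ {S : Set V}, IsBounded S →
    ∃ T : Set V, IsBounded T ∧ IsCompletantDisk T ∧ S ⊆ T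

open CompleteBornSpace

section Convergence

variable {V : Type*} [AddCommGroup V] [Module ℂ V] [Bornology V]

/-- Bornological convergence: `u` converges to `x` along `l` in the semi-normed space spanned
by some small disk. -/
def BTendsto {ι : Type*} (u : ι → V) (l : Filter ι) (x : V) : Prop :=
  ∃ T : Set V, IsBounded T ∧ IsDisk T ∧ ∀ ε : ℝ, 0 < ε → ∀ᶠ i in l, u i - x ∈ (ε : ℂ) • T

variable [CompleteBornSpace V]

theorem eq_zero_of_scale {T : Set V} (hT : IsBounded T) {x : V}
    (hx : ∀ ε : ℝ, 0 < ε → x ∈ (ε : ℂ) • T) : x = 0 := by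
  obtain ⟨U, -, hU, hTU⟩ := exists_completant hT
  exact hU.2.1 x fun ε hε => smul_set_mono hTU (hx ε hε)

theorem BTendsto.enlarge {ι : Type*} {u : ι → V} {l : Filter ι} {x : V} (h : BTendsto u l x)
    {S : Set V} (hS : IsBounded S) : ∃ T : Set V, IsBounded T ∧ IsCompletantDisk T ∧ S ⊆ T ∧
      ∀ ε : ℝ, 0 < ε → ∀ᶠ i in l, u i - x ∈ (ε : ℂ) • T := by
  obtain ⟨T, hT, -, h⟩ := h
  obtain ⟨U, hU, hUc, hTU⟩ := exists_completant (hT.union hS)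
  refine ⟨U, hU, hUc, subset_union_right.trans hTU, fun ε hε => (h ε hε).mono fun i hi => ?_⟩
  exact smul_set_mono (subset_union_left.trans hTU) hi

theorem BTendsto.add {ι : Type*} {u v : ι → V} {l : Filter ι} {x y : V} (hu : BTendsto u l x)
    (hv : BTendsto v l y) : BTendsto (fun i => u i + v i) l (x + y) := by
  obtain ⟨T, hT, -, h⟩ := hv
  obtain ⟨U, hU, hUc, hTU, h'⟩ := hu.enlarge hT
  refine ⟨U, hU, hUc.1, fun ε hε => ?_⟩
  filter_upwards [h _ (half_pos hε), h' _ (half_pos hε)] with i h1 h2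
  have := hUc.1.scale_add (half_pos hε).le (half_pos hε).le h2 (smul_set_mono hTU h1)
  rw [add_halves] at this
  convert this using 1
  abel

theorem BTendsto.smul {ι : Type*} {u : ι → V} {l : Filter ι} {x : V} (c : ℂ)
    (hu : BTendsto u l x) : BTendsto (fun i => c • u i) l (c • x) := by
  obtain ⟨T, hT, hTd, h⟩ := hu
  refine ⟨T, hT, hTd, fun ε hε => ?_⟩
  have hpos : 0 < ε / (‖c‖ + 1) := by positivity
  filter_upwards [h _ hpos] with i hi
  rw [← smul_sub]
  refine hTd.scale_smul hε.le ?_ hpos.le hi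
  rw [mul_div_assoc', div_le_iff₀ (by positivity)]
  nlinarith [norm_nonneg c]

theorem BTendsto.unique {ι : Type*} {u : ι → V} {l : Filter ι} [l.NeBot] {x y : V}
    (hx : BTendsto u l x) (hy : BTendsto u l y) : x = y := by
  have h := hy.add (hx.smul (-1))
  obtain ⟨T, hT, hTd, h⟩ := h
  have : y + (-1 : ℂ) • x = 0 := by
    refine eq_zero_of_scale hT fun ε hε => ?_
    obtain ⟨i, hi⟩ := (h ε hε).exists
    have := hTd.scale_neg hε.le hi
    convert this using 1
    module
  have h2 : y - x = 0 := by rw [← this]; module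
  exact (sub_eq_zero.mp h2).symm

/-- Absolutely convergent series in a complete bornological vector space. -/
theorem exists_bsum {ι : Type*} {U : Set V} (hU : IsBounded U) (hUc : IsCompletantDisk U)
    (c : ι → ℂ) (b : ι → V) (hc : Summable fun i => ‖c i‖) (hb : ∀ i, c i ≠ 0 → b i ∈ U) :
    ∃ x, BTendsto (fun s : Finset ι => ∑ i ∈ s, c i • b i) atTop x ∧
      ∀ C : ℝ, (∀ s : Finset ι, ∑ i ∈ s, ‖c i‖ ≤ C) → x ∈ ((1 + C : ℝ) : ℂ) • U := by
  classical
  have hvan : ∀ n : ℕ, ∃ s : Finset ι, ∀ t : Finset ι, Disjoint t s →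
      ∑ i ∈ t, ‖c i‖ ≤ 1 / ((n : ℝ) + 1) := by
    intro n
    obtain ⟨s, hs⟩ := summable_iff_vanishing_norm.1 hc (1 / ((n : ℝ) + 1)) (by positivity)
    exact ⟨s, fun t ht => (le_abs_self _).trans (hs t ht).le⟩
  choose s hs using hvan
  have key : ∀ (n : ℕ) (t : Finset ι), Disjoint t (s n) →
      ∑ i ∈ t, c i • b i ∈ ((1 / ((n : ℝ) + 1) : ℝ) : ℂ) • U := fun n t ht =>
    hUc.1.scale_mono (Finset.sum_nonneg fun _ _ => norm_nonneg _) (hs n t ht)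
      (hUc.1.scale_sum c b t fun i _ => hb i)
  have hdiff : ∀ t r : Finset ι, ∑ i ∈ t, c i • b i - ∑ i ∈ r, c i • b i
      = ∑ i ∈ t \ r, c i • b i - ∑ i ∈ r \ t, c i • b i := by
    intro t r
    rw [← Finset.sum_sdiff_sub_sum_sdiff]
  have hsmall : ∀ ε : ℝ, 0 < ε → ∃ N : ℕ, ∀ n ≥ N, 1 / ((n : ℝ) + 1) ≤ ε := by
    intro ε hε
    obtain ⟨N, hN⟩ := exists_nat_one_div_lt hε
    exact ⟨N, fun n hn => (Nat.one_div_le_one_div hn).trans hN.le⟩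
  obtain ⟨x, hx⟩ := hUc.2.2 (fun n => ∑ i ∈ s n, c i • b i)
    (fun n => Submodule.sum_mem _ fun i _ => by
      by_cases h0 : c i = 0
      · simp [h0]
      · exact Submodule.smul_mem _ _ (Submodule.subset_span (hb i h0)))
    (by
      intro ε hε
      obtain ⟨N, hN⟩ := hsmall (ε / 2) (by positivity)
      refine ⟨N, fun m hm n hn => ?_⟩
      rw [hdiff]
      have h1 := key n (s m \ s n) Finset.sdiff_disjoint
      have h2 := key m (s n \ s m) Finset.sdiff_disjoint
      refine hUc.1.scale_mono (by positivity) ?_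
        (hUc.1.scale_sub (by positivity) (by positivity) h1 h2)
      linarith [hN n hn, hN m hm])
  refine ⟨x, ⟨U, hU, hUc.1, fun ε hε => ?_⟩, fun C hC => ?_⟩
  rotate_left
  · obtain ⟨N, hN⟩ := hx 1 one_pos
    have h1 := hUc.1.scale_neg zero_le_one (hN N le_rfl)
    have hC0 : 0 ≤ C := (Finset.sum_nonneg fun _ _ => norm_nonneg _).trans (hC (s N))
    have h2 := hUc.1.scale_mono (Finset.sum_nonneg fun _ _ => norm_nonneg _) (hC (s N))
      (hUc.1.scale_sum c b (s N) fun i _ => hb i)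
    have h3 := hUc.1.scale_add zero_le_one hC0 h1 h2
    rwa [neg_sub, sub_add_cancel] at h3
  obtain ⟨N, hN⟩ := hsmall (ε / 2) (by positivity)
  obtain ⟨M, hM⟩ := hx (ε / 2) (by positivity)
  set n := max N M
  filter_upwards [eventually_ge_atTop (s n)] with t ht
  have h1 := hM n (le_max_right _ _)
  have h2 := key n (t \ s n) Finset.sdiff_disjoint
  have h3 := hUc.1.scale_add (by positivity) (by positivity) h1 h2
  have h4 := hUc.1.scale_mono (by positivity)
    (show _ ≤ ε by linarith [hN n (le_max_left _ _)]) h3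
  have h5 : ∑ i ∈ s n, c i • b i - x + ∑ i ∈ t \ s n, c i • b i = ∑ i ∈ t, c i • b i - x := by
    rw [← Finset.sum_sdiff ht]
    abel
  rwa [h5] at h4

end Convergence

/-! ### Bounded linear maps -/

/-- Bounded linear maps: linear maps sending small sets to small sets. -/
structure BLin (V W : Type*) [AddCommGroup V] [Module ℂ V] [Bornology V]
    [AddCommGroup W] [Module ℂ W] [Bornology W] extends V →ₗ[ℂ] W where
  bounded' : ∀ S : Set V, IsBounded S → IsBounded (toFun '' S)

namespace BLin

variable {V W X Y : Type*}
  [AddCommGroup V] [Module ℂ V] [Bornology V]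
  [AddCommGroup W] [Module ℂ W] [Bornology W]
  [AddCommGroup X] [Module ℂ X] [Bornology X]
  [AddCommGroup Y] [Module ℂ Y] [Bornology Y]

instance : FunLike (BLin V W) V W where
  coe f := f.toFun
  coe_injective f g h := by
    cases f; cases g; congr; exact DFunLike.coe_injective h

instance : LinearMapClass (BLin V W) ℂ V W where
  map_add f := f.map_add'
  map_smulₛₗ f := f.map_smul'

@[ext] theorem ext {f g : BLin V W} (h : ∀ x, f x = g x) : f = g := DFunLike.ext f g h

theorem bounded (f : BLin V W) {S : Set V} (hS : IsBounded S) : IsBounded (f '' S) :=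
  f.bounded' S hS

@[simp] theorem coe_mk (f : V →ₗ[ℂ] W) (h) (x : V) : (BLin.mk f h : BLin V W) x = f x := rfl

@[simp] theorem toLinearMap_apply (f : BLin V W) (x : V) : f.toLinearMap x = f x := rfl

/-- The identity map. -/
def id (V : Type*) [AddCommGroup V] [Module ℂ V] [Bornology V] : BLin V V :=
  ⟨LinearMap.id, fun S hS => by simpa using hS⟩

@[simp] theorem id_apply (x : V) : BLin.id V x = x := rfl

/-- Composition of bounded linear maps. -/
def comp (g : BLin W X) (f : BLin V W) : BLin V X :=
  ⟨g.toLinearMap.comp f.toLinearMap, fun S hS => by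
    have := g.bounded (f.bounded hS)
    rwa [← image_comp] at this⟩

@[simp] theorem comp_apply (g : BLin W X) (f : BLin V W) (x : V) : g.comp f x = g (f x) := rfl

/-- A bornological isomorphism: a bounded linear map with a bounded linear inverse. -/
def IsIso (f : BLin V W) : Prop := ∃ g : BLin W V, (∀ x, g (f x) = x) ∧ ∀ y, f (g y) = y

section Module

variable [CompleteBornSpace W]

instance : Zero (BLin V W) := ⟨⟨0, fun S _ => (isBounded_singleton (x := (0 : W))).subset (by
  rintro _ ⟨x, -, rfl⟩; rfl)⟩⟩

instance : Add (BLin V W) := ⟨fun f g => ⟨f.toLinearMap + g.toLinearMap, fun S hS =>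
  (isBounded_add (f.bounded hS) (g.bounded hS)).subset (by
    rintro _ ⟨x, hx, rfl⟩
    exact add_mem_add (mem_image_of_mem _ hx) (mem_image_of_mem _ hx))⟩⟩

instance : SMul ℂ (BLin V W) := ⟨fun c f => ⟨c • f.toLinearMap, fun S hS =>
  (isBounded_smul c (f.bounded hS)).subset (by
    rintro _ ⟨x, hx, rfl⟩
    exact smul_mem_smul_set (mem_image_of_mem _ hx))⟩⟩

instance : Neg (BLin V W) := ⟨fun f => (-1 : ℂ) • f⟩

@[simp] theorem zero_apply (x : V) : (0 : BLin V W) x = 0 := rfl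
@[simp] theorem add_apply (f g : BLin V W) (x : V) : (f + g) x = f x + g x := rfl
@[simp] theorem smul_apply (c : ℂ) (f : BLin V W) (x : V) : (c • f) x = c • f x := rfl
@[simp] theorem neg_apply (f : BLin V W) (x : V) : (-f) x = -f x := by
  change (-1 : ℂ) • f x = _
  simp

instance : AddCommGroup (BLin V W) where
  add_assoc f g h := by ext; simp [add_assoc]
  zero_add f := by ext; simp
  add_zero f := by ext; simp
  add_comm f g := by ext; simp [add_comm]
  neg_add_cancel f := by ext; simp
  nsmul := nsmulRec
  zsmul := zsmulRec

@[simp] theorem sub_apply (f g : BLin V W) (x : V) : (f - g) x = f x - g x := by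
  rw [sub_eq_add_neg, sub_eq_add_neg, add_apply, neg_apply]

instance : Module ℂ (BLin V W) where
  one_smul f := by ext; simp
  mul_smul a b f := by ext; simp [mul_smul]
  smul_zero a := by ext; simp
  smul_add a f g := by ext; simp
  add_smul a b f := by ext; simp [add_smul]
  zero_smul f := by ext; simp

end Module

/-- The equibounded sets of bounded linear maps: `L` is small if `L(S)` is small for all
small `S`. -/
instance : Bornology (BLin V W) :=
  Bornology.ofBounded {L | ∀ S : Set V, IsBounded S →
      IsBounded (image2 (fun (f : BLin V W) x => f x) L S)}
    (fun S _ => by simp)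
    (fun L hL M hM S hS => (hL S hS).subset (image2_subset_right hM))
    (fun L hL M hM S hS => by rw [image2_union_left]; exact (hL S hS).union (hM S hS))
    (fun f S hS => by rw [image2_singleton_left]; exact f.bounded hS)

theorem isBounded_iff {L : Set (BLin V W)} : IsBounded L ↔ ∀ S : Set V, IsBounded S →
    IsBounded (image2 (fun (f : BLin V W) x => f x) L S) :=
  Bornology.isBounded_ofBounded_iff _

section Complete

variable [CompleteBornSpace W]

instance : CompleteBornSpace (BLin V W) where
  isBounded_add {L M} hL hM := by
    rw [isBounded_iff] at *
    refine fun S hS => (isBounded_add (hL S hS) (hM S hS)).subset ?_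
    rintro _ ⟨_, ⟨f, hf, g, hg, rfl⟩, x, hx, rfl⟩
    exact add_mem_add (mem_image2_of_mem hf hx) (mem_image2_of_mem hg hx)
  isBounded_smul c {L} hL := by
    rw [isBounded_iff] at *
    refine fun S hS => (isBounded_smul c (hL S hS)).subset ?_
    rintro _ ⟨_, ⟨f, hf, rfl⟩, x, hx, rfl⟩
    exact smul_mem_smul_set (mem_image2_of_mem hf hx)
  exists_completant {L} hL := by
    rw [isBounded_iff] at hL
    choose! T hT hTc hTL using fun S hS => exists_completant (hL S hS)
    set D : Set (BLin V W) := {f | ∀ S, IsBounded S → ∀ x ∈ S, f x ∈ T S} with hD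
    have hscale : ∀ {ε : ℝ}, 0 < ε → ∀ {f : BLin V W}, f ∈ (ε : ℂ) • D ↔
        ∀ S, IsBounded S → ∀ x ∈ S, f x ∈ (ε : ℂ) • T S := by
      intro ε hε f
      have hne : (ε : ℂ) ≠ 0 := by exact_mod_cast hε.ne'
      simp only [mem_smul_set_iff_inv_smul_mem₀ hne, hD, mem_ofPred_eq, smul_apply]
    have hdisk : IsDisk D := by
      refine ⟨⟨0, fun S hS x _ => (hTc S hS).1.zero_mem⟩, fun f hf g hg a b hab S hS x hx => ?_⟩
      exact (hTc S hS).1.2 _ (hf S hS x hx) _ (hg S hS x hx) a b hab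
    refine ⟨D, ?_, ⟨hdisk, ?_, ?_⟩, fun f hf S hS x hx => hTL S hS (mem_image2_of_mem hf hx)⟩
    · rw [isBounded_iff]
      refine fun S hS => (hT S hS).subset ?_
      rintro _ ⟨f, hf, x, hx, rfl⟩
      exact hf S hS x hx
    · intro f hf
      ext x
      refine eq_zero_of_scale (hT {x} isBounded_singleton) fun ε hε => ?_
      exact (hscale hε).1 (hf ε hε) {x} isBounded_singleton x rfl
    · intro u hu hcau
      have hspan : ∀ S, IsBounded S → ∀ x ∈ S, ∀ n, u n x ∈ Submodule.span ℂ (T S) := by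
        intro S hS x hx n
        refine Submodule.span_induction (p := fun f _ => f x ∈ Submodule.span ℂ (T S))
          ?_ ?_ ?_ ?_ (hu n)
        · exact fun f hf => Submodule.subset_span (hf S hS x hx)
        · exact Submodule.zero_mem _
        · exact fun f g _ _ hf hg => Submodule.add_mem _ hf hg
        · exact fun a f _ hf => Submodule.smul_mem _ a hf
      have hlim : ∀ S, IsBounded S → ∀ x ∈ S, ∃ y, ∀ ε : ℝ, 0 < ε →
          ∃ N, ∀ n ≥ N, u n x - y ∈ (ε : ℂ) • T S := by
        intro S hS x hx
        refine (hTc S hS).2.2 (fun n => u n x) (hspan S hS x hx) fun ε hε => ?_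
        obtain ⟨N, hN⟩ := hcau ε hε
        refine ⟨N, fun m hm n hn => ?_⟩
        have := (hscale hε).1 (hN m hm n hn) S hS x hx
        rwa [sub_apply] at this
      have hB : ∀ S, IsBounded S → ∀ y (x : V), (∀ ε : ℝ, 0 < ε →
          ∃ N, ∀ n ≥ N, u n x - y ∈ (ε : ℂ) • T S) → BTendsto (fun n => u n x) atTop y := by
        intro S hS y x hxy
        exact ⟨T S, hT S hS, (hTc S hS).1, fun ε hε => eventually_atTop.2 (hxy ε hε)⟩
      choose g hg using fun x => hlim {x} isBounded_singleton x rfl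
      have hgB : ∀ x, BTendsto (fun n => u n x) atTop (g x) :=
        fun x => hB _ isBounded_singleton _ _ (hg x)
      have hgS : ∀ S, IsBounded S → ∀ x ∈ S, ∀ ε : ℝ, 0 < ε →
          ∃ N, ∀ n ≥ N, u n x - g x ∈ (ε : ℂ) • T S := by
        intro S hS x hx
        obtain ⟨y, hy⟩ := hlim S hS x hx
        rwa [(hgB x).unique (hB S hS y x hy)]
      have hunif : ∀ ε : ℝ, 0 < ε → ∃ N, ∀ n ≥ N, ∀ S, IsBounded S → ∀ x ∈ S,
          u n x - g x ∈ (ε : ℂ) • T S := by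
        intro ε hε
        obtain ⟨N, hN⟩ := hcau (ε / 2) (half_pos hε)
        refine ⟨N, fun n hn S hS x hx => ?_⟩
        obtain ⟨M, hM⟩ := hgS S hS x hx (ε / 2) (half_pos hε)
        have h1 := (hscale (half_pos hε)).1 (hN n hn (max N M) (le_max_left _ _)) S hS x hx
        have h2 := hM (max N M) (le_max_right _ _)
        have := (hTc S hS).1.scale_add (half_pos hε).le (half_pos hε).le h1 h2
        rw [add_halves, sub_apply, sub_add_sub_cancel] at this
        exact this
      refine ⟨⟨⟨⟨g, fun x y => ?_⟩, fun c x => ?_⟩, fun S hS => ?_⟩, fun ε hε => ?_⟩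
      · have := (hgB x).add (hgB y)
        refine (hgB (x + y)).unique ?_
        simpa using this
      · have := (hgB x).smul c
        refine (hgB (c • x)).unique ?_
        simpa using this
      · obtain ⟨N, hN⟩ := hunif 1 one_pos
        refine (isBounded_add ((u N).bounded hS) (isBounded_smul (-1) (hT S hS))).subset ?_
        rintro _ ⟨x, hx, rfl⟩
        have := hN N le_rfl S hS x hx
        simp only [Complex.ofReal_one, one_smul] at this
        refine ⟨u N x, mem_image_of_mem _ hx, (-1 : ℂ) • (u N x - g x),
          smul_mem_smul_set this, ?_⟩
        change u N x + (-1 : ℂ) • (u N x - g x) = g x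
        module
      · obtain ⟨N, hN⟩ := hunif ε hε
        refine ⟨N, fun n hn => (hscale hε).2 fun S hS x hx => ?_⟩
        rw [sub_apply]
        exact hN n hn S hS x hx

end Complete

theorem map_btendsto {ι : Type*} (f : BLin V W) {u : ι → V} {l : Filter ι} {x : V}
    (h : BTendsto u l x) : BTendsto (fun i => f (u i)) l (f x) := by
  obtain ⟨T, hT, hTd, h⟩ := h
  refine ⟨f '' T, f.bounded hT, ⟨hTd.1.image _, ?_⟩, fun ε hε => (h ε hε).mono fun i hi => ?_⟩
  · rintro _ ⟨x, hx, rfl⟩ _ ⟨y, hy, rfl⟩ a b hab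
    exact ⟨a • x + b • y, hTd.2 x hx y hy a b hab, by simp⟩
  · obtain ⟨t, ht, hti⟩ := hi
    refine ⟨f t, mem_image_of_mem _ ht, ?_⟩
    have := congrArg f hti
    rw [map_sub] at this
    rw [← this]
    exact (map_smul f (ε : ℂ) t).symm

/-- Bounded bilinear maps as bounded linear maps into the space of bounded linear maps. -/
def mk₂ [CompleteBornSpace X] (f : V → W → X)
    (h₁ : ∀ x x' y, f (x + x') y = f x y + f x' y) (h₂ : ∀ (c : ℂ) x y, f (c • x) y = c • f x y)
    (h₃ : ∀ x y y', f x (y + y') = f x y + f x y') (h₄ : ∀ (c : ℂ) x y, f x (c • y) = c • f x y)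
    (hb : ∀ S T, IsBounded S → IsBounded T → IsBounded (image2 f S T)) : BLin V (BLin W X) where
  toFun x := ⟨⟨⟨f x, h₃ x⟩, fun c y => h₄ c x y⟩, fun T hT =>
    (hb {x} T isBounded_singleton hT).subset (by simp)⟩
  map_add' x x' := ext fun y => h₁ x x' y
  map_smul' c x := ext fun y => h₂ c x y
  bounded' S hS := by
    rw [isBounded_iff]
    refine fun T hT => (hb S T hS hT).subset ?_
    rintro _ ⟨_, ⟨x, hx, rfl⟩, y, hy, rfl⟩
    exact mem_image2_of_mem hx hy

@[simp] theorem mk₂_apply [CompleteBornSpace X] (f : V → W → X) (h₁ h₂ h₃ h₄ hb) (x : V) (y : W) :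
    mk₂ f h₁ h₂ h₃ h₄ hb x y = f x y := rfl

theorem bounded₂ [CompleteBornSpace X] (f : BLin V (BLin W X)) {S : Set V} {T : Set W}
    (hS : IsBounded S) (hT : IsBounded T) : IsBounded (image2 (fun x y => f x y) S T) := by
  refine (isBounded_iff.1 (f.bounded hS) T hT).subset ?_
  rintro _ ⟨x, hx, y, hy, rfl⟩
  exact ⟨f x, mem_image_of_mem _ hx, y, hy, rfl⟩

/-- Exchange of the two arguments of a bounded bilinear map. -/
def flip [CompleteBornSpace X] (f : BLin V (BLin W X)) : BLin W (BLin V X) :=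
  mk₂ (fun y x => f x y) (by simp) (by simp) (by simp) (by simp) fun S T hS hT => by
    rw [image2_swap]
    exact f.bounded₂ hT hS

@[simp] theorem flip_apply [CompleteBornSpace X] (f : BLin V (BLin W X)) (y : W) (x : V) :
    f.flip y x = f x y := rfl

/-- Composition as a bounded bilinear map. -/
def compB [CompleteBornSpace W] [CompleteBornSpace X] :
    BLin (BLin W X) (BLin (BLin V W) (BLin V X)) :=
  mk₂ (fun g f => g.comp f) (fun g g' f => rfl) (fun c g f => rfl)
    (fun g f f' => by ext; simp) (fun c g f => by ext; simp) fun S T hS hT => by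
      rw [isBounded_iff] at *
      refine fun R hR => (hS _ (hT R hR)).subset ?_
      rintro _ ⟨_, ⟨g, hg, f, hf, rfl⟩, x, hx, rfl⟩
      exact mem_image2_of_mem hg (mem_image2_of_mem hf hx)

@[simp] theorem compB_apply [CompleteBornSpace W] [CompleteBornSpace X] (g : BLin W X)
    (f : BLin V W) : compB g f = g.comp f := rfl

/-- Scalar multiplication as a bounded bilinear map. -/
def smulB [CompleteBornSpace V] : BLin ℂ (BLin V V) :=
  mk₂ (fun c v => c • v) (fun _ _ _ => add_smul _ _ _) (fun _ _ _ => by rw [smul_assoc])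
    (fun _ _ _ => smul_add _ _ _) (fun _ _ _ => smul_comm _ _ _) fun S T hS hT => by
      obtain ⟨U, hU, hUc, hTU⟩ := exists_completant hT
      obtain ⟨C, hC, hSC⟩ := hS.exists_pos_norm_le
      refine (isBounded_smul (C : ℂ) hU).subset ?_
      rintro _ ⟨c, hc, v, hv, rfl⟩
      exact hUc.1.scale_smul hC.le (ε := 1) (by simpa using hSC c hc) zero_le_one
        (by simpa using hTU hv)

@[simp] theorem smulB_apply [CompleteBornSpace V] (c : ℂ) (v : V) : smulB c v = c • v := rfl

end BLin

instance : CompleteBornSpace ℂ where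
  isBounded_add hS hT := hS.add hT
  isBounded_smul c _ hS := hS.smul₀ c
  exists_completant {S} hS := by
    obtain ⟨C, hC, hSC⟩ := hS.exists_pos_norm_le
    have hne : (C : ℂ) ≠ 0 := by exact_mod_cast hC.ne'
    have hsc : ∀ {ε : ℝ}, 0 < ε → ∀ {x : ℂ}, x ∈ (ε : ℂ) • Metric.closedBall (0 : ℂ) C ↔
        ‖x‖ ≤ ε * C := by
      intro ε hε x
      have hε' : (ε : ℂ) ≠ 0 := by exact_mod_cast hε.ne'
      rw [mem_smul_set_iff_inv_smul_mem₀ hε', mem_closedBall_zero_iff, norm_smul, norm_inv,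
        Complex.norm_real, Real.norm_of_nonneg hε.le, inv_mul_le_iff₀ hε]
    refine ⟨Metric.closedBall 0 C, Metric.isBounded_closedBall,
      ⟨⟨⟨0, by simpa using hC.le⟩, fun x hx y hy a b hab => ?_⟩, fun x hx => ?_,
        fun u _ hcau => ?_⟩, fun x hx => by simpa using hSC x hx⟩
    · rw [mem_closedBall_zero_iff] at *
      calc ‖a • x + b • y‖ ≤ ‖a‖ * ‖x‖ + ‖b‖ * ‖y‖ := by
            rw [← norm_smul, ← norm_smul]; exact norm_add_le _ _
        _ ≤ ‖a‖ * C + ‖b‖ * C := by gcongr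
        _ ≤ C := by nlinarith
    · refine norm_eq_zero.1 (le_antisymm (le_of_forall_pos_le_add fun ε hε => ?_) (norm_nonneg _))
      have := (hsc (ε := ε / C) (by positivity)).1 (hx _ (by positivity))
      rw [div_mul_cancel₀ _ hC.ne'] at this
      linarith
    · obtain ⟨x, hx⟩ := cauchySeq_tendsto_of_complete (u := u)
        (Metric.cauchySeq_iff.2 fun ε hε => by
          obtain ⟨N, hN⟩ := hcau (ε / 2 / C) (by positivity)
          refine ⟨N, fun m hm n hn => ?_⟩
          have := (hsc (by positivity)).1 (hN m hm n hn)
          rw [div_mul_cancel₀ _ hC.ne'] at this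
          rw [dist_eq_norm]
          linarith)
      refine ⟨x, fun ε hε => ?_⟩
      obtain ⟨N, hN⟩ := Metric.tendsto_atTop.1 hx (ε * C) (by positivity)
      refine ⟨N, fun n hn => (hsc hε).2 ?_⟩
      rw [← dist_eq_norm]
      exact (hN n hn).le

/-! ### Quotients by bornologically closed subspaces -/

section Quotient

variable {V : Type*} [AddCommGroup V] [Module ℂ V] [Bornology V]

/-- Bornologically closed subspaces: closed under limits of convergent sequences. -/
def BClosed (N : Submodule ℂ V) : Prop :=
  ∀ (u : ℕ → V) (x : V), (∀ n, u n ∈ N) → BTendsto u atTop x → x ∈ N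

/-- The bornologically closed subspace generated by a set. -/
def closedSpan (r : Set V) : Submodule ℂ V := sInf {N | r ⊆ N ∧ BClosed N}

theorem subset_closedSpan (r : Set V) : r ⊆ closedSpan r := fun _ hx =>
  Submodule.mem_sInf.2 fun _ hN => hN.1 hx

theorem bClosed_closedSpan (r : Set V) : BClosed (closedSpan r) := fun u x hu hx =>
  Submodule.mem_sInf.2 fun N hN => hN.2 u x (fun n => Submodule.mem_sInf.1 (hu n) N hN) hx

theorem closedSpan_le {r : Set V} {N : Submodule ℂ V} (h : r ⊆ N) (hN : BClosed N) :
    closedSpan r ≤ N := sInf_le ⟨h, hN⟩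

theorem bClosed_ker {W : Type*} [AddCommGroup W] [Module ℂ W] [Bornology W]
    [CompleteBornSpace W] (f : BLin V W) : BClosed (LinearMap.ker f.toLinearMap) := by
  intro u x hu hx
  have h1 := f.map_btendsto hx
  have h2 : BTendsto (fun n => f (u n)) atTop (0 : W) := by
    refine ⟨{0}, isBounded_singleton, ⟨singleton_nonempty _, by simp⟩, fun ε hε => ?_⟩
    refine Eventually.of_forall fun n => ⟨0, rfl, ?_⟩
    have : f (u n) = 0 := hu n
    simp [this]
  exact h1.unique h2

/-- The complete bornological quotient of `V` by the closed subspace generated by `r`. -/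
def BQuot (r : Set V) : Type _ := V ⧸ closedSpan r

namespace BQuot

variable (r : Set V)

instance : AddCommGroup (BQuot r) := inferInstanceAs (AddCommGroup (V ⧸ closedSpan r))

instance : Module ℂ (BQuot r) := inferInstanceAs (Module ℂ (V ⧸ closedSpan r))

/-- The quotient map, as a linear map. -/
def mkLin : V →ₗ[ℂ] BQuot r := (closedSpan r).mkQ

theorem mkLin_surjective : Function.Surjective (mkLin r) := Submodule.mkQ_surjective _

theorem mkLin_eq_zero {x : V} : mkLin r x = 0 ↔ x ∈ closedSpan r :=
  Submodule.Quotient.mk_eq_zero _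

/-- The quotient bornology: the small sets are the images of small sets. -/
instance : Bornology (BQuot r) :=
  Bornology.ofBounded {B | ∃ S : Set V, IsBounded S ∧ B ⊆ mkLin r '' S}
    ⟨∅, isBounded_empty, by simp⟩
    (fun B ⟨S, hS, h⟩ B' h' => ⟨S, hS, h'.trans h⟩)
    (fun B ⟨S, hS, h⟩ B' ⟨S', hS', h'⟩ => ⟨S ∪ S', hS.union hS', by
      rw [image_union]; exact union_subset_union h h'⟩)
    (fun x => by
      obtain ⟨y, rfl⟩ := mkLin_surjective r x
      exact ⟨{y}, isBounded_singleton, by simp⟩)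

theorem isBounded_iff {B : Set (BQuot r)} :
    IsBounded B ↔ ∃ S : Set V, IsBounded S ∧ B ⊆ mkLin r '' S :=
  Bornology.isBounded_ofBounded_iff _

/-- The quotient map. -/
def mk : BLin V (BQuot r) := ⟨mkLin r, fun S hS => (isBounded_iff r).2 ⟨S, hS, subset_rfl⟩⟩

theorem mk_surjective : Function.Surjective (mk r) := mkLin_surjective r

theorem mk_eq_zero {x : V} : mk r x = 0 ↔ x ∈ closedSpan r := mkLin_eq_zero r

theorem mem_scale_image {T : Set V} {ε : ℝ} {x : BQuot r} :
    x ∈ (ε : ℂ) • (mk r '' T) ↔ ∃ t ∈ (ε : ℂ) • T, mk r t = x := by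
  constructor
  · rintro ⟨_, ⟨t, ht, rfl⟩, rfl⟩
    exact ⟨(ε : ℂ) • t, smul_mem_smul_set ht, map_smul (mk r) _ _⟩
  · rintro ⟨_, ⟨t, ht, rfl⟩, rfl⟩
    exact ⟨mk r t, mem_image_of_mem _ ht, (map_smul (mk r) (ε : ℂ) t).symm⟩

theorem isCompletantDisk_image {D : Set V} (hD : IsBounded D) (hDc : IsCompletantDisk D) :
    IsCompletantDisk (mk r '' D) := by
  refine ⟨⟨hDc.1.1.image _, ?_⟩, fun x hx => ?_, fun u hu hcau => ?_⟩
  · rintro _ ⟨x, hx, rfl⟩ _ ⟨y, hy, rfl⟩ a b hab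
    exact ⟨a • x + b • y, hDc.1.2 x hx y hy a b hab, by simp⟩
  · obtain ⟨y, rfl⟩ := mk_surjective r x
    choose d hd hdy using fun n : ℕ => (mem_scale_image r).1
      (hx (1 / ((n : ℝ) + 1)) (by positivity))
    refine (mk_eq_zero r).2 (bClosed_closedSpan r (fun n => y - d n) y (fun n => ?_) ?_)
    · rw [← mk_eq_zero, map_sub, hdy, sub_self]
    · refine ⟨D, hD, hDc.1, fun ε hε => ?_⟩
      obtain ⟨N, hN⟩ := exists_nat_one_div_lt hε
      filter_upwards [eventually_ge_atTop N] with n hn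
      have := hDc.1.scale_neg (by positivity) (hd n)
      rw [sub_sub_cancel_left]
      exact hDc.1.scale_mono (by positivity) ((Nat.one_div_le_one_div hn).trans hN.le) this
  · -- choose a rapidly converging subsequence and lift it
    have hpow : ∀ j : ℕ, (0 : ℝ) < (1 / 2) ^ j := fun j => by positivity
    choose N hN using fun j : ℕ => hcau ((1 / 2) ^ j) (hpow j)
    set k : ℕ → ℕ := fun j => ∑ i ∈ Finset.range (j + 1), N i with hk
    have hkN : ∀ j, N j ≤ k j := fun j =>
      Finset.single_le_sum (f := N) (fun _ _ => Nat.zero_le _) (Finset.self_mem_range_succ j)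
    have hkmono : ∀ j, k j ≤ k (j + 1) := fun j => by
      simp only [hk]
      rw [Finset.sum_range_succ _ (j + 1)]
      exact Nat.le_add_right _ _
    choose d hd hdu using fun j : ℕ => (mem_scale_image r).1
      (hN j (k (j + 1)) ((hkN j).trans (hkmono j)) (k j) (hkN j))
    obtain ⟨y₀, hy₀, hy₀u⟩ : ∃ y₀ ∈ Submodule.span ℂ D, mk r y₀ = u (k 0) := by
      have h1 : u (k 0) ∈ (Submodule.span ℂ D).map (mkLin r) := by
        rw [Submodule.map_span]
        exact hu (k 0)
      exact h1
    set y : ℕ → V := fun j => y₀ + ∑ i ∈ Finset.range j, d i with hy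
    have hysucc : ∀ j, y (j + 1) = y j + d j := fun j => by
      simp only [hy, Finset.sum_range_succ, add_assoc]
    have hyu : ∀ j, mk r (y j) = u (k j) := by
      intro j
      induction j with
      | zero => simpa [hy] using hy₀u
      | succ j ih => rw [hysucc, map_add, ih, hdu]; abel
    have hdiff : ∀ n l : ℕ, y (n + l) - y n ∈
        ((2 * (1 / 2) ^ n - 2 * (1 / 2) ^ (n + l) : ℝ) : ℂ) • D := by
      intro n l
      induction l with
      | zero => simpa using hDc.1.zero_mem_scale 0
      | succ l ih =>
        have hle : ((1 : ℝ) / 2) ^ (n + l) ≤ (1 / 2) ^ n :=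
          pow_le_pow_of_le_one (by norm_num) (by norm_num) (Nat.le_add_right _ _)
        have := hDc.1.scale_add (by linarith) (hpow _).le ih (hd (n + l))
        have e1 : y (n + l) - y n + d (n + l) = y (n + (l + 1)) - y n := by
          rw [← add_assoc n l 1, hysucc]; abel
        rw [e1] at this
        refine hDc.1.scale_mono (by linarith [hpow (n + l)]) (le_of_eq ?_) this
        rw [← add_assoc n l 1, pow_succ _ (n + l)]
        ring
    have hdiff' : ∀ n m : ℕ, n ≤ m → y m - y n ∈ ((2 * (1 / 2) ^ n : ℝ) : ℂ) • D := by
      intro n m hnm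
      obtain ⟨l, rfl⟩ := Nat.exists_eq_add_of_le hnm
      have hle : ((1 : ℝ) / 2) ^ (n + l) ≤ (1 / 2) ^ n :=
        pow_le_pow_of_le_one (by norm_num) (by norm_num) (Nat.le_add_right _ _)
      exact hDc.1.scale_mono (by linarith) (by linarith [hpow (n + l)]) (hdiff n l)
    obtain ⟨x, hx⟩ := hDc.2.2 y
      (fun n => Submodule.add_mem _ hy₀ (Submodule.sum_mem _ fun i _ => by
        obtain ⟨t, ht, h⟩ := hd i
        rw [← h]
        exact Submodule.smul_mem _ _ (Submodule.subset_span ht)))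
      (by
        intro ε hε
        obtain ⟨M, hM⟩ := exists_pow_lt_of_lt_one (show (0 : ℝ) < ε / 4 by positivity)
          (show (1 / 2 : ℝ) < 1 by norm_num)
        refine ⟨M, fun m hm n hn => ?_⟩
        have h1 := hDc.1.scale_sub (by positivity) (by positivity) (hdiff' M m hm) (hdiff' M n hn)
        rw [sub_sub_sub_cancel_right] at h1
        exact hDc.1.scale_mono (by positivity) (by linarith) h1)
    refine ⟨mk r x, fun ε hε => ?_⟩
    obtain ⟨M, hM⟩ := exists_pow_lt_of_lt_one (show (0 : ℝ) < ε / 2 by positivity)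
      (show (1 / 2 : ℝ) < 1 by norm_num)
    obtain ⟨L, hL⟩ := hx (ε / 2) (half_pos hε)
    set j := max M L
    refine ⟨k j, fun n hn => ?_⟩
    obtain ⟨t, ht, htu⟩ := (mem_scale_image r).1 (hN j n ((hkN j).trans hn) (k j) (hkN j))
    have h1 := hDc.1.scale_add (by positivity) (by positivity) ht (hL j (le_max_right _ _))
    refine (mem_scale_image r).2 ⟨t + (y j - x), hDc.1.scale_mono (by positivity) ?_ h1, ?_⟩
    · have : ((1 : ℝ) / 2) ^ j ≤ (1 / 2) ^ M :=
        pow_le_pow_of_le_one (by norm_num) (by norm_num) (le_max_left _ _)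
      linarith
    · rw [map_add, map_sub, htu, hyu]
      abel

instance [CompleteBornSpace V] : CompleteBornSpace (BQuot r) where
  isBounded_add {B B'} hB hB' := by
    obtain ⟨S, hS, h⟩ := (isBounded_iff r).1 hB
    obtain ⟨S', hS', h'⟩ := (isBounded_iff r).1 hB'
    refine (isBounded_iff r).2 ⟨S + S', isBounded_add hS hS', ?_⟩
    rw [image_add]
    exact add_subset_add h h'
  isBounded_smul c {B} hB := by
    obtain ⟨S, hS, h⟩ := (isBounded_iff r).1 hB
    refine (isBounded_iff r).2 ⟨c • S, isBounded_smul c hS, ?_⟩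
    rw [image_smul_set]
    exact smul_set_mono h
  exists_completant {B} hB := by
    obtain ⟨S, hS, h⟩ := (isBounded_iff r).1 hB
    obtain ⟨D, hD, hDc, hSD⟩ := exists_completant hS
    exact ⟨mk r '' D, (mk r).bounded hD, isCompletantDisk_image r hD hDc,
      h.trans (image_mono hSD)⟩

variable {r}

/-- Bounded linear maps killing `r` descend to the quotient. -/
def lift {W : Type*} [AddCommGroup W] [Module ℂ W] [Bornology W] [CompleteBornSpace W]
    (f : BLin V W) (hf : ∀ x ∈ r, f x = 0) : BLin (BQuot r) W :=
  ⟨(closedSpan r).liftQ f.toLinearMap (closedSpan_le hf (bClosed_ker f)), fun B hB => by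
    obtain ⟨S, hS, h⟩ := (isBounded_iff r).1 hB
    refine (f.bounded hS).subset ((image_mono h).trans ?_)
    rintro _ ⟨_, ⟨x, hx, rfl⟩, rfl⟩
    exact ⟨x, hx, rfl⟩⟩

@[simp] theorem lift_mk {W : Type*} [AddCommGroup W] [Module ℂ W] [Bornology W]
    [CompleteBornSpace W] (f : BLin V W) (hf : ∀ x ∈ r, f x = 0) (x : V) :
    lift f hf (mk r x) = f x := rfl

end BQuot

end Quotient

/-! ### The completed bornological tensor product -/

section Tensor

variable (V W : Type*) [AddCommGroup V] [Module ℂ V] [Bornology V]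
  [AddCommGroup W] [Module ℂ W] [Bornology W]

/-- The absolutely summable families of coefficients `c` on `V × W` supported in a product of
two small sets; `c` stands for the formal series `∑ c (v, w) • (v ⊗ w)`. -/
def FormalTensor : Submodule ℂ (V × W → ℂ) where
  carrier := {c | (Summable fun p => ‖c p‖) ∧
    ∃ (S : Set V) (T : Set W), IsBounded S ∧ IsBounded T ∧ ∀ p, c p ≠ 0 → p ∈ S ×ˢ T}
  zero_mem' := ⟨by simp, ∅, ∅, isBounded_empty, isBounded_empty, by simp⟩
  add_mem' := by
    rintro c d ⟨hc, S, T, hS, hT, h⟩ ⟨hd, S', T', hS', hT', h'⟩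
    refine ⟨(hc.add hd).of_nonneg_of_le (fun _ => norm_nonneg _) (fun p => norm_add_le _ _),
      S ∪ S', T ∪ T', hS.union hS', hT.union hT', fun p hp => ?_⟩
    by_cases h0 : c p = 0
    · have := h' p (by simpa [h0] using hp)
      exact ⟨Or.inr this.1, Or.inr this.2⟩
    · exact ⟨Or.inl (h p h0).1, Or.inl (h p h0).2⟩
  smul_mem' := by
    rintro a c ⟨hc, S, T, hS, hT, h⟩
    refine ⟨by simpa using hc.mul_left ‖a‖, S, T, hS, hT, fun p hp => h p fun h0 => hp ?_⟩
    simp [h0]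

namespace FormalTensor

variable {V W}

/-- The unit ball of the absolutely summable families supported in `S ×ˢ T`. -/
def ball (S : Set V) (T : Set W) : Set (FormalTensor V W) :=
  {c | (∀ p, c.1 p ≠ 0 → p ∈ S ×ˢ T) ∧ ∀ s : Finset (V × W), ∑ p ∈ s, ‖c.1 p‖ ≤ 1}

theorem ball_mono {S S' : Set V} {T T' : Set W} (hS : S ⊆ S') (hT : T ⊆ T') :
    ball S T ⊆ ball S' T' := fun _ hc =>
  ⟨fun p hp => prod_mono hS hT (hc.1 p hp), hc.2⟩

theorem mem_scale_ball {S : Set V} {T : Set W} {ε : ℝ} (hε : 0 < ε) {c : FormalTensor V W} :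
    c ∈ (ε : ℂ) • ball S T ↔
      (∀ p, c.1 p ≠ 0 → p ∈ S ×ˢ T) ∧ ∀ s : Finset (V × W), ∑ p ∈ s, ‖c.1 p‖ ≤ ε := by
  have hne : (ε : ℂ) ≠ 0 := by exact_mod_cast hε.ne'
  rw [mem_smul_set_iff_inv_smul_mem₀ hne]
  have h1 : ∀ p, (((ε : ℂ)⁻¹ • c : FormalTensor V W)).1 p = (ε : ℂ)⁻¹ * c.1 p := fun p => rfl
  simp only [ball, mem_ofPred_eq, h1]
  refine and_congr (forall_congr' fun p => ?_) (forall_congr' fun s => ?_)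
  · simp [hε.ne']
  · simp only [norm_mul, norm_inv, Complex.norm_real, Real.norm_of_nonneg hε.le]
    rw [← Finset.mul_sum, inv_mul_le_iff₀ hε, mul_one]

theorem isDisk_ball (S : Set V) (T : Set W) : IsDisk (ball S T) := by
  refine ⟨⟨0, fun p hp => absurd rfl hp, fun s => ?_⟩, ?_⟩
  · have : ∀ p, (0 : FormalTensor V W).1 p = 0 := fun _ => rfl
    simp [this]
  · rintro c ⟨hc, hc'⟩ d ⟨hd, hd'⟩ a b hab
    have h1 : ∀ p, (a • c + b • d : FormalTensor V W).1 p = a * c.1 p + b * d.1 p := fun _ => rfl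
    refine ⟨fun p hp => ?_, fun s => ?_⟩
    · by_cases h0 : c.1 p = 0
      · exact hd p fun h2 => hp (by rw [h1, h0, h2]; simp)
      · exact hc p h0
    · calc ∑ p ∈ s, ‖(a • c + b • d : FormalTensor V W).1 p‖
          ≤ ∑ p ∈ s, (‖a‖ * ‖c.1 p‖ + ‖b‖ * ‖d.1 p‖) := Finset.sum_le_sum fun p _ => by
            rw [h1, ← norm_mul, ← norm_mul]; exact norm_add_le _ _
        _ = ‖a‖ * ∑ p ∈ s, ‖c.1 p‖ + ‖b‖ * ∑ p ∈ s, ‖d.1 p‖ := by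
            rw [Finset.sum_add_distrib, Finset.mul_sum, Finset.mul_sum]
        _ ≤ ‖a‖ * 1 + ‖b‖ * 1 := by
            gcongr
            · exact hc' s
            · exact hd' s
        _ ≤ 1 := by linarith

theorem isCompletantDisk_ball {S : Set V} {T : Set W} (hS : IsBounded S) (hT : IsBounded T) :
    IsCompletantDisk (ball S T) := by
  refine ⟨isDisk_ball S T, fun c hc => ?_, fun u _ hcau => ?_⟩
  · refine Subtype.ext (funext fun p => norm_eq_zero.1 (le_antisymm ?_ (norm_nonneg _)))
    refine le_of_forall_pos_le_add fun ε hε => ?_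
    simpa using ((mem_scale_ball hε).1 (hc ε hε)).2 {p}
  · have hsub : ∀ m n p, (u m - u n : FormalTensor V W).1 p = (u m).1 p - (u n).1 p :=
      fun _ _ _ => rfl
    have hpt : ∀ p, ∃ z : ℂ, Tendsto (fun n => (u n).1 p) atTop (nhds z) := by
      intro p
      refine cauchySeq_tendsto_of_complete (Metric.cauchySeq_iff.2 fun ε hε => ?_)
      obtain ⟨N, hN⟩ := hcau (ε / 2) (half_pos hε)
      refine ⟨N, fun m hm n hn => ?_⟩
      have := ((mem_scale_ball (half_pos hε)).1 (hN m hm n hn)).2 {p}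
      rw [Finset.sum_singleton, hsub] at this
      rw [dist_eq_norm]
      linarith
    choose z hz using hpt
    have hle : ∀ ε : ℝ, 0 < ε → ∃ N, ∀ n ≥ N, (∀ p, (u n).1 p - z p ≠ 0 → p ∈ S ×ˢ T) ∧
        ∀ s : Finset (V × W), ∑ p ∈ s, ‖(u n).1 p - z p‖ ≤ ε := by
      intro ε hε
      obtain ⟨N, hN⟩ := hcau ε hε
      refine ⟨N, fun n hn => ⟨fun p hp => ?_, fun s => ?_⟩⟩
      · by_contra hpS
        refine hp (sub_eq_zero.2 ?_)
        refine tendsto_nhds_unique (tendsto_const_nhds.congr' ?_) (hz p)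
        filter_upwards [eventually_ge_atTop N] with m hm
        by_contra hne
        exact hpS (((mem_scale_ball hε).1 (hN n hn m hm)).1 p (by
          rw [hsub]; exact sub_ne_zero.2 hne))
      · have h1 : Tendsto (fun m => ∑ p ∈ s, ‖(u n).1 p - (u m).1 p‖) atTop
            (nhds (∑ p ∈ s, ‖(u n).1 p - z p‖)) :=
          tendsto_finsetSum _ fun p _ => (tendsto_const_nhds.sub (hz p)).norm
        refine le_of_tendsto h1 ?_
        filter_upwards [eventually_ge_atTop N] with m hm
        exact ((mem_scale_ball hε).1 (hN n hn m hm)).2 s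
    obtain ⟨N, hN⟩ := hle 1 one_pos
    have hmem : (fun p => (u N).1 p - z p) ∈ FormalTensor V W :=
      ⟨summable_of_sum_le (fun _ => norm_nonneg _) (hN N le_rfl).2, S, T, hS, hT,
        (hN N le_rfl).1⟩
    have hzmem : z ∈ FormalTensor V W := by
      have := Submodule.sub_mem _ (u N).2 hmem
      convert this using 1
      funext p
      simp
    refine ⟨⟨z, hzmem⟩, fun ε hε => ?_⟩
    obtain ⟨M, hM⟩ := hle ε hε
    exact ⟨M, fun n hn => (mem_scale_ball hε).2 (hM n hn)⟩

/-- The small sets of formal tensors: uniformly supported in a product of small sets and with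
uniformly bounded `ℓ¹`-norms. -/
instance : Bornology (FormalTensor V W) :=
  Bornology.ofBounded {B | ∃ (S : Set V) (T : Set W) (C : ℝ), IsBounded S ∧ IsBounded T ∧ 0 < C ∧
      B ⊆ (C : ℂ) • ball S T}
    ⟨∅, ∅, 1, isBounded_empty, isBounded_empty, one_pos, by simp⟩
    (fun B ⟨S, T, C, hS, hT, hC, h⟩ B' h' => ⟨S, T, C, hS, hT, hC, h'.trans h⟩)
    (fun B ⟨S, T, C, hS, hT, hC, h⟩ B' ⟨S', T', C', hS', hT', hC', h'⟩ => by
      refine ⟨S ∪ S', T ∪ T', C + C', hS.union hS', hT.union hT', by positivity,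
        union_subset (fun c hc => ?_) (fun c hc => ?_)⟩
      · exact (isDisk_ball _ _).scale_mono hC.le (by linarith)
          (smul_set_mono (ball_mono subset_union_left subset_union_left) (h hc))
      · exact (isDisk_ball _ _).scale_mono hC'.le (by linarith)
          (smul_set_mono (ball_mono subset_union_right subset_union_right) (h' hc)))
    (fun c => by
      obtain ⟨hc, S, T, hS, hT, h⟩ := c.2
      have hpos : 0 < (∑' p, ‖c.1 p‖) + 1 := by
        have : 0 ≤ ∑' p, ‖c.1 p‖ := tsum_nonneg fun _ => norm_nonneg _
        linarith
      refine ⟨S, T, (∑' p, ‖c.1 p‖) + 1, hS, hT, hpos,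
        singleton_subset_iff.2 ((mem_scale_ball hpos).2 ⟨h, fun s => ?_⟩)⟩
      exact (hc.sum_le_tsum s fun _ _ => norm_nonneg _).trans (by linarith))

theorem isBounded_iff {B : Set (FormalTensor V W)} : IsBounded B ↔
    ∃ (S : Set V) (T : Set W) (C : ℝ), IsBounded S ∧ IsBounded T ∧ 0 < C ∧
      B ⊆ (C : ℂ) • ball S T :=
  Bornology.isBounded_ofBounded_iff _

theorem isBounded_ball {S : Set V} {T : Set W} (hS : IsBounded S) (hT : IsBounded T) (C : ℝ)
    (hC : 0 < C) : IsBounded ((C : ℂ) • ball S T) :=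
  isBounded_iff.2 ⟨S, T, C, hS, hT, hC, subset_rfl⟩

instance : CompleteBornSpace (FormalTensor V W) where
  isBounded_add {B B'} hB hB' := by
    obtain ⟨S, T, C, hS, hT, hC, h⟩ := isBounded_iff.1 hB
    obtain ⟨S', T', C', hS', hT', hC', h'⟩ := isBounded_iff.1 hB'
    refine isBounded_iff.2 ⟨S ∪ S', T ∪ T', C + C', hS.union hS', hT.union hT', by positivity, ?_⟩
    rintro _ ⟨c, hc, d, hd, rfl⟩
    exact (isDisk_ball _ _).scale_add hC.le hC'.le
      (smul_set_mono (ball_mono subset_union_left subset_union_left) (h hc))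
      (smul_set_mono (ball_mono subset_union_right subset_union_right) (h' hd))
  isBounded_smul a {B} hB := by
    obtain ⟨S, T, C, hS, hT, hC, h⟩ := isBounded_iff.1 hB
    refine isBounded_iff.2 ⟨S, T, (‖a‖ + 1) * C, hS, hT, by positivity, ?_⟩
    rintro _ ⟨c, hc, rfl⟩
    refine (isDisk_ball _ _).scale_smul (by positivity) ?_ hC.le (h hc)
    gcongr
    linarith
  exists_completant {B} hB := by
    obtain ⟨S, T, C, hS, hT, hC, h⟩ := isBounded_iff.1 hB
    have hne : (C : ℂ) ≠ 0 := by exact_mod_cast hC.ne'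
    have hsc : ∀ {ε : ℝ}, (ε : ℂ) • (C : ℂ) • ball S T = ((ε * C : ℝ) : ℂ) • ball S T := by
      intro ε
      rw [smul_smul, Complex.ofReal_mul]
    refine ⟨(C : ℂ) • ball S T, isBounded_ball hS hT C hC, ⟨⟨(isDisk_ball S T).1.smul_set, ?_⟩,
      fun x hx => ?_, fun u hu hcau => ?_⟩, h⟩
    · rintro _ ⟨c, hc, rfl⟩ _ ⟨d, hd, rfl⟩ a b hab
      refine ⟨a • c + b • d, (isDisk_ball S T).2 c hc d hd a b hab, ?_⟩
      simp only [smul_add]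
      rw [smul_comm _ a, smul_comm _ b]
    · refine (isCompletantDisk_ball hS hT).2.1 x fun ε hε => ?_
      have := hx (ε / C) (by positivity)
      rwa [hsc, div_mul_cancel₀ _ hC.ne'] at this
    · obtain ⟨x, hx⟩ := (isCompletantDisk_ball hS hT).2.2 u
        (fun n => Submodule.span_le.2 (by
          rintro _ ⟨c, hc, rfl⟩
          exact Submodule.smul_mem _ _ (Submodule.subset_span hc)) (hu n))
        (fun ε hε => by
          obtain ⟨N, hN⟩ := hcau (ε / C) (by positivity)
          refine ⟨N, fun m hm n hn => ?_⟩
          have := hN m hm n hn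
          rwa [hsc, div_mul_cancel₀ _ hC.ne'] at this)
      refine ⟨x, fun ε hε => ?_⟩
      obtain ⟨N, hN⟩ := hx (ε * C) (by positivity)
      refine ⟨N, fun n hn => ?_⟩
      rw [hsc]
      exact hN n hn

open Classical in
/-- The formal tensor `v ⊗ w`. -/
def single (v : V) (w : W) : FormalTensor V W :=
  ⟨Pi.single (v, w) 1, summable_of_ne_finset_zero (s := {(v, w)}) (fun p hp => by
      rw [Finset.mem_singleton] at hp
      simp [hp]),
    {v}, {w}, isBounded_singleton, isBounded_singleton, fun p hp => by
      by_contra h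
      refine hp (Pi.single_eq_of_ne (fun h' => h ?_) _)
      simp [h']⟩

theorem single_self (v : V) (w : W) : (single v w).1 (v, w) = 1 := by
  simp [single]

theorem single_of_ne {v : V} {w : W} {p : V × W} (h : p ≠ (v, w)) : (single v w).1 p = 0 := by
  simp [single, h]

theorem single_mem_ball {S : Set V} {T : Set W} {v : V} {w : W} (hv : v ∈ S) (hw : w ∈ T) :
    single v w ∈ ball S T := by
  classical
  refine ⟨fun p hp => ?_, fun s => ?_⟩
  · by_contra h
    exact hp (single_of_ne fun h' => h (by rw [h']; exact ⟨hv, hw⟩))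
  · calc ∑ p ∈ s, ‖(single v w).1 p‖ ≤ ∑ p ∈ s, if p = (v, w) then (1 : ℝ) else 0 :=
        Finset.sum_le_sum fun p _ => by
          by_cases h : p = (v, w)
          · subst h; simp [single_self]
          · simp [single_of_ne h, h]
      _ ≤ 1 := by
        rw [Finset.sum_ite_eq']
        split_ifs <;> norm_num

end FormalTensor

/-- The relations expressing bilinearity of `v ⊗ w`. -/
inductive TensorRel : FormalTensor V W → Prop
  | add_left (v v' : V) (w : W) : TensorRel (FormalTensor.single (v + v') w -
      FormalTensor.single v w - FormalTensor.single v' w)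
  | add_right (v : V) (w w' : W) : TensorRel (FormalTensor.single v (w + w') -
      FormalTensor.single v w - FormalTensor.single v w')
  | smul_left (a : ℂ) (v : V) (w : W) : TensorRel (FormalTensor.single (a • v) w -
      a • FormalTensor.single v w)
  | smul_right (a : ℂ) (v : V) (w : W) : TensorRel (FormalTensor.single v (a • w) -
      a • FormalTensor.single v w)

/-- The completed bornological tensor product of complete bornological vector spaces, the
universal target of bounded bilinear maps on `V × W` (see `BTensor.lift` and `BTensor.ext`). -/
def BTensor : Type _ := BQuot {x | TensorRel V W x}

namespace BTensor

instance : AddCommGroup (BTensor V W) := inferInstanceAs (AddCommGroup (BQuot _))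
instance : Module ℂ (BTensor V W) := inferInstanceAs (Module ℂ (BQuot _))
instance : Bornology (BTensor V W) := inferInstanceAs (Bornology (BQuot _))
instance : CompleteBornSpace (BTensor V W) := inferInstanceAs (CompleteBornSpace (BQuot _))

/-- The quotient map from formal tensors. -/
def proj : BLin (FormalTensor V W) (BTensor V W) := BQuot.mk _

theorem proj_surjective : Function.Surjective (proj V W) := BQuot.mk_surjective _

variable {V W}

theorem proj_eq_zero {x : FormalTensor V W} (h : TensorRel V W x) : proj V W x = 0 :=
  (BQuot.mk_eq_zero _).2 (subset_closedSpan _ h)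

/-- The universal bounded bilinear map `(v, w) ↦ v ⊗ w`. -/
def tmul : BLin V (BLin W (BTensor V W)) :=
  BLin.mk₂ (fun v w => proj V W (FormalTensor.single v w))
    (fun v v' w => by
      have := proj_eq_zero (TensorRel.add_left v v' w)
      rw [map_sub, map_sub, sub_sub, sub_eq_zero] at this
      exact this)
    (fun a v w => by
      have := proj_eq_zero (TensorRel.smul_left a v w)
      rw [map_sub, map_smul, sub_eq_zero] at this
      exact this)
    (fun v w w' => by
      have := proj_eq_zero (TensorRel.add_right v w w')
      rw [map_sub, map_sub, sub_sub, sub_eq_zero] at this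
      exact this)
    (fun a v w => by
      have := proj_eq_zero (TensorRel.smul_right a v w)
      rw [map_sub, map_smul, sub_eq_zero] at this
      exact this)
    (fun S T hS hT => by
      refine ((proj V W).bounded (FormalTensor.isBounded_ball hS hT 1 one_pos)).subset ?_
      rintro _ ⟨v, hv, w, hw, rfl⟩
      refine mem_image_of_mem _ ?_
      rw [Complex.ofReal_one, one_smul]
      exact FormalTensor.single_mem_ball hv hw)

variable {X : Type*} [AddCommGroup X] [Module ℂ X] [Bornology X] [CompleteBornSpace X]

theorem exists_sum (f : BLin V (BLin W X)) (c : FormalTensor V W) :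
    ∃ x, BTendsto (fun s : Finset (V × W) => ∑ p ∈ s, c.1 p • f p.1 p.2) atTop x := by
  obtain ⟨hc, S, T, hS, hT, h⟩ := c.2
  obtain ⟨U, hU, hUc, hST⟩ := exists_completant (f.bounded₂ hS hT)
  obtain ⟨x, hx, -⟩ := exists_bsum hU hUc c.1 (fun p => f p.1 p.2) hc fun p hp =>
    hST (mem_image2_of_mem (h p hp).1 (h p hp).2)
  exact ⟨x, hx⟩

theorem choose_mem (f : BLin V (BLin W X)) {S : Set V} {T : Set W} {U : Set X} (hU : IsBounded U)
    (hUc : IsCompletantDisk U) (h : ∀ v ∈ S, ∀ w ∈ T, f v w ∈ U) {C : ℝ} (hC : 0 < C)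
    {c : FormalTensor V W} (hc : c ∈ (C : ℂ) • FormalTensor.ball S T) :
    (exists_sum f c).choose ∈ ((1 + C : ℝ) : ℂ) • U := by
  obtain ⟨hcS, hcC⟩ := (FormalTensor.mem_scale_ball hC).1 hc
  obtain ⟨x, hx, hxC⟩ := exists_bsum hU hUc c.1 (fun p => f p.1 p.2) c.2.1 fun p hp =>
    h _ (hcS p hp).1 _ (hcS p hp).2
  rw [(exists_sum f c).choose_spec.unique hx]
  exact hxC C hcC

/-- The linear extension `∑ c (v, w) • f v w` of a bounded bilinear map `f` to formal tensors. -/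
def liftFormal (f : BLin V (BLin W X)) : BLin (FormalTensor V W) X where
  toFun c := (exists_sum f c).choose
  map_add' c d := by
    refine (exists_sum f (c + d)).choose_spec.unique ?_
    refine cast ?_ ((exists_sum f c).choose_spec.add (exists_sum f d).choose_spec)
    congr 1
    funext s
    rw [← Finset.sum_add_distrib]
    exact Finset.sum_congr rfl fun p _ => (add_smul _ _ _).symm
  map_smul' a c := by
    refine (exists_sum f (a • c)).choose_spec.unique ?_
    refine cast ?_ ((exists_sum f c).choose_spec.smul a)
    congr 1
    funext s
    rw [Finset.smul_sum]
    exact Finset.sum_congr rfl fun p _ => (mul_smul _ _ _).symm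
  bounded' B hB := by
    obtain ⟨S, T, C, hS, hT, hC, h⟩ := FormalTensor.isBounded_iff.1 hB
    obtain ⟨U, hU, hUc, hST⟩ := exists_completant (f.bounded₂ hS hT)
    refine (isBounded_smul ((1 + C : ℝ) : ℂ) hU).subset ?_
    rintro _ ⟨c, hc, rfl⟩
    exact choose_mem f hU hUc (fun v hv w hw => hST (mem_image2_of_mem hv hw)) hC (h hc)

theorem liftFormal_mem (f : BLin V (BLin W X)) {S : Set V} {T : Set W} {U : Set X}
    (hU : IsBounded U) (hUc : IsCompletantDisk U) (h : ∀ v ∈ S, ∀ w ∈ T, f v w ∈ U) {C : ℝ}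
    (hC : 0 < C) {c : FormalTensor V W} (hc : c ∈ (C : ℂ) • FormalTensor.ball S T) :
    liftFormal f c ∈ ((1 + C : ℝ) : ℂ) • U := choose_mem f hU hUc h hC hc

theorem liftFormal_single (f : BLin V (BLin W X)) (v : V) (w : W) :
    liftFormal f (FormalTensor.single v w) = f v w := by
  classical
  refine (exists_sum f (FormalTensor.single v w)).choose_spec.unique
    ⟨{0}, isBounded_singleton, ⟨singleton_nonempty _, by simp⟩, fun ε hε => ?_⟩
  filter_upwards [eventually_ge_atTop {(v, w)}] with s hs
  refine ⟨0, rfl, ?_⟩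
  rw [Finset.sum_eq_single_of_mem (v, w) (hs (Finset.mem_singleton_self _))
    (fun p _ hp => by rw [FormalTensor.single_of_ne hp, zero_smul]), FormalTensor.single_self]
  simp

/-- Bounded linear maps out of the tensor product from bounded bilinear maps. -/
def lift (f : BLin V (BLin W X)) : BLin (BTensor V W) X :=
  BQuot.lift (liftFormal f) (by
    rintro x (⟨v, v', w⟩ | ⟨v, w, w'⟩ | ⟨a, v, w⟩ | ⟨a, v, w⟩) <;>
      simp [liftFormal_single])

theorem lift_proj (f : BLin V (BLin W X)) (c : FormalTensor V W) :
    lift f (proj V W c) = liftFormal f c := rfl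

@[simp] theorem lift_tmul (f : BLin V (BLin W X)) (v : V) (w : W) :
    lift f (tmul v w) = f v w := liftFormal_single f v w

/-- Bounded linear maps on the tensor product are determined by their values on `v ⊗ w`. -/
theorem ext {f g : BLin (BTensor V W) X} (h : ∀ v w, f (tmul v w) = g (tmul v w)) : f = g := by
  have key : ∀ d : BLin (FormalTensor V W) X, (∀ v w, d (FormalTensor.single v w) = 0) →
      ∀ c, d c = 0 := by
    intro d hd c
    obtain ⟨hc, S, T, hS, hT, hcS⟩ := c.2
    refine eq_zero_of_scale
      (d.bounded (FormalTensor.isBounded_ball hS hT 1 one_pos)) fun ε hε => ?_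
    obtain ⟨s, hs⟩ := summable_iff_vanishing_norm.1 hc ε hε
    set e : FormalTensor V W := c - ∑ p ∈ s, c.1 p • FormalTensor.single p.1 p.2 with he
    have hde : d c = d e := by simp [he, hd]
    classical
    have hval : ∀ q, e.1 q = if q ∈ s then 0 else c.1 q := by
      intro q
      have h1 : e.1 q = c.1 q - ∑ p ∈ s, c.1 p * (FormalTensor.single p.1 p.2).1 q := by
        rw [he]
        simp
      rw [h1]
      split_ifs with hq
      · rw [Finset.sum_eq_single_of_mem q hq fun p _ hp => by
          rw [FormalTensor.single_of_ne (Ne.symm hp), mul_zero]]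
        rw [FormalTensor.single_self, mul_one, sub_self]
      · rw [Finset.sum_eq_zero, sub_zero]
        intro p hp
        rw [FormalTensor.single_of_ne (fun h => hq (by rw [h]; exact hp)), mul_zero]
    have hemem : e ∈ (ε : ℂ) • FormalTensor.ball S T := by
      refine (FormalTensor.mem_scale_ball hε).2 ⟨fun p hp => ?_, fun t => ?_⟩
      · rw [hval] at hp
        exact hcS p fun h0 => hp (by simp [h0])
      · have h1 : ∑ p ∈ t, ‖e.1 p‖ = ∑ p ∈ t \ s, ‖c.1 p‖ := by
          rw [Finset.sdiff_eq_filter, Finset.sum_filter]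
          refine Finset.sum_congr rfl fun p _ => ?_
          rw [hval]
          by_cases hp : p ∈ s <;> simp [hp]
        rw [h1]
        exact (le_abs_self _).trans (hs _ Finset.sdiff_disjoint).le
    rw [hde]
    obtain ⟨b, hb, hbe⟩ := hemem
    refine ⟨d b, mem_image_of_mem _ ?_, ?_⟩
    · rwa [Complex.ofReal_one, one_smul]
    · rw [← hbe]
      exact (map_smul d (ε : ℂ) b).symm
  refine BLin.ext fun x => ?_
  obtain ⟨c, rfl⟩ := proj_surjective V W x
  have := key ((f - g).comp (proj V W)) (fun v w => by
    rw [BLin.comp_apply, BLin.sub_apply, sub_eq_zero]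
    exact h v w) c
  rw [BLin.comp_apply, BLin.sub_apply, sub_eq_zero] at this
  exact this

theorem ext_apply {f g : BLin (BTensor V W) X} (h : ∀ v w, f (tmul v w) = g (tmul v w))
    (x : BTensor V W) : f x = g x := by rw [ext h]

/-- `lift` as a bounded linear map. -/
def liftB : BLin (BLin V (BLin W X)) (BLin (BTensor V W) X) where
  toFun := lift
  map_add' f g := ext fun v w => by simp
  map_smul' a f := ext fun v w => by simp
  bounded' L hL := by
    rw [BLin.isBounded_iff]
    intro B hB
    obtain ⟨B', hB', hBB'⟩ := (BQuot.isBounded_iff _).1 hB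
    obtain ⟨S, T, C, hS, hT, hC, h⟩ := FormalTensor.isBounded_iff.1 hB'
    obtain ⟨U, hU, hUc, hST⟩ := exists_completant
      (BLin.isBounded_iff.1 (BLin.isBounded_iff.1 hL S hS) T hT)
    refine (isBounded_smul ((1 + C : ℝ) : ℂ) hU).subset ?_
    rintro _ ⟨_, ⟨f, hf, rfl⟩, x, hx, rfl⟩
    obtain ⟨c, hc, rfl⟩ := hBB' hx
    exact liftFormal_mem f hU hUc
      (fun v hv w hw => hST (mem_image2_of_mem (mem_image2_of_mem hf hv) hw)) hC (h hc)

@[simp] theorem liftB_apply (f : BLin V (BLin W X)) : liftB f = lift f := rfl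

variable {V' W' X' : Type*} [AddCommGroup V'] [Module ℂ V'] [Bornology V']
  [AddCommGroup W'] [Module ℂ W'] [Bornology W']
  [AddCommGroup X'] [Module ℂ X'] [Bornology X'] [CompleteBornSpace X']
  [CompleteBornSpace V'] [CompleteBornSpace W']

/-- The tensor product `f ⊗ g` of bounded linear maps, as a bounded bilinear map in `f`, `g`. -/
def mapB : BLin (BLin V V') (BLin (BLin W W') (BLin (BTensor V W) (BTensor V' W'))) :=
  ((BLin.compB liftB).comp ((BLin.compB.flip (BLin.compB tmul)).comp
    (BLin.compB.comp BLin.compB.flip))).flip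

/-- The tensor product `f ⊗ g` of bounded linear maps. -/
def map (f : BLin V V') (g : BLin W W') : BLin (BTensor V W) (BTensor V' W') := mapB f g

@[simp] theorem map_tmul (f : BLin V V') (g : BLin W W') (v : V) (w : W) :
    map f g (tmul v w) = tmul (f v) (g w) := lift_tmul _ v w

@[simp] theorem mapB_apply (f : BLin V V') (g : BLin W W') : mapB f g = map f g := rfl

variable [CompleteBornSpace V] [CompleteBornSpace W]

/-- The flip `v ⊗ w ↦ w ⊗ v`. -/
def swap : BLin (BTensor V W) (BTensor W V) := lift tmul.flip

@[simp] theorem swap_tmul (v : V) (w : W) : swap (tmul v w) = tmul w v := lift_tmul _ v w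

/-- The slice map `ω ⊗ id : V ⊗ W → W` of a bounded functional `ω` on `V`. -/
def sliceLeft (ω : BLin V ℂ) : BLin (BTensor V W) W := lift (BLin.smulB.comp ω)

@[simp] theorem sliceLeft_tmul (ω : BLin V ℂ) (v : V) (w : W) :
    sliceLeft ω (tmul v w) = ω v • w := lift_tmul _ v w

/-- The slice map `id ⊗ ω : V ⊗ W → V` of a bounded functional `ω` on `W`. -/
def sliceRight (ω : BLin W ℂ) : BLin (BTensor V W) V := lift (BLin.smulB.comp ω).flip

@[simp] theorem sliceRight_tmul (ω : BLin W ℂ) (v : V) (w : W) :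
    sliceRight ω (tmul v w) = ω w • v := lift_tmul _ v w

/-- The associativity map `(v ⊗ w) ⊗ x ↦ v ⊗ (w ⊗ x)`. -/
def assoc : BLin (BTensor (BTensor V W) X) (BTensor V (BTensor W X)) :=
  lift (lift ((BLin.compB.flip tmul).comp (BLin.compB.comp tmul)))

@[simp] theorem assoc_tmul (v : V) (w : W) (x : X) :
    assoc (tmul (tmul v w) x) = tmul v (tmul w x) := by
  simp [assoc]

/-- The tensor product of two bounded bilinear maps,
`(v ⊗ v', w ⊗ w') ↦ f v w ⊗ g v' w'`. -/
def map₂ (f : BLin V (BLin W X)) (g : BLin V' (BLin W' X')) :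
    BLin (BTensor V V') (BLin (BTensor W W') (BTensor X X')) :=
  lift ((BLin.compB.flip g).comp (mapB.comp f))

@[simp] theorem map₂_tmul (f : BLin V (BLin W X)) (g : BLin V' (BLin W' X')) (v : V) (v' : V') :
    map₂ f g (tmul v v') = map (f v) (g v') := by
  simp [map₂]

attribute [irreducible] tmul lift mapB map map₂ swap sliceLeft sliceRight assoc

end BTensor

end Tensor

/-! ### Bornological algebras and their multipliers -/

/-- A bornological algebra: a complete bornological vector space over `ℂ` with an associative,
not necessarily unital, bounded multiplication. -/
class BornAlgebra (A : Type*) [NonUnitalRing A] [Module ℂ A] [IsScalarTower ℂ A A]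
    [SMulCommClass ℂ A A] [Bornology A] : Prop extends CompleteBornSpace A where
  isBounded_mul : ∀ {S T : Set A}, IsBounded S → IsBounded T → IsBounded (S * T)

instance : BornAlgebra ℂ where
  isBounded_mul {S T} hS hT := by
    obtain ⟨C, hC, hSC⟩ := hS.exists_pos_norm_le
    obtain ⟨D, hD, hTD⟩ := hT.exists_pos_norm_le
    refine isBounded_iff_forall_norm_le.2 ⟨C * D, ?_⟩
    rintro _ ⟨x, hx, y, hy, rfl⟩
    rw [norm_mul]
    gcongr
    · exact hSC x hx
    · exact hTD y hy

section Algebra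

variable {A B : Type*}
  [NonUnitalRing A] [Module ℂ A] [IsScalarTower ℂ A A] [SMulCommClass ℂ A A] [Bornology A]
  [BornAlgebra A]
  [NonUnitalRing B] [Module ℂ B] [IsScalarTower ℂ B B] [SMulCommClass ℂ B B] [Bornology B]
  [BornAlgebra B]

/-- The multiplication as a bounded bilinear map. -/
def mulB : BLin A (BLin A A) :=
  BLin.mk₂ (fun a b => a * b) add_mul (fun c a b => smul_mul_assoc c a b) mul_add
    (fun c a b => mul_smul_comm c a b) fun _ _ hS hT => BornAlgebra.isBounded_mul hS hT

@[simp] theorem mulB_apply (a b : A) : mulB a b = a * b := rfl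

namespace BTensor

instance : Mul (BTensor A B) := ⟨fun x y => map₂ mulB mulB x y⟩

theorem mul_def (x y : BTensor A B) : x * y = map₂ mulB mulB x y := rfl

@[simp] theorem tmul_mul_tmul (a a' : A) (b b' : B) :
    (tmul a b * tmul a' b' : BTensor A B) = tmul (a * a') (b * b') := by
  simp [mul_def]

/-- The multiplication `(a ⊗ b) (a' ⊗ b') = a a' ⊗ b b'` on the tensor product. -/
instance : NonUnitalRing (BTensor A B) where
  left_distrib x y z := by simp [mul_def]
  right_distrib x y z := by simp [mul_def]
  zero_mul x := by simp [mul_def]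
  mul_zero x := by simp [mul_def]
  mul_assoc x y z := by
    set M : BLin (BTensor A B) (BLin (BTensor A B) (BTensor A B)) := map₂ mulB mulB with hM
    have hMm : ∀ x y : BTensor A B, M x y = x * y := fun _ _ => rfl
    have h1 : ∀ a b a' b' z, (tmul a b * tmul a' b' : BTensor A B) * z =
        tmul a b * (tmul a' b' * z) := fun a b a' b' =>
      ext_apply (f := M (tmul a b * tmul a' b')) (g := (M (tmul a b)).comp (M (tmul a' b')))
        fun a'' b'' => by simp [hMm, mul_assoc]
    have h2 : ∀ a b y z, (tmul a b * y : BTensor A B) * z = tmul a b * (y * z) := fun a b y z =>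
      ext_apply (f := (M.flip z).comp (M (tmul a b))) (g := (M (tmul a b)).comp (M.flip z))
        (fun a' b' => by simpa [hMm] using h1 a b a' b' z) y
    exact ext_apply (f := (M.flip z).comp (M.flip y)) (g := M.flip (M y z))
        (fun a b => by simpa [hMm] using h2 a b y z) x

instance : IsScalarTower ℂ (BTensor A B) (BTensor A B) :=
  ⟨fun c x y => by simp [mul_def]⟩

instance : SMulCommClass ℂ (BTensor A B) (BTensor A B) :=
  ⟨fun c x y => by simp [mul_def]⟩

instance : BornAlgebra (BTensor A B) where
  isBounded_mul hS hT := (map₂ mulB mulB : BLin (BTensor A B) _).bounded₂ hS hT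

end BTensor

end Algebra

/-- A multiplier of a bornological algebra: a pair of a left multiplier `L` and a right
multiplier `R` with `a L(b) = R(a) b`. One thinks of `L a = m · a` and `R a = a · m`. -/
structure Multiplier (A : Type*) [NonUnitalRing A] [Module ℂ A] [Bornology A] where
  L : BLin A A
  R : BLin A A
  L_mul : ∀ a b, L (a * b) = L a * b
  R_mul : ∀ a b, R (a * b) = a * R b
  mul_L : ∀ a b, a * L b = R a * b

namespace Multiplier

section Structure

variable {A : Type*} [NonUnitalRing A] [Module ℂ A] [IsScalarTower ℂ A A] [SMulCommClass ℂ A A]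
  [Bornology A] [BornAlgebra A]

@[ext] theorem ext {m n : Multiplier A} (hL : ∀ a, m.L a = n.L a) (hR : ∀ a, m.R a = n.R a) :
    m = n := by
  cases m; cases n
  congr
  · exact BLin.ext hL
  · exact BLin.ext hR

instance : Zero (Multiplier A) := ⟨⟨0, 0, by simp, by simp, by simp⟩⟩

instance : One (Multiplier A) := ⟨⟨BLin.id A, BLin.id A, by simp, by simp, by simp⟩⟩

instance : Add (Multiplier A) := ⟨fun m n => ⟨m.L + n.L, m.R + n.R,
  by simp [m.L_mul, n.L_mul, add_mul], by simp [m.R_mul, n.R_mul, mul_add],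
  by simp [m.mul_L, n.mul_L, add_mul, mul_add]⟩⟩

instance : SMul ℂ (Multiplier A) := ⟨fun c m => ⟨c • m.L, c • m.R,
  by simp [m.L_mul, smul_mul_assoc], by simp [m.R_mul, mul_smul_comm],
  by simp [m.mul_L, mul_smul_comm, smul_mul_assoc]⟩⟩

instance : Neg (Multiplier A) := ⟨fun m => (-1 : ℂ) • m⟩

/-- The product of multipliers: `(m n) · a = m · (n · a)` and `a · (m n) = (a · m) · n`. -/
instance : Mul (Multiplier A) := ⟨fun m n => ⟨m.L.comp n.L, n.R.comp m.R,
  by simp [m.L_mul, n.L_mul], by simp [m.R_mul, n.R_mul], by simp [m.mul_L, n.mul_L]⟩⟩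

@[simp] theorem zero_L (a : A) : (0 : Multiplier A).L a = 0 := rfl
@[simp] theorem zero_R (a : A) : (0 : Multiplier A).R a = 0 := rfl
@[simp] theorem one_L (a : A) : (1 : Multiplier A).L a = a := rfl
@[simp] theorem one_R (a : A) : (1 : Multiplier A).R a = a := rfl
@[simp] theorem add_L (m n : Multiplier A) (a : A) : (m + n).L a = m.L a + n.L a := rfl
@[simp] theorem add_R (m n : Multiplier A) (a : A) : (m + n).R a = m.R a + n.R a := rfl
@[simp] theorem smul_L (c : ℂ) (m : Multiplier A) (a : A) : (c • m).L a = c • m.L a := rfl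
@[simp] theorem smul_R (c : ℂ) (m : Multiplier A) (a : A) : (c • m).R a = c • m.R a := rfl
@[simp] theorem mul_L_apply (m n : Multiplier A) (a : A) : (m * n).L a = m.L (n.L a) := rfl
@[simp] theorem mul_R_apply (m n : Multiplier A) (a : A) : (m * n).R a = n.R (m.R a) := rfl
@[simp] theorem neg_L (m : Multiplier A) (a : A) : (-m).L a = -m.L a := by
  change (-1 : ℂ) • m.L a = _
  simp
@[simp] theorem neg_R (m : Multiplier A) (a : A) : (-m).R a = -m.R a := by
  change (-1 : ℂ) • m.R a = _
  simp

instance : Ring (Multiplier A) where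
  add_assoc _ _ _ := by ext <;> simp [add_assoc]
  zero_add _ := by ext <;> simp
  add_zero _ := by ext <;> simp
  add_comm _ _ := by ext <;> simp [add_comm]
  neg_add_cancel _ := by ext <;> simp
  left_distrib _ _ _ := by ext <;> simp
  right_distrib _ _ _ := by ext <;> simp
  zero_mul _ := by ext <;> simp
  mul_zero _ := by ext <;> simp
  mul_assoc _ _ _ := by ext <;> simp
  one_mul _ := by ext <;> simp
  mul_one _ := by ext <;> simp
  nsmul := nsmulRec
  zsmul := zsmulRec

instance : Module ℂ (Multiplier A) where
  one_smul _ := by ext <;> simp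
  mul_smul _ _ _ := by ext <;> simp [mul_smul]
  smul_zero _ := by ext <;> simp
  smul_add _ _ _ := by ext <;> simp
  add_smul _ _ _ := by ext <;> simp [add_smul]
  zero_smul _ := by ext <;> simp

/-- The bornology on multipliers as pairs of bounded linear maps. -/
instance : Bornology (Multiplier A) := Bornology.induced fun m => (m.L, m.R)

theorem isBounded_iff {B : Set (Multiplier A)} :
    IsBounded B ↔ IsBounded (L '' B) ∧ IsBounded (R '' B) := by
  have h := isBounded_induced (f := fun m : Multiplier A => (m.L, m.R)) (s := B)
  rw [h, ← isBounded_image_fst_and_snd, image_image, image_image]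

/-- Left multiplication by multipliers, `m ↦ (a ↦ m · a)`. -/
def LB : BLin (Multiplier A) (BLin A A) where
  toFun := L
  map_add' _ _ := rfl
  map_smul' _ _ := rfl
  bounded' _ hS := (isBounded_iff.1 hS).1

/-- Right multiplication by multipliers, `m ↦ (a ↦ a · m)`. -/
def RB : BLin (Multiplier A) (BLin A A) where
  toFun := R
  map_add' _ _ := rfl
  map_smul' _ _ := rfl
  bounded' _ hS := (isBounded_iff.1 hS).2

@[simp] theorem LB_apply (m : Multiplier A) : LB m = m.L := rfl
@[simp] theorem RB_apply (m : Multiplier A) : RB m = m.R := rfl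

variable (A) in
/-- The canonical homomorphism from an algebra to its multiplier algebra. -/
def ι : BLin A (Multiplier A) where
  toFun a := ⟨mulB a, mulB.flip a, fun b c => (mul_assoc a b c).symm, fun b c => mul_assoc b c a,
    fun b c => (mul_assoc b a c).symm⟩
  map_add' a b := by ext x; exacts [add_mul a b x, mul_add x a b]
  map_smul' c a := by ext <;> simp
  bounded' S hS := isBounded_iff.2 ⟨by
    rw [image_image]
    exact mulB.bounded hS, by
    rw [image_image]
    exact mulB.flip.bounded hS⟩

@[simp] theorem ι_L (a b : A) : (ι A a).L b = a * b := rfl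
@[simp] theorem ι_R (a b : A) : (ι A a).R b = b * a := rfl

end Structure

section Tensor

variable {A B : Type*}
  [NonUnitalRing A] [Module ℂ A] [IsScalarTower ℂ A A] [SMulCommClass ℂ A A] [Bornology A]
  [BornAlgebra A]
  [NonUnitalRing B] [Module ℂ B] [IsScalarTower ℂ B B] [SMulCommClass ℂ B B] [Bornology B]
  [BornAlgebra B]

open BTensor

/-- The multiplier `m ⊗ n` of the tensor product of two algebras. -/
def tensor (m : Multiplier A) (n : Multiplier B) : Multiplier (BTensor A B) where
  L := map m.L n.L
  R := map m.R n.R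
  L_mul x y := by
    have h : ∀ a b y, map m.L n.L (tmul a b * y) = map m.L n.L (tmul a b) * y := fun a b =>
      ext_apply (f := (map m.L n.L).comp (mulB (tmul a b))) (g := mulB (map m.L n.L (tmul a b)))
        fun c d => by simp [m.L_mul, n.L_mul]
    exact ext_apply (f := (map m.L n.L).comp (mulB.flip y)) (g := (mulB.flip y).comp (map m.L n.L))
      (fun a b => h a b y) x
  R_mul x y := by
    have h : ∀ a b y, map m.R n.R (tmul a b * y) = tmul a b * map m.R n.R y := fun a b =>
      ext_apply (f := (map m.R n.R).comp (mulB (tmul a b)))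
        (g := (mulB (tmul a b)).comp (map m.R n.R))
        fun c d => by simp [m.R_mul, n.R_mul]
    exact ext_apply (f := (map m.R n.R).comp (mulB.flip y)) (g := mulB.flip (map m.R n.R y))
      (fun a b => h a b y) x
  mul_L x y := by
    have h : ∀ a b y, tmul a b * map m.L n.L y = map m.R n.R (tmul a b) * y := fun a b =>
      ext_apply (f := (mulB (tmul a b)).comp (map m.L n.L)) (g := mulB (map m.R n.R (tmul a b)))
        fun c d => by simp [m.mul_L, n.mul_L]
    exact ext_apply (f := mulB.flip (map m.L n.L y)) (g := (mulB.flip y).comp (map m.R n.R))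
      (fun a b => h a b y) x

@[simp] theorem tensor_L (m : Multiplier A) (n : Multiplier B) : (tensor m n).L = map m.L n.L := rfl

@[simp] theorem tensor_R (m : Multiplier A) (n : Multiplier B) : (tensor m n).R = map m.R n.R := rfl

variable {A' B' : Type*}
  [NonUnitalRing A'] [Module ℂ A'] [IsScalarTower ℂ A' A'] [SMulCommClass ℂ A' A'] [Bornology A']
  [BornAlgebra A']
  [NonUnitalRing B'] [Module ℂ B'] [IsScalarTower ℂ B' B'] [SMulCommClass ℂ B' B'] [Bornology B']
  [BornAlgebra B']

/-- The map `f ⊗ g : A ⊗ B → M(A' ⊗ B')`, `a ⊗ b ↦ f a ⊗ g b`, induced by maps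
`f : A → M(A')` and `g : B → M(B')`. -/
def tensorHom (f : BLin A (Multiplier A')) (g : BLin B (Multiplier B')) :
    BLin (BTensor A B) (Multiplier (BTensor A' B')) where
  toFun t :=
    { L := map₂ (LB.comp f) (LB.comp g) t
      R := map₂ (RB.comp f) (RB.comp g) t
      L_mul := fun x y => ext_apply
        (f := (map₂ (LB.comp f) (LB.comp g)).flip (x * y))
        (g := (mulB.flip y).comp ((map₂ (LB.comp f) (LB.comp g)).flip x))
        (fun a b => by simpa using (tensor (f a) (g b)).L_mul x y) t
      R_mul := fun x y => ext_apply
        (f := (map₂ (RB.comp f) (RB.comp g)).flip (x * y))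
        (g := (mulB x).comp ((map₂ (RB.comp f) (RB.comp g)).flip y))
        (fun a b => by simpa using (tensor (f a) (g b)).R_mul x y) t
      mul_L := fun x y => ext_apply
        (f := (mulB x).comp ((map₂ (LB.comp f) (LB.comp g)).flip y))
        (g := (mulB.flip y).comp ((map₂ (RB.comp f) (RB.comp g)).flip x))
        (fun a b => by simpa using (tensor (f a) (g b)).mul_L x y) t }
  map_add' s t := by ext <;> simp
  map_smul' c t := by ext <;> simp
  bounded' S hS := isBounded_iff.2 ⟨by
    rw [image_image]
    exact (map₂ (LB.comp f) (LB.comp g)).bounded hS, by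
    rw [image_image]
    exact (map₂ (RB.comp f) (RB.comp g)).bounded hS⟩

@[simp] theorem tensorHom_tmul (f : BLin A (Multiplier A')) (g : BLin B (Multiplier B')) (a : A)
    (b : B) : tensorHom f g (tmul a b) = tensor (f a) (g b) := by
  ext x
  · exact congrArg (fun h => h x) (map₂_tmul (LB.comp f) (LB.comp g) a b)
  · exact congrArg (fun h => h x) (map₂_tmul (RB.comp f) (RB.comp g) a b)

end Tensor

end Multiplier

/-! ### Essential algebras and essential homomorphisms -/

section Balanced

variable {A M N P : Type*} [AddCommGroup A] [Module ℂ A] [Bornology A]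
  [AddCommGroup M] [Module ℂ M] [Bornology M] [CompleteBornSpace M]
  [AddCommGroup N] [Module ℂ N] [Bornology N] [CompleteBornSpace N]
  [AddCommGroup P] [Module ℂ P] [Bornology P] [CompleteBornSpace P]

/-- The completed balanced tensor product `M ⊗_A N` of `M` with the right action `ρ` of `A` and
`N` with the left action `l` of `A`: the quotient of `M ⊗ N` by the closed subspace generated by
the elements `m a ⊗ n - m ⊗ a n`. -/
def BalancedTensor (ρ : BLin M (BLin A M)) (l : BLin A (BLin N N)) : Type _ :=
  BQuot {t : BTensor M N | ∃ m a n, t = BTensor.tmul (ρ m a) n - BTensor.tmul m (l a n)}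

namespace BalancedTensor

variable (ρ : BLin M (BLin A M)) (l : BLin A (BLin N N))

instance : AddCommGroup (BalancedTensor ρ l) := inferInstanceAs (AddCommGroup (BQuot _))
instance : Module ℂ (BalancedTensor ρ l) := inferInstanceAs (Module ℂ (BQuot _))
instance : Bornology (BalancedTensor ρ l) := inferInstanceAs (Bornology (BQuot _))
instance : CompleteBornSpace (BalancedTensor ρ l) := inferInstanceAs (CompleteBornSpace (BQuot _))

/-- The quotient map `M ⊗ N → M ⊗_A N`. -/
def mk : BLin (BTensor M N) (BalancedTensor ρ l) := BQuot.mk _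

theorem mk_surjective : Function.Surjective (mk ρ l) := BQuot.mk_surjective _

variable {ρ l}

/-- The map on `M ⊗_A N` induced by a balanced bounded bilinear map. -/
def lift (β : BLin M (BLin N P)) (h : ∀ m a n, β (ρ m a) n = β m (l a n)) :
    BLin (BalancedTensor ρ l) P :=
  BQuot.lift (BTensor.lift β) (by
    rintro _ ⟨m, a, n, rfl⟩
    simp [h])

@[simp] theorem lift_mk (β : BLin M (BLin N P)) (h : ∀ m a n, β (ρ m a) n = β m (l a n))
    (t : BTensor M N) : lift β h (mk ρ l t) = BTensor.lift β t := rfl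

end BalancedTensor

end Balanced

section Essential

variable {A B : Type*}
  [NonUnitalRing A] [Module ℂ A] [IsScalarTower ℂ A A] [SMulCommClass ℂ A A] [Bornology A]
  [BornAlgebra A]
  [NonUnitalRing B] [Module ℂ B] [IsScalarTower ℂ B B] [SMulCommClass ℂ B B] [Bornology B]
  [BornAlgebra B]

variable (A) in
/-- A (nonzero) bornological algebra is essential if the multiplication induces an
isomorphism `A ⊗_A A ≅ A`. -/
def IsEssentialAlgebra : Prop :=
  Nontrivial A ∧ (BalancedTensor.lift (ρ := mulB) (l := mulB) (mulB : BLin A (BLin A A))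
    (fun a b c => mul_assoc a b c)).IsIso

/-- The left action `(a, b) ↦ f(a) · b` of `A` on `B` defined by `f : A → M(B)`. -/
def leftAction (f : BLin A (Multiplier B)) : BLin A (BLin B B) := Multiplier.LB.comp f

/-- The right action `(b, a) ↦ b · f(a)` of `A` on `B` defined by `f : A → M(B)`. -/
def rightAction (f : BLin A (Multiplier B)) : BLin B (BLin A B) := (Multiplier.RB.comp f).flip

@[simp] theorem leftAction_apply (f : BLin A (Multiplier B)) (a : A) (b : B) :
    leftAction f a b = (f a).L b := rfl

@[simp] theorem rightAction_apply (f : BLin A (Multiplier B)) (a : A) (b : B) :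
    rightAction f b a = (f a).R b := rfl

theorem leftAction_mul {f : BLin A (Multiplier B)} (hf : ∀ a b, f (a * b) = f a * f b)
    (a a' : A) (b : B) : leftAction f (mulB a a') b = leftAction f a (leftAction f a' b) := by
  simp [hf]

theorem rightAction_mul {f : BLin A (Multiplier B)} (hf : ∀ a b, f (a * b) = f a * f b)
    (b : B) (a a' : A) : rightAction f (rightAction f b a) a' = rightAction f b (mulB a a') := by
  simp [hf]

/-- Essential homomorphisms `f : A → M(B)`: the canonical maps `A ⊗_A B → B` and `B ⊗_A A → B`
are isomorphisms. -/
structure IsEssentialHom (f : BLin A (Multiplier B)) : Prop where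
  map_mul : ∀ a b, f (a * b) = f a * f b
  left : (BalancedTensor.lift (ρ := mulB) (l := leftAction f) (leftAction f)
    (leftAction_mul map_mul)).IsIso
  right : (BalancedTensor.lift (ρ := rightAction f) (l := mulB) (rightAction f)
    (rightAction_mul map_mul)).IsIso

/-- `n ∈ M(B)` is the value at `m ∈ M(A)` of the canonical extension `M(A) → M(B)` of a
homomorphism `f : A → M(B)`: `n f(a) b = f(m a) b` and `b f(a) n = b f(a m)`. For essential `f`,
there is exactly one such `n`, see `IsEssentialHom.existsUnique_extendsAt`. -/
def ExtendsAt (f : BLin A (Multiplier B)) (m : Multiplier A) (n : Multiplier B) : Prop :=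
  (∀ a b, n.L ((f a).L b) = (f (m.L a)).L b) ∧ ∀ a b, n.R ((f a).R b) = (f (m.R a)).R b

namespace IsEssentialHom

variable {f : BLin A (Multiplier B)}
  {P : Type*} [AddCommGroup P] [Module ℂ P] [Bornology P] [CompleteBornSpace P]

theorem ext_left (hf : IsEssentialHom f) {g h : BLin B P} (H : ∀ a b, g ((f a).L b) = h ((f a).L b)) (b : B) :
    g b = h b := by
  obtain ⟨k, -, hk⟩ := hf.left
  rw [← hk b]
  obtain ⟨t, ht⟩ := BalancedTensor.mk_surjective _ _ (k b)
  rw [← ht, BalancedTensor.lift_mk]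
  exact BTensor.ext_apply (f := g.comp (BTensor.lift (leftAction f)))
    (g := h.comp (BTensor.lift (leftAction f))) (fun a b => by simpa using H a b) t

theorem ext_right (hf : IsEssentialHom f) {g h : BLin B P} (H : ∀ a b, g ((f a).R b) = h ((f a).R b)) (b : B) :
    g b = h b := by
  obtain ⟨k, -, hk⟩ := hf.right
  rw [← hk b]
  obtain ⟨t, ht⟩ := BalancedTensor.mk_surjective _ _ (k b)
  rw [← ht, BalancedTensor.lift_mk]
  exact BTensor.ext_apply (f := g.comp (BTensor.lift (rightAction f)))
    (g := h.comp (BTensor.lift (rightAction f))) (fun b a => by simpa using H a b) t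

theorem exists_left (hf : IsEssentialHom f) (m : Multiplier A) :
    ∃ g : BLin B B, ∀ a b, g ((f a).L b) = (f (m.L a)).L b := by
  obtain ⟨k, hk, -⟩ := hf.left
  have hbal : ∀ a a' b, (leftAction f).comp m.L (mulB a a') b =
      (leftAction f).comp m.L a (leftAction f a' b) := fun a a' b => by
    simp [m.L_mul, hf.map_mul]
  refine ⟨(BalancedTensor.lift ((leftAction f).comp m.L) hbal).comp k, fun a b => ?_⟩
  have h1 : (f a).L b = BalancedTensor.lift (leftAction f) (leftAction_mul hf.map_mul)
      (BalancedTensor.mk mulB (leftAction f) (BTensor.tmul a b)) := by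
    rw [BalancedTensor.lift_mk, BTensor.lift_tmul, leftAction_apply]
  rw [BLin.comp_apply, h1, hk, BalancedTensor.lift_mk, BTensor.lift_tmul, BLin.comp_apply,
    leftAction_apply]

theorem exists_right (hf : IsEssentialHom f) (m : Multiplier A) :
    ∃ g : BLin B B, ∀ a b, g ((f a).R b) = (f (m.R a)).R b := by
  obtain ⟨k, hk, -⟩ := hf.right
  have hbal : ∀ b a a', ((rightAction f).flip.comp m.R).flip (rightAction f b a) a' =
      ((rightAction f).flip.comp m.R).flip b (mulB a a') := fun b a a' => by
    simp [m.R_mul, hf.map_mul]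
  refine ⟨(BalancedTensor.lift ((rightAction f).flip.comp m.R).flip hbal).comp k, fun a b => ?_⟩
  have h1 : (f a).R b = BalancedTensor.lift (rightAction f) (rightAction_mul hf.map_mul)
      (BalancedTensor.mk (rightAction f) mulB (BTensor.tmul b a)) := by
    rw [BalancedTensor.lift_mk, BTensor.lift_tmul, rightAction_apply]
  rw [BLin.comp_apply, h1, hk, BalancedTensor.lift_mk, BTensor.lift_tmul, BLin.flip_apply,
    BLin.comp_apply, BLin.flip_apply, rightAction_apply]

theorem existsUnique_extendsAt (hf : IsEssentialHom f) (m : Multiplier A) : ∃! n, ExtendsAt f m n := by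
  obtain ⟨g, hg⟩ := hf.exists_left m
  obtain ⟨h, hh⟩ := hf.exists_right m
  refine ⟨⟨g, h, fun x y => ?_, fun x y => ?_, fun x y => ?_⟩, ⟨hg, hh⟩, fun n hn => ?_⟩
  · refine hf.ext_left (g := g.comp (mulB.flip y)) (h := (mulB.flip y).comp g) (fun a b => ?_) x
    simp [← Multiplier.L_mul, hg]
  · refine hf.ext_right (g := h.comp (mulB x)) (h := (mulB x).comp h) (fun a b => ?_) y
    simp [← Multiplier.R_mul, hh]
  · refine hf.ext_left (g := (mulB x).comp g) (h := mulB (h x)) (fun a b => ?_) y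
    refine hf.ext_right (g := mulB.flip (g ((f a).L b))) (h := (mulB.flip ((f a).L b)).comp h)
      (fun c d => ?_) x
    have h1 : f (c * m.L a) = f (m.R c * a) := by rw [m.mul_L]
    rw [hf.map_mul, hf.map_mul] at h1
    simp only [BLin.flip_apply, mulB_apply, BLin.comp_apply, hg, hh, ← Multiplier.mul_L]
    rw [← Multiplier.mul_L_apply, h1, Multiplier.mul_L_apply]
  · refine Multiplier.ext (hf.ext_left fun a b => ?_) (hf.ext_right fun a b => ?_)
    · rw [hn.1, hg]
    · rw [hn.2, hh]

end IsEssentialHom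

/-- `n ∈ M(A)` is the value at `m ∈ M(A)` of the canonical extension `M(A) → M(A)` of an algebra
antiautomorphism `θ` of `A`: `n θ(a) = θ(a m)` and `θ(a) n = θ(m a)`. -/
def AntiExtendsAt (θ : BLin A A) (m n : Multiplier A) : Prop :=
  (∀ a, n.L (θ a) = θ (m.R a)) ∧ ∀ a, n.R (θ a) = θ (m.L a)

/-- Faithful functionals. -/
def IsFaithful (ω : BLin A ℂ) : Prop :=
  (∀ a, (∀ b, ω (a * b) = 0) → a = 0) ∧ ∀ b, (∀ a, ω (a * b) = 0) → b = 0

end Essential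

/-! ### The approximation property -/

section Approximation

variable (V : Type*) [AddCommGroup V] [Module ℂ V] [Bornology V]

variable {V} in
/-- Finite rank operators: finite sums of operators `x ↦ ω(x) w` with `ω` a bounded functional. -/
def IsFiniteRank (f : BLin V V) : Prop :=
  ∃ (n : ℕ) (w : Fin n → V) (ω : Fin n → BLin V ℂ), ∀ x, f x = ∑ i, ω i x • w i

variable {V} in
/-- Compact subsets of a complete bornological vector space: subsets which are (sequentially)
compact in the Banach space spanned by some small completant disk `T`. -/
def IsBornCompact (S : Set V) : Prop :=
  ∃ T : Set V, IsBounded T ∧ IsCompletantDisk T ∧ S ⊆ Submodule.span ℂ T ∧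
    ∀ u : ℕ → V, (∀ n, u n ∈ S) → ∃ x ∈ S, ∃ k : ℕ → ℕ, StrictMono k ∧
      ∀ ε : ℝ, 0 < ε → ∃ N, ∀ n ≥ N, u (k n) - x ∈ (ε : ℂ) • T

/-- The approximation property: on each compact disk `S`, the identity is the limit of a sequence
of finite rank operators, uniformly on `S` in the bornological sense, i.e. in `Hom(⟨S⟩, V)`. -/
def ApproximationProperty : Prop :=
  ∀ S : Set V, IsDisk S → IsBornCompact S → ∃ f : ℕ → BLin V V, (∀ n, IsFiniteRank (f n)) ∧
    ∃ T : Set V, IsBounded T ∧ IsDisk T ∧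
      ∀ ε : ℝ, 0 < ε → ∃ N, ∀ n ≥ N, ∀ x ∈ S, f n x - x ∈ (ε : ℂ) • T

end Approximation

/-! ### Bornological quantum groups -/

section QuantumGroup

variable {H : Type*} [NonUnitalRing H] [Module ℂ H] [IsScalarTower ℂ H H] [SMulCommClass ℂ H H]
  [Bornology H] [BornAlgebra H]

open BTensor Multiplier

/-- Coassociativity `(Δ ⊗ id) Δ = (id ⊗ Δ) Δ`, where `Δ ⊗ id` and `id ⊗ Δ` are extended to
`M(H ⊗ H)` and `(H ⊗ H) ⊗ H` is identified with `H ⊗ (H ⊗ H)`. -/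
def IsCoassociative (Δ : BLin H (Multiplier (BTensor H H))) : Prop :=
  ∀ f : H, ∃ (m : Multiplier (BTensor (BTensor H H) H)) (n : Multiplier (BTensor H (BTensor H H))),
    ExtendsAt (tensorHom Δ (ι H)) (Δ f) m ∧ ExtendsAt (tensorHom (ι H) Δ) (Δ f) n ∧
      (∀ t, assoc (m.L t) = n.L (assoc t)) ∧ ∀ t, assoc (m.R t) = n.R (assoc t)

/-- A comultiplication: a coassociative essential homomorphism `H → M(H ⊗ H)`. -/
structure IsComultiplication (Δ : BLin H (Multiplier (BTensor H H))) : Prop where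
  essential : IsEssentialHom Δ
  coassoc : IsCoassociative Δ

variable (H) in
/-- A bornological quantum group: an essential bornological algebra `H` with the approximation
property, a comultiplication `Δ` all of whose Galois maps `γl`, `γr`, `ρl`, `ρr` are bornological
isomorphisms of `H ⊗ H`, and a faithful left invariant functional `φ`. -/
structure BornQuantumGroup where
  essential : IsEssentialAlgebra H
  approximation : ApproximationProperty H
  /-- the comultiplication -/
  Δ : BLin H (Multiplier (BTensor H H))
  comul : IsComultiplication Δ
  /-- the Galois map `f ⊗ g ↦ Δ(f) (g ⊗ 1)` -/
  γl : BLin (BTensor H H) (BTensor H H)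
  γl_spec : ∀ f g, ι _ (γl (tmul f g)) = Δ f * tensor (ι H g) 1
  γl_isIso : γl.IsIso
  /-- the Galois map `f ⊗ g ↦ Δ(f) (1 ⊗ g)` -/
  γr : BLin (BTensor H H) (BTensor H H)
  γr_spec : ∀ f g, ι _ (γr (tmul f g)) = Δ f * tensor 1 (ι H g)
  γr_isIso : γr.IsIso
  /-- the Galois map `f ⊗ g ↦ (f ⊗ 1) Δ(g)` -/
  ρl : BLin (BTensor H H) (BTensor H H)
  ρl_spec : ∀ f g, ι _ (ρl (tmul f g)) = tensor (ι H f) 1 * Δ g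
  ρl_isIso : ρl.IsIso
  /-- the Galois map `f ⊗ g ↦ (1 ⊗ f) Δ(g)` -/
  ρr : BLin (BTensor H H) (BTensor H H)
  ρr_spec : ∀ f g, ι _ (ρr (tmul f g)) = tensor 1 (ι H f) * Δ g
  ρr_isIso : ρr.IsIso
  /-- the left Haar functional -/
  φ : BLin H ℂ
  faithful : IsFaithful φ
  /-- `(id ⊗ φ) Δ(f) = φ(f) 1`, as left and as right multipliers -/
  left_invariant : ∀ f g, sliceRight φ (γl (tmul f g)) = φ f • g ∧
    sliceRight φ (ρl (tmul g f)) = φ f • g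

namespace BornQuantumGroup

variable (Q : BornQuantumGroup H)

/-- `m` is the multiplier `(id ⊗ ω) Δ(f)`, defined by
`m · g = (id ⊗ ω)(Δ(f) (g ⊗ 1))` and `g · m = (id ⊗ ω)((g ⊗ 1) Δ(f))`. -/
def IsRightSlice (ω : BLin H ℂ) (f : H) (m : Multiplier H) : Prop :=
  ∀ g, m.L g = sliceRight ω (Q.γl (tmul f g)) ∧ m.R g = sliceRight ω (Q.ρl (tmul g f))

/-- `m` is the multiplier `(ω ⊗ id) Δ(f)`, defined by
`m · g = (ω ⊗ id)(Δ(f) (1 ⊗ g))` and `g · m = (ω ⊗ id)((1 ⊗ g) Δ(f))`. -/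
def IsLeftSlice (ω : BLin H ℂ) (f : H) (m : Multiplier H) : Prop :=
  ∀ g, m.L g = sliceLeft ω (Q.γr (tmul f g)) ∧ m.R g = sliceLeft ω (Q.ρr (tmul g f))

/-- The counit: an essential algebra homomorphism `ε : H → ℂ` such that
`(ε ⊗ id) Δ = id = (id ⊗ ε) Δ`. -/
structure IsCounit (ε : BLin H ℂ) : Prop where
  essential : IsEssentialHom ((ι ℂ).comp ε)
  left : ∀ f, Q.IsLeftSlice ε f (ι H f)
  right : ∀ f, Q.IsRightSlice ε f (ι H f)

/-- The antipode with respect to `ε`: a linear isomorphism `S` of `H`, an antihomomorphism of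
algebras and of coalgebras (that is, `Δ S = (S ⊗ S) τ Δ`), such that
`μ (S ⊗ id) γr = ε ⊗ id` and `μ (id ⊗ S) ρl = id ⊗ ε`. -/
structure IsAntipode (ε : BLin H ℂ) (S : BLin H H) : Prop where
  isIso : S.IsIso
  map_mul : ∀ f g, S (f * g) = S g * S f
  comul : ∀ f, AntiExtendsAt ((BTensor.map S S).comp swap) (Q.Δ f) (Q.Δ (S f))
  left : ∀ t, BTensor.lift mulB (BTensor.map S (BLin.id H) (Q.γr t)) = sliceLeft ε t
  right : ∀ t, BTensor.lift mulB (BTensor.map (BLin.id H) S (Q.ρl t)) = sliceRight ε t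

/-- `δ` is the modular element: `(φ ⊗ id) Δ(f) = φ(f) δ` for all `f`. -/
def IsModularElement (δ : Multiplier H) : Prop :=
  ∀ f, Q.IsLeftSlice Q.φ f (Q.φ f • δ)

end BornQuantumGroup

end QuantumGroup

end BornQG

end

open BornQG

/-!
All identities are tested on elementary tensors after multiplying the legs: the multiplication of
`H` is nondegenerate, and by the approximation property slices separate the points of `H ⊗ H`.

Coassociativity gives `x ⊗ μ γr⁻¹ (y ⊗ c) = μ ρl⁻¹ (x ⊗ y) ⊗ c`, so `μ γr⁻¹ = ε ⊗ id` and
`μ ρl⁻¹ = id ⊗ ε` for one functional `ε`, the counit. The antipode is read off from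
`(ε ⊗ id) γr⁻¹ (f ⊗ g) = S(f) g`; the same construction for `γl` produces its inverse.

Choose `e` with `φ(e) = 1` and put `δ = (φ ⊗ id) Δ(e)`. Strong left invariance,
`S ((id ⊗ φ) (Δ(f) (1 ⊗ g))) = (id ⊗ φ) ((1 ⊗ f) Δ(g))`, forces `(φ ⊗ id) Δ(f)` to be proportional
to `φ(f)`. Then `Δ(δ) = δ ⊗ δ` follows from coassociativity, `ε(δ) = 1` from the counit identity,
and the antipode identities applied to `δ ⊗ δ` show that `S(δ)` is a two-sided inverse of `δ`.
-/

noncomputable section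

open Bornology Set Filter CompleteBornSpace
open scoped Pointwise Topology

namespace BornQG

/-! ### Bounded linear functions -/

section IsBLin

variable {V W X Y Z : Type*} [AddCommGroup V] [Module ℂ V] [Bornology V]
  [AddCommGroup W] [Module ℂ W] [Bornology W] [AddCommGroup X] [Module ℂ X] [Bornology X]
  [AddCommGroup Y] [Module ℂ Y] [Bornology Y] [AddCommGroup Z] [Module ℂ Z] [Bornology Z]

/-- A function is bounded linear if it underlies a bounded linear map. The unbundled predicate lets
`fun_prop` recognise composites of the structure maps, so that identities between them can be
checked on elementary tensors without naming the bundled maps. -/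
@[fun_prop] def IsBLin (F : V → W) : Prop := ∃ f : BLin V W, ∀ x, f x = F x

namespace IsBLin

@[fun_prop] theorem id : IsBLin (fun x : V => x) := ⟨BLin.id V, fun _ => rfl⟩

@[fun_prop] theorem blin (f : BLin V W) : IsBLin (fun x => f x) := ⟨f, fun _ => rfl⟩

@[fun_prop] theorem comp {G : W → X} {F : V → W} (hG : IsBLin G) (hF : IsBLin F) :
    IsBLin (fun x => G (F x)) := by
  obtain ⟨f, hf⟩ := hF
  obtain ⟨g, hg⟩ := hG
  exact ⟨g.comp f, fun x => by rw [BLin.comp_apply, hf, hg]⟩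

@[fun_prop] theorem apply_blin (f : BLin W X) {F : V → W} (hF : IsBLin F) :
    IsBLin (fun x => f (F x)) := (blin f).comp hF

@[fun_prop] theorem eval [CompleteBornSpace X] {F : V → BLin W X} (hF : IsBLin F) (w : W) :
    IsBLin (fun x => F x w) := by
  obtain ⟨f, hf⟩ := hF
  exact ⟨f.flip w, fun x => by rw [BLin.flip_apply, hf]⟩

@[fun_prop] theorem map_left [CompleteBornSpace X] [CompleteBornSpace Z] {F : V → BLin W X}
    (hF : IsBLin F) (g : BLin Y Z) : IsBLin (fun x => BTensor.map (F x) g) := by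
  simpa using (blin (BTensor.mapB.flip g)).comp hF

@[fun_prop] theorem map_right [CompleteBornSpace X] [CompleteBornSpace Z] {F : V → BLin Y Z}
    (hF : IsBLin F) (g : BLin W X) : IsBLin (fun x => BTensor.map g (F x)) := by
  simpa using (blin (BTensor.mapB g)).comp hF

@[fun_prop] theorem const_smul [CompleteBornSpace W] (c : ℂ) {F : V → W} (hF : IsBLin F) :
    IsBLin (fun x => c • F x) := by
  obtain ⟨f, hf⟩ := hF
  exact ⟨c • f, fun x => by rw [BLin.smul_apply, hf]⟩

theorem zero : IsBLin (fun _ : V => (0 : W)) := ⟨0, fun _ => rfl⟩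

theorem add [CompleteBornSpace W] {F G : V → W} (hF : IsBLin F) (hG : IsBLin G) :
    IsBLin (fun x => F x + G x) := by
  obtain ⟨f, hf⟩ := hF
  obtain ⟨g, hg⟩ := hG
  exact ⟨f + g, fun x => by rw [BLin.add_apply, hf, hg]⟩

@[fun_prop] theorem sub [CompleteBornSpace W] {F G : V → W} (hF : IsBLin F) (hG : IsBLin G) :
    IsBLin (fun x => F x - G x) := by
  obtain ⟨f, hf⟩ := hF
  obtain ⟨g, hg⟩ := hG
  exact ⟨f - g, fun x => by rw [BLin.sub_apply, hf, hg]⟩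

@[fun_prop] theorem sum [CompleteBornSpace W] {ι : Type*} (s : Finset ι) {F : ι → V → W}
    (hF : ∀ i, IsBLin (F i)) : IsBLin (fun x => ∑ i ∈ s, F i x) := by
  classical
  induction s using Finset.induction_on with
  | empty => simpa only [Finset.sum_empty] using zero
  | insert i s hi ih => simpa only [Finset.sum_insert hi] using (hF i).add ih

@[fun_prop] theorem smul_const [CompleteBornSpace W] {F : V → ℂ} (hF : IsBLin F) (w : W) :
    IsBLin (fun x => F x • w) := (blin (BLin.smulB.flip w)).comp hF

section Algebra

variable {A : Type*} [NonUnitalRing A] [Module ℂ A] [IsScalarTower ℂ A A] [SMulCommClass ℂ A A]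
  [Bornology A] [BornAlgebra A]

@[fun_prop] theorem mul_const {F : V → A} (hF : IsBLin F) (a : A) : IsBLin (fun x => F x * a) :=
  (blin (mulB.flip a)).comp hF

@[fun_prop] theorem const_mul {F : V → A} (hF : IsBLin F) (a : A) : IsBLin (fun x => a * F x) :=
  (blin (mulB a)).comp hF

end Algebra

end IsBLin

theorem BTensor.ext_fun [CompleteBornSpace X] {F G : BTensor V W → X}
    (h : ∀ v w, F (tmul v w) = G (tmul v w)) (hF : IsBLin F := by fun_prop)
    (hG : IsBLin G := by fun_prop) (t : BTensor V W) : F t = G t := by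
  obtain ⟨f, hf⟩ := hF
  obtain ⟨g, hg⟩ := hG
  rw [← hf, ← hg]
  exact ext_apply (fun v w => by rw [hf, hg, h]) t

end IsBLin

/-! ### Legs of tensor products -/

namespace BTensor

section Legs

variable {V W X : Type*} [AddCommGroup V] [Module ℂ V] [Bornology V]
  [AddCommGroup W] [Module ℂ W] [Bornology W] [AddCommGroup X] [Module ℂ X] [Bornology X]

/-- The inverse of the associativity map `assoc`. -/
def assocSymm : BLin (BTensor V (BTensor W X)) (BTensor (BTensor V W) X) :=
  lift (liftB.comp ((BLin.compB tmul).comp tmul))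

@[simp] theorem assocSymm_tmul (v : V) (w : W) (x : X) :
    assocSymm (tmul v (tmul w x)) = tmul (tmul v w) x := by
  simp [assocSymm]

/-- The map `v ⊗ x ↦ v ⊗ (w ⊗ x)`, used to write down `leg13` on elementary tensors. -/
def insertMid [CompleteBornSpace V] (w : W) : BLin (BTensor V X) (BTensor V (BTensor W X)) :=
  map (BLin.id V) (tmul w)

@[simp] theorem insertMid_tmul [CompleteBornSpace V] (v : V) (w : W) (x : X) :
    insertMid w (tmul v x) = tmul v (tmul w x) := by
  simp [insertMid]

variable [CompleteBornSpace X]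

/-- The leg notation `F₁₂`: the operator `F` on `V ⊗ W` acting on the first two legs of
`V ⊗ (W ⊗ X)`. -/
def leg12 (F : BLin (BTensor V W) (BTensor V W)) :
    BLin (BTensor V (BTensor W X)) (BTensor V (BTensor W X)) :=
  assoc.comp ((map F (BLin.id X)).comp assocSymm)

theorem leg12_tmul (F : BLin (BTensor V W) (BTensor V W)) (v : V) (w : W) (x : X) :
    leg12 F (tmul v (tmul w x)) = assoc (tmul (F (tmul v w)) x) := by
  simp [leg12]

variable [CompleteBornSpace V] [CompleteBornSpace W]

@[simp] theorem swap_swap : ∀ t : BTensor V W, swap (swap t) = t :=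
  ext_fun fun v w => by simp only [swap_tmul]

@[simp] theorem assocSymm_assoc : ∀ t : BTensor (BTensor V W) X, assocSymm (assoc t) = t := by
  refine ext_fun fun t x => ?_
  revert t
  exact ext_fun fun v w => by rw [assoc_tmul, assocSymm_tmul]

theorem leg12_assoc (F : BLin (BTensor V W) (BTensor V W)) (t : BTensor V W) (x : X) :
    leg12 F (assoc (tmul t x)) = assoc (tmul (F t) x) := by
  simp [leg12]

/-- The leg notation `F₁₃`: the operator `F` on `V ⊗ X` acting on the first and third leg of
`V ⊗ (W ⊗ X)`. -/
def leg13 (F : BLin (BTensor V X) (BTensor V X)) :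
    BLin (BTensor V (BTensor W X)) (BTensor V (BTensor W X)) :=
  (map (BLin.id V) swap).comp ((leg12 F).comp (map (BLin.id V) swap))

theorem leg13_tmul (F : BLin (BTensor V X) (BTensor V X)) (v : V) (w : W) (x : X) :
    leg13 F (tmul v (tmul w x)) = insertMid w (F (tmul v x)) := by
  have map_swap_assoc : ∀ t : BTensor V X,
      map (BLin.id V) swap (assoc (tmul t w)) = insertMid w t :=
    ext_fun fun v x => by simp
  simp only [leg13, BLin.comp_apply, map_tmul, swap_tmul, leg12_tmul, BLin.id_apply, map_swap_assoc]

theorem leg13_leg13 {F G : BLin (BTensor V X) (BTensor V X)} (hFG : ∀ t, F (G t) = t) :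
    ∀ t : BTensor V (BTensor W X), leg13 F (leg13 G t) = t := by
  refine ext_fun fun v => ext_fun fun w x => ?_
  have leg13_insertMid : ∀ t : BTensor V X, leg13 F (insertMid w t) = insertMid w (F t) :=
    ext_fun fun v x => by rw [insertMid_tmul, leg13_tmul]
  rw [leg13_tmul, leg13_insertMid, hFG, insertMid_tmul]

end Legs

end BTensor

/-! ### Compact disks from null sequences -/

section Scalars

variable {ι : Type*}

/- Abel–Dini: for `t n = ∑' k, d (k + n)`, the quotient
`d n / √(t n) = (t n - t (n + 1)) / √(t n)` is at most the telescoping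
`2 (√(t n) - √(t (n + 1)))`. -/
theorem exists_tendsto_zero_summable_div {d : ℕ → ℝ} (hd0 : ∀ n, 0 ≤ d n) (hd : Summable d) :
    ∃ r : ℕ → ℝ, Tendsto r atTop (𝓝 0) ∧ (∀ n, r n = 0 → d n = 0) ∧
      Summable fun n => ‖d n / r n‖ := by
  set t : ℕ → ℝ := fun n => ∑' k, d (k + n) with ht
  have t_nonneg (n : ℕ) : 0 ≤ t n := tsum_nonneg fun k => hd0 _
  have t_succ (n : ℕ) : t n = d n + t (n + 1) := by
    simpa [ht, add_assoc, add_comm, add_left_comm] using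
      ((summable_nat_add_iff n).2 hd).tsum_eq_zero_add
  have sqrt_tendsto : Tendsto (fun n => √(t n)) atTop (𝓝 0) := by
    simpa using (tendsto_sum_nat_add d).sqrt
  have div_le (n : ℕ) : ‖d n / √(t n)‖ ≤ 2 * (√(t n) - √(t (n + 1))) := by
    have sqrt_le : √(t (n + 1)) ≤ √(t n) := Real.sqrt_le_sqrt (by linarith [t_succ n, hd0 n])
    rw [Real.norm_of_nonneg (div_nonneg (hd0 n) (Real.sqrt_nonneg _))]
    refine div_le_of_le_mul₀ (Real.sqrt_nonneg _) (by linarith) ?_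
    nlinarith [Real.mul_self_sqrt (t_nonneg n), Real.mul_self_sqrt (t_nonneg (n + 1)), t_succ n,
      Real.sqrt_nonneg (t (n + 1))]
  refine ⟨fun n => √(t n), sqrt_tendsto, fun n hn => ?_,
    summable_of_sum_range_le (c := 2 * √(t 0)) (fun _ => norm_nonneg _) fun n => ?_⟩
  · have : t n = 0 := (Real.sqrt_eq_zero (t_nonneg n)).1 hn
    linarith [t_succ n, hd0 n, t_nonneg (n + 1)]
  · calc ∑ k ∈ Finset.range n, ‖d k / √(t k)‖
        ≤ ∑ k ∈ Finset.range n, 2 * (√(t k) - √(t (k + 1))) :=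
          Finset.sum_le_sum fun k _ => div_le k
      _ = 2 * (√(t 0) - √(t n)) := by rw [← Finset.mul_sum, Finset.sum_range_sub']
      _ ≤ 2 * √(t 0) := by linarith [Real.sqrt_nonneg (t n)]

theorem tendsto_extend_zero_cofinite {κ E : Type*} [TopologicalSpace E] [Zero E] {g : κ → ι}
    (hg : g.Injective) {f : κ → E} (hf : Tendsto f cofinite (𝓝 0)) :
    Tendsto (Function.extend g f 0) cofinite (𝓝 0) := by
  refine fun s hs => (Finite.image g (hf hs)).subset fun i hi => ?_
  by_cases hi' : ∃ j, g j = i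
  · obtain ⟨j, rfl⟩ := hi'
    exact ⟨j, fun hj => hi (by rwa [mem_preimage, hg.extend_apply]), rfl⟩
  · refine absurd ?_ hi
    rw [mem_preimage, Function.extend_apply' _ _ _ hi']
    exact mem_of_mem_nhds hs

theorem exists_eq_summable_mul_tendsto_zero {c : ι → ℂ} (hc : Summable fun i => ‖c i‖) :
    ∃ a r : ι → ℂ, (Summable fun i => ‖a i‖) ∧ Tendsto r cofinite (𝓝 0) ∧
      ∀ i, c i = a i * r i := by
  have support_countable : Countable {i | c i ≠ 0} := by
    simpa only [Function.support, ne_eq, norm_eq_zero] using hc.countable_support.to_subtype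
  obtain ⟨e, he⟩ := exists_injective_nat {i | c i ≠ 0}
  set d : ℕ → ℝ := Function.extend e (fun i => ‖c i‖) 0
  have d_apply (i : {i | c i ≠ 0}) : d (e i) = ‖c i‖ := he.extend_apply _ _ _
  have d_nonneg (n : ℕ) : 0 ≤ d n := by
    by_cases hn : ∃ i, e i = n
    · obtain ⟨i, rfl⟩ := hn
      exact (d_apply i).symm ▸ norm_nonneg _
    · exact (Function.extend_apply' (fun i : {i | c i ≠ 0} => ‖c i‖) (0 : ℕ → ℝ) _ hn).ge
  obtain ⟨ρ, hρ, eq_zero_of_ρ, hdρ⟩ := exists_tendsto_zero_summable_div d_nonneg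
    ((summable_extend_zero he).2 (hc.comp_injective Subtype.val_injective))
  set r : ι → ℂ := Function.extend Subtype.val (fun i : {i | c i ≠ 0} => (ρ (e i) : ℂ)) 0
  have r_apply (i : {i | c i ≠ 0}) : r i = ρ (e i) := Subtype.val_injective.extend_apply _ _ _
  refine ⟨fun i => c i / r i, r, ?_,
    tendsto_extend_zero_cofinite Subtype.val_injective
      ((Complex.continuous_ofReal.tendsto' 0 0 rfl).comp
        (hρ.comp (Nat.cofinite_eq_atTop ▸ he.tendsto_cofinite))),
    fun i => (div_mul_cancel_of_imp fun hi => ?_).symm⟩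
  · refine (Subtype.val_injective.summable_iff fun i hi => ?_).1
      ((hdρ.comp_injective he).congr fun i => ?_)
    · simp [show c i = 0 by simpa using hi]
    · simp [r_apply, d_apply]
  · by_contra hci
    have := eq_zero_of_ρ (e ⟨i, hci⟩) (by simpa [r_apply ⟨i, hci⟩] using hi)
    rw [d_apply, norm_eq_zero] at this
    exact hci this

end Scalars

section Series

variable {ι V : Type*} [AddCommGroup V] [Module ℂ V] [Bornology V]

theorem BTendsto.of_eventually_eq {u : ι → V} {l : Filter ι} {x : V} (h : ∀ᶠ i in l, u i = x) :
    BTendsto u l x := by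
  refine ⟨{0}, isBounded_singleton, ⟨singleton_nonempty _, by simp⟩, fun ε _ => h.mono ?_⟩
  rintro i rfl
  simp

theorem BTendsto.mem_smul_of_sum_norm_le [CompleteBornSpace V] {U : Set V} (hU : IsBounded U)
    (hUc : IsCompletantDisk U) {c : ι → ℂ} {b : ι → V} (hb : ∀ i, c i ≠ 0 → b i ∈ U) {C : ℝ}
    (hC : 0 < C) (hc : ∀ s : Finset ι, ∑ i ∈ s, ‖c i‖ ≤ C) {x : V}
    (hx : BTendsto (fun s : Finset ι => ∑ i ∈ s, c i • b i) atTop x) :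
    x ∈ ((2 * C : ℝ) : ℂ) • U := by
  have hC' : (C : ℂ) ≠ 0 := by exact_mod_cast hC.ne'
  have norm_eq (i : ι) : ‖(C : ℂ)⁻¹ * c i‖ = C⁻¹ * ‖c i‖ := by
    rw [norm_mul, norm_inv, Complex.norm_real, Real.norm_of_nonneg hC.le]
  obtain ⟨y, hy, hyU⟩ := exists_bsum hU hUc (fun i => (C : ℂ)⁻¹ * c i) b
    (by simpa only [norm_eq] using
      (summable_of_sum_le (fun _ => norm_nonneg _) hc).mul_left C⁻¹)
    fun i hi => hb i (right_ne_zero_of_mul hi)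
  have hxy : x = (C : ℂ) • y := hx.unique <| by
    simpa only [Finset.smul_sum, smul_smul, mul_inv_cancel_left₀ hC'] using hy.smul (C : ℂ)
  have y_mem : y ∈ ((2 : ℝ) : ℂ) • U := by
    rw [← one_add_one_eq_two]
    refine hyU 1 fun s => ?_
    simp only [norm_eq]
    rw [← Finset.mul_sum, inv_mul_le_iff₀ hC, mul_one]
    exact hc s
  rw [hxy, mul_comm, Complex.ofReal_mul, ← smul_smul]
  exact smul_mem_smul_set y_mem

end Series

section EllOne

variable {ι : Type*}

/-- The closed unit ball of `ℓ¹(ι)`, as a set of families: for the product topology it is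
compact. -/
def ellOneBall (ι : Type*) : Set (ι → ℂ) := {a | ∀ s : Finset ι, ∑ i ∈ s, ‖a i‖ ≤ 1}

theorem isDisk_ellOneBall : IsDisk (ellOneBall ι) := by
  refine ⟨⟨0, fun s => by simp⟩, fun a ha b hb z z' hz s => ?_⟩
  calc ∑ i ∈ s, ‖(z • a + z' • b) i‖ ≤ ∑ i ∈ s, (‖z‖ * ‖a i‖ + ‖z'‖ * ‖b i‖) :=
        Finset.sum_le_sum fun i _ => by
          simpa only [Pi.add_apply, Pi.smul_apply, smul_eq_mul, norm_mul] using
            norm_add_le (z * a i) (z' * b i)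
    _ = ‖z‖ * ∑ i ∈ s, ‖a i‖ + ‖z'‖ * ∑ i ∈ s, ‖b i‖ := by
        rw [Finset.sum_add_distrib, Finset.mul_sum, Finset.mul_sum]
    _ ≤ ‖z‖ * 1 + ‖z'‖ * 1 := by gcongr; exacts [ha s, hb s]
    _ ≤ 1 := by simpa only [mul_one] using hz

theorem isCompact_ellOneBall : IsCompact (ellOneBall ι) := by
  refine (isCompact_univ_pi fun _ => isCompact_closedBall (0 : ℂ) 1).of_isClosed_subset ?_
    fun a ha i _ => by simpa using ha {i}
  simp only [ellOneBall, ofPred_forall]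
  exact isClosed_iInter fun s => isClosed_le (by fun_prop) continuous_const

theorem single_mem_ellOneBall [DecidableEq ι] (i : ι) : Pi.single i 1 ∈ ellOneBall ι := fun s => by
  calc ∑ j ∈ s, ‖(Pi.single i 1 : ι → ℂ) j‖ = ∑ j ∈ s, if i = j then (1 : ℝ) else 0 :=
        Finset.sum_congr rfl fun j _ => by
          by_cases hij : i = j
          · simp [hij]
          · simp [hij, Ne.symm hij]
    _ ≤ 1 := by rw [Finset.sum_ite_eq]; split_ifs <;> norm_num

theorem sum_norm_mul_le_of_mem_ellOneBall {a r : ι → ℂ} (ha : a ∈ ellOneBall ι) {R : ℝ}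
    (hR : 0 ≤ R) (s : Finset ι) (hr : ∀ i ∈ s, ‖r i‖ ≤ R) : ∑ i ∈ s, ‖a i * r i‖ ≤ R :=
  calc ∑ i ∈ s, ‖a i * r i‖ ≤ ∑ i ∈ s, ‖a i‖ * R := Finset.sum_le_sum fun i hi => by
        rw [norm_mul]; exact mul_le_mul_of_nonneg_left (hr i hi) (norm_nonneg _)
    _ ≤ 1 * R := by rw [← Finset.sum_mul]; gcongr; exact ha s
    _ = R := one_mul R

/- Multiplication by a null family turns pointwise convergence in the ball into convergence in
`ℓ¹`: off a finite set the factor is small, and on a finite set the convergence is uniform. -/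
theorem eventually_sum_norm_sub_mul_le {β : Type*} {l : Filter β} {α : β → ι → ℂ} {a r : ι → ℂ}
    (hα : ∀ n, α n ∈ ellOneBall ι) (ha : a ∈ ellOneBall ι) (hlim : Tendsto α l (𝓝 a))
    (hr : Tendsto r cofinite (𝓝 0)) {ε : ℝ} (hε : 0 < ε) :
    ∀ᶠ n in l, ∀ s : Finset ι, ∑ i ∈ s, ‖(α n i - a i) * r i‖ ≤ ε := by
  classical
  have large_finite : {i | ¬ ‖r i‖ < ε / 4}.Finite :=
    eventually_cofinite.1 (hr.norm.eventually_lt_const (by simpa using (by positivity : 0 < ε / 4)))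
  set F := large_finite.toFinset
  have sum_F_tendsto : Tendsto (fun n => ∑ i ∈ F, ‖(α n i - a i) * r i‖) l (𝓝 0) := by
    rw [← Finset.sum_const_zero (s := F)]
    refine tendsto_finsetSum _ fun i _ => ?_
    simpa using (((tendsto_pi_nhds.1 hlim i).sub_const (a i)).mul_const (r i)).norm
  filter_upwards [sum_F_tendsto.eventually_lt_const (half_pos hε)] with n hn s
  have on_F : ∑ i ∈ s ∩ F, ‖(α n i - a i) * r i‖ ≤ ε / 2 :=
    (Finset.sum_le_sum_of_subset_of_nonneg Finset.inter_subset_right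
      fun _ _ _ => norm_nonneg _).trans hn.le
  have r_le : ∀ i ∈ s \ F, ‖r i‖ ≤ ε / 4 := fun i hi => by
    by_contra hlt
    exact (Finset.mem_sdiff.1 hi).2 (large_finite.mem_toFinset.2 fun h => hlt h.le)
  have off_F : ∑ i ∈ s \ F, ‖(α n i - a i) * r i‖ ≤ ε / 4 + ε / 4 :=
    calc ∑ i ∈ s \ F, ‖(α n i - a i) * r i‖
        ≤ ∑ i ∈ s \ F, (‖α n i * r i‖ + ‖a i * r i‖) := Finset.sum_le_sum fun i _ => by
          rw [sub_mul]; exact norm_sub_le _ _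
      _ ≤ ε / 4 + ε / 4 := by
          rw [Finset.sum_add_distrib]
          gcongr
          · exact sum_norm_mul_le_of_mem_ellOneBall (hα n) (by positivity) _ r_le
          · exact sum_norm_mul_le_of_mem_ellOneBall ha (by positivity) _ r_le
  rw [← Finset.sum_inter_add_sum_sdiff s F]
  linarith

end EllOne

section NullHull

variable {ι V : Type*} [AddCommGroup V] [Module ℂ V] [Bornology V]

/-- The absolutely convex hull of the null family `r i • w i`: all sums `∑ (a i * r i) • w i`
with `a` in the unit ball of `ℓ¹`. -/
def nullHull (r : ι → ℂ) (w : ι → V) : Set V :=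
  {x | ∃ a ∈ ellOneBall ι, BTendsto (fun s : Finset ι => ∑ i ∈ s, (a i * r i) • w i) atTop x}

variable {r : ι → ℂ} {w : ι → V} {U : Set V}

theorem smul_mem_nullHull (i : ι) : r i • w i ∈ nullHull r w := by
  classical
  refine ⟨Pi.single i 1, single_mem_ellOneBall i, .of_eventually_eq ?_⟩
  filter_upwards [eventually_ge_atTop {i}] with s hs
  rw [Finset.sum_eq_single_of_mem i (hs (Finset.mem_singleton_self _))
    (fun j _ hj => by rw [Pi.single_eq_of_ne hj, zero_mul, zero_smul]), Pi.single_eq_same, one_mul]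

variable [CompleteBornSpace V]

theorem btendsto_sum_smul_add_smul {a b : ι → ℂ} {x y : V}
    (hx : BTendsto (fun s : Finset ι => ∑ i ∈ s, (a i * r i) • w i) atTop x)
    (hy : BTendsto (fun s : Finset ι => ∑ i ∈ s, (b i * r i) • w i) atTop y) (z z' : ℂ) :
    BTendsto (fun s : Finset ι => ∑ i ∈ s, ((z * a i + z' * b i) * r i) • w i) atTop
      (z • x + z' • y) := by
  simpa only [Finset.smul_sum, smul_smul, ← Finset.sum_add_distrib, ← add_smul, add_mul, mul_assoc]
    using (hx.smul z).add (hy.smul z')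

theorem isDisk_nullHull : IsDisk (nullHull r w) := by
  refine ⟨⟨0, 0, isDisk_ellOneBall.zero_mem, .of_eventually_eq (by simp)⟩, ?_⟩
  rintro x ⟨a, ha, hx⟩ y ⟨b, hb, hy⟩ z z' hz
  exact ⟨_, isDisk_ellOneBall.2 a ha b hb z z' hz, btendsto_sum_smul_add_smul hx hy z z'⟩

theorem exists_norm_le_of_tendsto_cofinite (hr : Tendsto r cofinite (𝓝 0)) :
    ∃ R, 0 < R ∧ ∀ i, ‖r i‖ ≤ R := by
  obtain ⟨R, hR, h⟩ := (Metric.isBounded_range_of_tendsto_cofinite hr).exists_pos_norm_le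
  exact ⟨R, hR, fun i => h _ (mem_range_self i)⟩

theorem nullHull_subset_span (hU : IsBounded U) (hUc : IsCompletantDisk U) (hw : ∀ i, w i ∈ U)
    (hr : Tendsto r cofinite (𝓝 0)) : nullHull r w ⊆ Submodule.span ℂ U := by
  rintro x ⟨a, ha, hx⟩
  obtain ⟨R, hR, hrR⟩ := exists_norm_le_of_tendsto_cofinite hr
  obtain ⟨u, hu, rfl⟩ := hx.mem_smul_of_sum_norm_le hU hUc (fun i _ => hw i) hR fun s =>
    sum_norm_mul_le_of_mem_ellOneBall ha hR.le s fun i _ => hrR i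
  exact Submodule.smul_mem _ _ (Submodule.subset_span hu)

theorem exists_btendsto_sum_mul_smul (hU : IsBounded U) (hUc : IsCompletantDisk U)
    (hw : ∀ i, w i ∈ U) (hr : Tendsto r cofinite (𝓝 0)) {a : ι → ℂ} (ha : a ∈ ellOneBall ι) :
    ∃ x, BTendsto (fun s : Finset ι => ∑ i ∈ s, (a i * r i) • w i) atTop x := by
  obtain ⟨R, hR, hrR⟩ := exists_norm_le_of_tendsto_cofinite hr
  obtain ⟨x, hx, -⟩ := exists_bsum hU hUc (fun i => a i * r i) w
    (summable_of_sum_le (fun _ => norm_nonneg _) fun s =>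
      sum_norm_mul_le_of_mem_ellOneBall ha hR.le s fun i _ => hrR i) fun i _ => hw i
  exact ⟨x, hx⟩

theorem isBornCompact_nullHull [Countable ι] (hU : IsBounded U) (hUc : IsCompletantDisk U)
    (hw : ∀ i, w i ∈ U) (hr : Tendsto r cofinite (𝓝 0)) : IsBornCompact (nullHull r w) := by
  refine ⟨U, hU, hUc, nullHull_subset_span hU hUc hw hr, fun u hu => ?_⟩
  choose α hα hαu using hu
  obtain ⟨a, ha, k, hk, hlim⟩ := isCompact_ellOneBall.isSeqCompact hα
  obtain ⟨x, hx⟩ := exists_btendsto_sum_mul_smul hU hUc hw hr ha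
  refine ⟨x, ⟨a, ha, hx⟩, k, hk, fun ε hε => eventually_atTop.1 ?_⟩
  filter_upwards [eventually_sum_norm_sub_mul_le (fun n => hα (k n)) ha hlim hr (half_pos hε)]
    with n hn
  have hux : BTendsto (fun s : Finset ι => ∑ i ∈ s, ((α (k n) i - a i) * r i) • w i) atTop
      (u (k n) - x) := by
    simpa only [one_mul, neg_one_mul, one_smul, neg_one_smul, ← sub_eq_add_neg] using
      btendsto_sum_smul_add_smul (hαu (k n)) hx 1 (-1)
  simpa only [mul_div_cancel₀ ε two_ne_zero] using
    hux.mem_smul_of_sum_norm_le hU hUc (fun i _ => hw i) (half_pos hε) hn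

end NullHull

/-! ### Slices and the approximation property -/

section Slices

variable {V W X : Type*} [AddCommGroup V] [Module ℂ V] [Bornology V]
  [AddCommGroup W] [Module ℂ W] [Bornology W] [AddCommGroup X] [Module ℂ X] [Bornology X]

open BTensor

/-- Bounded functionals separate the points of `V`. -/
def HasSeparatingDual (V : Type*) [AddCommGroup V] [Module ℂ V] [Bornology V] : Prop :=
  ∀ v : V, (∀ ω : BLin V ℂ, ω v = 0) → v = 0

theorem BTensor.lift_proj_btendsto [CompleteBornSpace X] (f : BLin V (BLin W X))
    (c : FormalTensor V W) :
    BTendsto (fun s : Finset (V × W) => ∑ p ∈ s, c.1 p • f p.1 p.2) atTop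
      (lift f (proj V W c)) := by
  rw [lift_proj]
  exact (exists_sum f c).choose_spec

theorem BTensor.lift_proj_mem_smul [CompleteBornSpace X] (f : BLin V (BLin W X))
    {c : FormalTensor V W} {a r : V × W → ℂ} (hc : ∀ p, c.1 p = a p * r p) {C ε : ℝ} (hC : 0 < C)
    (hε : 0 < ε) (ha : ∀ s : Finset (V × W), ∑ p ∈ s, ‖a p‖ ≤ C) {U : Set X} (hU : IsBounded U)
    (hUc : IsCompletantDisk U) (h : ∀ p, c.1 p ≠ 0 → r p • f p.1 p.2 ∈ (ε : ℂ) • U) :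
    lift f (proj V W c) ∈ ((2 * (C * ε) : ℝ) : ℂ) • U := by
  classical
  choose! u hu hur using h
  have norm_le (p : V × W) : ‖if c.1 p = 0 then 0 else a p * ε‖ ≤ ‖a p‖ * ε := by
    split_ifs
    · rw [norm_zero]; positivity
    · rw [norm_mul, Complex.norm_real, Real.norm_of_nonneg hε.le]
  refine BTendsto.mem_smul_of_sum_norm_le (c := fun p => if c.1 p = 0 then 0 else a p * ε) (b := u)
    hU hUc (fun p hp => hu p fun h0 => hp (if_pos h0)) (by positivity) (fun s => ?_)
    (cast ?_ (lift_proj_btendsto f c))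
  · calc _ ≤ ∑ p ∈ s, ‖a p‖ * ε := Finset.sum_le_sum fun p _ => norm_le p
      _ ≤ C * ε := by rw [← Finset.sum_mul]; gcongr; exact ha s
  · congr 1
    funext s
    refine Finset.sum_congr rfl fun p _ => ?_
    split_ifs with h0
    · rw [h0, zero_smul, zero_smul]
    · rw [mul_smul, hc, mul_smul, ← hur p h0]

/- The coefficients of the null family `r p • p.2` are split off the absolutely summable
coefficients of `c`, so that the second legs lie in a compact disk. -/
theorem FormalTensor.exists_isBornCompact {V : Type*} [Bornology V] [CompleteBornSpace W]
    (c : FormalTensor V W) :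
    ∃ a r : V × W → ℂ, (Summable fun p => ‖a p‖) ∧ (∀ p, c.1 p = a p * r p) ∧
      ∃ K : Set W, IsDisk K ∧ IsBornCompact K ∧ ∀ p, c.1 p ≠ 0 → r p • p.2 ∈ K := by
  obtain ⟨hc, S, T, -, hT, hcST⟩ := c.2
  obtain ⟨U, hU, hUc, hTU⟩ := exists_completant hT
  obtain ⟨a, r, ha, hr, har⟩ := exists_eq_summable_mul_tendsto_zero hc
  have : Countable {p // c.1 p ≠ 0} :=
    (hc.countable_support.mono fun p hp => norm_ne_zero_iff.2 hp).to_subtype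
  exact ⟨a, r, ha, har, nullHull (fun p : {p // c.1 p ≠ 0} => r p) fun p => p.1.2,
    isDisk_nullHull, isBornCompact_nullHull hU hUc (fun p => hTU (hcST _ p.2).2)
      (hr.comp Subtype.val_injective.tendsto_cofinite),
    fun p hp => smul_mem_nullHull (r := fun p : {p // c.1 p ≠ 0} => r p) ⟨p, hp⟩⟩

variable [CompleteBornSpace V] [CompleteBornSpace W]

theorem BTensor.apply_sliceRight (η : BLin V ℂ) (ω : BLin W ℂ) :
    ∀ t, η (sliceRight ω t) = ω (sliceLeft η t) :=
  ext_fun fun v w => by simp [mul_comm]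

theorem IsFiniteRank.map_id_eq_zero {f : BLin W W} (hf : IsFiniteRank f) {t : BTensor V W}
    (h : ∀ ω : BLin W ℂ, sliceRight ω t = 0) : map (BLin.id V) f t = 0 := by
  obtain ⟨m, w, ω, hfw⟩ := hf
  have map_eq : ∀ t : BTensor V W,
      map (BLin.id V) f t = ∑ i, tmul (sliceRight (ω i) t) (w i) :=
    ext_fun fun v x => by simp [hfw]
  simp [map_eq, h]

theorem ApproximationProperty.exists_btendsto_map_id (hW : ApproximationProperty W)
    (t : BTensor V W) : ∃ f : ℕ → BLin W W, (∀ n, IsFiniteRank (f n)) ∧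
      BTendsto (fun n => map (BLin.id V) (f n) t) atTop t := by
  obtain ⟨c, rfl⟩ := proj_surjective V W t
  obtain ⟨-, S, T₀, hS, -, hcS⟩ := c.2
  obtain ⟨a, r, ha, har, K, hKd, hKc, hK⟩ := FormalTensor.exists_isBornCompact c
  obtain ⟨f, hf, T, hT, -, hlim⟩ := hW K hKd hKc
  obtain ⟨U, hU, hUc, hSTU⟩ := exists_completant
    ((tmul : BLin V (BLin W (BTensor V W))).bounded₂ hS hT)
  obtain ⟨C, hC, haC⟩ : ∃ C, 0 < C ∧ ∀ s : Finset (V × W), ∑ p ∈ s, ‖a p‖ ≤ C :=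
    ⟨∑' p, ‖a p‖ + 1, by positivity, fun s =>
      (ha.sum_le_tsum s fun p _ => norm_nonneg _).trans (lt_add_one _).le⟩
  refine ⟨f, hf, U, hU, hUc.1, fun ε hε => ?_⟩
  obtain ⟨N, hN⟩ := hlim (ε / (2 * C)) (by positivity)
  filter_upwards [eventually_ge_atTop N] with n hn
  have map_sub_eq : ∀ t : BTensor V W, map (BLin.id V) (f n) t - t =
      lift ((BLin.compB.flip (f n - BLin.id W)).comp tmul) t := fun t => by
    revert t
    exact ext_fun fun v w => by simp
  rw [map_sub_eq, (by field_simp : ε = 2 * (C * (ε / (2 * C))))]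
  refine lift_proj_mem_smul _ har hC (by positivity) haC hU hUc fun p hp => ?_
  obtain ⟨y, hy, hyf⟩ := hN n hn _ (hK p hp)
  refine ⟨tmul p.1 y, hSTU (mem_image2_of_mem (hcS p hp).1 hy), ?_⟩
  calc ((ε / (2 * C) : ℝ) : ℂ) • tmul p.1 y = tmul p.1 (f n (r p • p.2) - r p • p.2) := by
        rw [← hyf, map_smul]
    _ = _ := by simp [smul_sub]

theorem ApproximationProperty.slice_eq_zero (hW : ApproximationProperty W) (t : BTensor V W)
    (h : ∀ ω : BLin W ℂ, sliceRight ω t = 0) : t = 0 := by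
  obtain ⟨f, hf, hlim⟩ := hW.exists_btendsto_map_id t
  exact hlim.unique (.of_eventually_eq (.of_forall fun n => (hf n).map_id_eq_zero h))

theorem HasSeparatingDual.tensor_right (hV : HasSeparatingDual V) (hW : ApproximationProperty W) :
    HasSeparatingDual (BTensor V W) := fun t ht =>
  hW.slice_eq_zero t fun ω => hV _ fun η => ht (η.comp (sliceRight ω))

variable [CompleteBornSpace X] {ι : Type*} {F : ι → BLin W X}

theorem ApproximationProperty.id_map_ext (hV : ApproximationProperty V)
    (hF : ∀ x, (∀ i, F i x = 0) → x = 0) {s t : BTensor V W}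
    (h : ∀ i, map (BLin.id V) (F i) s = map (BLin.id V) (F i) t) : s = t := by
  have apply_slice (η : BLin V ℂ) (i : ι) : ∀ t : BTensor V W,
      F i (sliceRight η (swap t)) = sliceLeft η (map (BLin.id V) (F i) t) :=
    ext_fun fun v w => by simp
  have swap_eq_zero : swap (s - t) = 0 := hV.slice_eq_zero _ fun η => hF _ fun i => by
    rw [apply_slice, map_sub, h, sub_self, map_zero]
  rw [← sub_eq_zero, ← swap_swap (s - t), swap_eq_zero, map_zero]

theorem ApproximationProperty.map_id_ext (hW : ApproximationProperty W) (hV : HasSeparatingDual V)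
    (hF : ∀ x, (∀ i, F i x = 0) → x = 0) {s t : BTensor V W}
    (h : ∀ i, map (BLin.id V) (F i) s = map (BLin.id V) (F i) t) : s = t := by
  have apply_slice (η : BLin V ℂ) (i : ι) : ∀ t : BTensor V W,
      F i (sliceLeft η t) = sliceLeft η (map (BLin.id V) (F i) t) :=
    ext_fun fun v w => by simp
  have slice_eq_zero (η : BLin V ℂ) : sliceLeft η (s - t) = 0 := hF _ fun i => by
    rw [apply_slice, map_sub, h, sub_self, map_zero]
  refine sub_eq_zero.1 (hW.slice_eq_zero _ fun ω => hV _ fun η => ?_)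
  rw [apply_sliceRight, slice_eq_zero, map_zero]

theorem ApproximationProperty.map_ext_id (hW : ApproximationProperty W) (hV : HasSeparatingDual V)
    (hF : ∀ x, (∀ i, F i x = 0) → x = 0) {s t : BTensor W V}
    (h : ∀ i, map (F i) (BLin.id V) s = map (F i) (BLin.id V) t) : s = t := by
  have map_swap (i : ι) : ∀ t : BTensor W V,
      map (BLin.id V) (F i) (swap t) = swap (map (F i) (BLin.id V) t) :=
    ext_fun fun v w => by simp
  have swap_eq : swap s = swap t := hW.map_id_ext hV hF fun i => by rw [map_swap, map_swap, h]
  rw [← swap_swap s, swap_eq, swap_swap]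

end Slices

/-! ### Multiplication on a leg of a tensor product -/

section LegMultiplication

variable {A B V W X : Type*} [NonUnitalRing A] [Module ℂ A] [IsScalarTower ℂ A A]
  [SMulCommClass ℂ A A] [Bornology A] [BornAlgebra A] [NonUnitalRing B] [Module ℂ B]
  [IsScalarTower ℂ B B] [SMulCommClass ℂ B B] [Bornology B] [BornAlgebra B] [AddCommGroup V]
  [Module ℂ V] [Bornology V] [CompleteBornSpace V] [AddCommGroup W] [Module ℂ W] [Bornology W]
  [CompleteBornSpace W] [AddCommGroup X] [Module ℂ X] [Bornology X]

open BTensor Multiplier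

local notation:75 x:76 " ⊠ " y:75 => BTensor.tmul x y

/-- Left multiplication by `a` on the first leg. -/
def lmulFst (a : A) : BLin (BTensor A V) (BTensor A V) := map (mulB a) (BLin.id V)

/-- Right multiplication by `a` on the first leg. -/
def rmulFst (a : A) : BLin (BTensor A V) (BTensor A V) := map (mulB.flip a) (BLin.id V)

/-- Left multiplication by `b` on the second leg. -/
def lmulSnd (b : B) : BLin (BTensor V B) (BTensor V B) := map (BLin.id V) (mulB b)

/-- Right multiplication by `b` on the second leg. -/
def rmulSnd (b : B) : BLin (BTensor V B) (BTensor V B) := map (BLin.id V) (mulB.flip b)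

@[simp] theorem lmulFst_tmul (a x : A) (v : V) : lmulFst a (x ⊠ v) = (a * x) ⊠ v := by
  simp [lmulFst]

@[simp] theorem rmulFst_tmul (a x : A) (v : V) : rmulFst a (x ⊠ v) = (x * a) ⊠ v := by
  simp [rmulFst]

@[simp] theorem lmulSnd_tmul (b y : B) (v : V) : lmulSnd b (v ⊠ y) = v ⊠ (b * y) := by
  simp [lmulSnd]

@[simp] theorem rmulSnd_tmul (b y : B) (v : V) : rmulSnd b (v ⊠ y) = v ⊠ (y * b) := by
  simp [rmulSnd]

@[fun_prop] theorem isBLin_rmulFst {F : X → A} (hF : IsBLin F) :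
    IsBLin (fun x => (rmulFst (F x) : BLin (BTensor A V) (BTensor A V))) :=
  IsBLin.map_left ((IsBLin.blin mulB.flip).comp hF) (BLin.id V)

theorem lmulFst_lmulSnd (a : A) (b : B) : ∀ t, lmulFst a (lmulSnd b t) = a ⊠ b * t :=
  ext_fun fun x y => by simp

theorem lmulSnd_lmulFst (a : A) (b : B) : ∀ t, lmulSnd b (lmulFst a t) = a ⊠ b * t :=
  ext_fun fun x y => by simp

theorem rmulFst_rmulSnd (a : A) (b : B) : ∀ t, rmulFst a (rmulSnd b t) = t * a ⊠ b :=
  ext_fun fun x y => by simp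

theorem rmulSnd_rmulFst (a : A) (b : B) : ∀ t, rmulSnd b (rmulFst a t) = t * a ⊠ b :=
  ext_fun fun x y => by simp

theorem lmulFst_mul (a : A) (s t : BTensor A B) : lmulFst a (s * t) = lmulFst a s * t :=
  (tensor (ι A a) 1).L_mul s t

theorem lmulSnd_mul (b : B) (s t : BTensor A B) : lmulSnd b (s * t) = lmulSnd b s * t :=
  (tensor 1 (ι B b)).L_mul s t

theorem mul_lmulFst (a : A) (s t : BTensor A B) : s * lmulFst a t = rmulFst a s * t :=
  (tensor (ι A a) 1).mul_L s t

theorem mul_lmulSnd (b : B) (s t : BTensor A B) : s * lmulSnd b t = rmulSnd b s * t :=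
  (tensor 1 (ι B b)).mul_L s t

theorem lmulFst_mul_apply (a a' : A) :
    ∀ t : BTensor A V, lmulFst (a * a') t = lmulFst a (lmulFst a' t) :=
  ext_fun fun x v => by simp [mul_assoc]

theorem lmulSnd_mul_apply (b b' : B) :
    ∀ t : BTensor V B, lmulSnd (b * b') t = lmulSnd b (lmulSnd b' t) :=
  ext_fun fun v y => by simp [mul_assoc]

theorem rmulSnd_mul_apply (b b' : B) :
    ∀ t : BTensor V B, rmulSnd (b * b') t = rmulSnd b' (rmulSnd b t) :=
  ext_fun fun v y => by simp [mul_assoc]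

theorem assoc_lmulFst (a : A) (v : V) :
    ∀ t : BTensor A W, assoc (lmulFst a t ⊠ v) = lmulFst a (assoc (t ⊠ v)) :=
  ext_fun fun x w => by simp

theorem assoc_rmulFst (a : A) (v : V) :
    ∀ t : BTensor A W, assoc (rmulFst a t ⊠ v) = rmulFst a (assoc (t ⊠ v)) :=
  ext_fun fun x w => by simp

theorem leg12_lmulSnd (F : BLin (BTensor V W) (BTensor V W)) (b : B) (v : V) :
    ∀ t, leg12 F (v ⊠ lmulSnd b t) = map (BLin.id V) (lmulSnd b) (leg12 F (v ⊠ t)) := by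
  have assoc_tmul_mul (y : B) : ∀ t : BTensor V W,
      assoc (t ⊠ (b * y)) = map (BLin.id V) (lmulSnd b) (assoc (t ⊠ y)) :=
    ext_fun fun v w => by simp
  exact ext_fun fun w y => by rw [lmulSnd_tmul, leg12_tmul, leg12_tmul, assoc_tmul_mul]

theorem leg12_rmulSnd (F : BLin (BTensor V W) (BTensor V W)) (b : B) (v : V) :
    ∀ t, leg12 F (v ⊠ rmulSnd b t) = map (BLin.id V) (rmulSnd b) (leg12 F (v ⊠ t)) := by
  have assoc_tmul_mul (y : B) : ∀ t : BTensor V W,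
      assoc (t ⊠ (y * b)) = map (BLin.id V) (rmulSnd b) (assoc (t ⊠ y)) :=
    ext_fun fun v w => by simp
  exact ext_fun fun w y => by rw [rmulSnd_tmul, leg12_tmul, leg12_tmul, assoc_tmul_mul]

theorem sliceLeft_lmulSnd (ω : BLin V ℂ) (b : B) :
    ∀ t, sliceLeft ω (lmulSnd b t) = b * sliceLeft ω t :=
  ext_fun fun x y => by simp [mul_smul_comm]

theorem sliceLeft_rmulSnd (ω : BLin V ℂ) (b : B) :
    ∀ t, sliceLeft ω (rmulSnd b t) = sliceLeft ω t * b :=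
  ext_fun fun x y => by simp [smul_mul_assoc]

theorem sliceRight_lmulFst (ω : BLin V ℂ) (a : A) :
    ∀ t, sliceRight ω (lmulFst a t) = a * sliceRight ω t :=
  ext_fun fun x y => by simp [mul_smul_comm]

theorem sliceRight_rmulFst (ω : BLin V ℂ) (a : A) :
    ∀ t, sliceRight ω (rmulFst a t) = sliceRight ω t * a :=
  ext_fun fun x y => by simp [smul_mul_assoc]

end LegMultiplication

/-! ### Nondegeneracy -/

namespace IsFaithful

variable {A : Type*} [NonUnitalRing A] [Module ℂ A] [Bornology A] {ω : BLin A ℂ}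

theorem eq_zero_of_mul_right (hω : IsFaithful ω) (a : A) (h : ∀ b, a * b = 0) : a = 0 :=
  hω.1 a fun b => by rw [h, map_zero]

theorem eq_zero_of_mul_left (hω : IsFaithful ω) (b : A) (h : ∀ a, a * b = 0) : b = 0 :=
  hω.2 b fun a => by rw [h, map_zero]

theorem eq_of_mul_right (hω : IsFaithful ω) {a a' : A} (h : ∀ b, a * b = a' * b) : a = a' :=
  sub_eq_zero.1 (hω.eq_zero_of_mul_right _ fun b => by rw [sub_mul, h, sub_self])

theorem eq_of_mul_left (hω : IsFaithful ω) {b b' : A} (h : ∀ a, a * b = a * b') : b = b' :=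
  sub_eq_zero.1 (hω.eq_zero_of_mul_left _ fun a => by rw [mul_sub, h, sub_self])

end IsFaithful

section Nondegeneracy

variable {A B V X : Type*} [NonUnitalRing A] [Module ℂ A] [IsScalarTower ℂ A A]
  [SMulCommClass ℂ A A] [Bornology A] [BornAlgebra A] [NonUnitalRing B] [Module ℂ B]
  [IsScalarTower ℂ B B] [SMulCommClass ℂ B B] [Bornology B] [BornAlgebra B] [AddCommGroup V]
  [Module ℂ V] [Bornology V] [CompleteBornSpace V] [AddCommGroup X] [Module ℂ X] [Bornology X]
  [CompleteBornSpace X]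

open BTensor

namespace IsFaithful

variable {ω : BLin A ℂ} {η : BLin B ℂ}

theorem hasSeparatingDual (hω : IsFaithful ω) : HasSeparatingDual A := fun a h =>
  hω.1 a fun b => h (ω.comp (mulB.flip b))

theorem ext_rmulFst (hω : IsFaithful ω) (hA : ApproximationProperty A) (hV : HasSeparatingDual V)
    {s t : BTensor A V} (h : ∀ a, rmulFst a s = rmulFst a t) : s = t :=
  hA.map_ext_id hV hω.eq_zero_of_mul_right h

theorem ext_lmulFst (hω : IsFaithful ω) (hA : ApproximationProperty A) (hV : HasSeparatingDual V)
    {s t : BTensor A V} (h : ∀ a, lmulFst a s = lmulFst a t) : s = t :=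
  hA.map_ext_id hV hω.eq_zero_of_mul_left h

theorem ext_rmulSnd (hω : IsFaithful ω) (hA : ApproximationProperty A) (hV : HasSeparatingDual V)
    {s t : BTensor V A} (h : ∀ a, rmulSnd a s = rmulSnd a t) : s = t :=
  hA.map_id_ext hV hω.eq_zero_of_mul_right h

theorem ext_lmulSnd (hω : IsFaithful ω) (hA : ApproximationProperty A) (hV : HasSeparatingDual V)
    {s t : BTensor V A} (h : ∀ a, lmulSnd a s = lmulSnd a t) : s = t :=
  hA.map_id_ext hV hω.eq_zero_of_mul_left h

theorem tensor_ext_right (hω : IsFaithful ω) (hη : IsFaithful η) (hA : ApproximationProperty A)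
    (hB : ApproximationProperty B) {s t : BTensor A B} (h : ∀ z, s * z = t * z) : s = t :=
  hω.ext_rmulFst hA hη.hasSeparatingDual fun a => hη.ext_rmulSnd hB hω.hasSeparatingDual fun b => by
    rw [rmulSnd_rmulFst, rmulSnd_rmulFst, h]

theorem tensor_ext_left (hω : IsFaithful ω) (hη : IsFaithful η) (hA : ApproximationProperty A)
    (hB : ApproximationProperty B) {s t : BTensor A B} (h : ∀ z, z * s = z * t) : s = t :=
  hω.ext_lmulFst hA hη.hasSeparatingDual fun a => hη.ext_lmulSnd hB hω.hasSeparatingDual fun b => by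
    rw [lmulSnd_lmulFst, lmulSnd_lmulFst, h]

end IsFaithful

theorem IsEssentialAlgebra.exists_lift_mulB_eq (hA : IsEssentialAlgebra A) (a : A) :
    ∃ t, lift mulB t = a := by
  obtain ⟨k, -, hk⟩ := hA.2
  obtain ⟨t, ht⟩ := BalancedTensor.mk_surjective _ _ (k a)
  exact ⟨t, (BalancedTensor.lift_mk _ _ t).symm.trans ((congrArg _ ht).trans (hk a))⟩

theorem IsEssentialAlgebra.ext_fun (hA : IsEssentialAlgebra A) {F G : A → X}
    (h : ∀ a b, F (a * b) = G (a * b)) (hF : IsBLin F := by fun_prop)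
    (hG : IsBLin G := by fun_prop) (a : A) : F a = G a := by
  obtain ⟨t, rfl⟩ := hA.exists_lift_mulB_eq a
  revert t
  exact BTensor.ext_fun fun a b => by rw [lift_tmul, mulB_apply, h]

theorem IsEssentialHom.ext_fun {f : BLin A (Multiplier B)} (hf : IsEssentialHom f) {F G : B → X}
    (h : ∀ a b, F ((f a).L b) = G ((f a).L b)) (hF : IsBLin F := by fun_prop)
    (hG : IsBLin G := by fun_prop) (b : B) : F b = G b := by
  obtain ⟨F', hF'⟩ := hF
  obtain ⟨G', hG'⟩ := hG
  rw [← hF', ← hG']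
  exact hf.ext_left (fun a b => by rw [hF', hG', h]) b

end Nondegeneracy

namespace BornQuantumGroup

variable {H : Type*} [NonUnitalRing H] [Module ℂ H] [IsScalarTower ℂ H H] [SMulCommClass ℂ H H]
  [Bornology H] [BornAlgebra H]

open BTensor Multiplier

local notation:75 x:76 " ⊠ " y:75 => BTensor.tmul x y

theorem hasSeparatingDual_tensor (Q : BornQuantumGroup H) : HasSeparatingDual (BTensor H H) :=
  Q.faithful.hasSeparatingDual.tensor_right Q.approximation

theorem tensor_ext_right (Q : BornQuantumGroup H) {s t : BTensor H H}
    (h : ∀ z, s * z = t * z) : s = t :=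
  Q.faithful.tensor_ext_right Q.faithful Q.approximation Q.approximation h

theorem tensor_ext_left (Q : BornQuantumGroup H) {s t : BTensor H H}
    (h : ∀ z, z * s = z * t) : s = t :=
  Q.faithful.tensor_ext_left Q.faithful Q.approximation Q.approximation h

/-! ### Galois maps and the comultiplication -/

variable (Q : BornQuantumGroup H)

theorem Δ_mul (f g : H) : Q.Δ (f * g) = Q.Δ f * Q.Δ g := Q.comul.essential.map_mul f g

theorem γl_mul (f g : H) (t : BTensor H H) : Q.γl (f ⊠ g) * t = (Q.Δ f).L (lmulFst g t) :=
  congrArg (fun m => m.L t) (Q.γl_spec f g)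

theorem γr_mul (f g : H) (t : BTensor H H) : Q.γr (f ⊠ g) * t = (Q.Δ f).L (lmulSnd g t) :=
  congrArg (fun m => m.L t) (Q.γr_spec f g)

theorem mul_ρl (f g : H) (t : BTensor H H) : t * Q.ρl (f ⊠ g) = (Q.Δ g).R (rmulFst f t) :=
  congrArg (fun m => m.R t) (Q.ρl_spec f g)

theorem mul_ρr (f g : H) (t : BTensor H H) : t * Q.ρr (f ⊠ g) = (Q.Δ g).R (rmulSnd f t) :=
  congrArg (fun m => m.R t) (Q.ρr_spec f g)

theorem Δ_L_eq_γr (f x y : H) : (Q.Δ f).L (x ⊠ y) = rmulFst x (Q.γr (f ⊠ y)) :=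
  Q.tensor_ext_right fun z => by
    rw [← Multiplier.L_mul, ← mul_lmulFst, γr_mul, lmulSnd_lmulFst]

theorem Δ_L_eq_γl (f x y : H) : (Q.Δ f).L (x ⊠ y) = rmulSnd y (Q.γl (f ⊠ x)) :=
  Q.tensor_ext_right fun z => by
    rw [← Multiplier.L_mul, ← mul_lmulSnd, γl_mul, lmulFst_lmulSnd]

theorem Δ_R_eq_ρr (f x y : H) : (Q.Δ f).R (x ⊠ y) = lmulFst x (Q.ρr (y ⊠ f)) :=
  Q.tensor_ext_left fun z => by
    rw [← Multiplier.R_mul, mul_lmulFst, mul_ρr, rmulSnd_rmulFst]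

theorem Δ_R_eq_ρl (f x y : H) : (Q.Δ f).R (x ⊠ y) = lmulSnd y (Q.ρl (x ⊠ f)) :=
  Q.tensor_ext_left fun z => by
    rw [← Multiplier.R_mul, mul_lmulSnd, mul_ρl, rmulFst_rmulSnd]

theorem γr_mul_right (f g h : H) : Q.γr (f ⊠ (g * h)) = rmulSnd h (Q.γr (f ⊠ g)) :=
  Q.tensor_ext_right fun z => by
    rw [γr_mul, ← mul_lmulSnd, γr_mul, lmulSnd_mul_apply]

theorem γl_mul_right (f g h : H) : Q.γl (f ⊠ (g * h)) = rmulFst h (Q.γl (f ⊠ g)) :=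
  Q.tensor_ext_right fun z => by
    rw [γl_mul, ← mul_lmulFst, γl_mul, lmulFst_mul_apply]

theorem ρr_mul_left (f g h : H) : Q.ρr ((f * g) ⊠ h) = lmulSnd f (Q.ρr (g ⊠ h)) :=
  Q.tensor_ext_left fun z => by
    rw [mul_ρr, mul_lmulSnd, mul_ρr, rmulSnd_mul_apply]

theorem γr_mul_left (f g h : H) : Q.γr ((f * g) ⊠ h) = (Q.Δ f).L (Q.γr (g ⊠ h)) :=
  Q.tensor_ext_right fun z => by
    rw [← Multiplier.L_mul, γr_mul, γr_mul, Δ_mul, mul_L_apply]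

theorem γl_mul_left (f g h : H) : Q.γl ((f * g) ⊠ h) = (Q.Δ f).L (Q.γl (g ⊠ h)) :=
  Q.tensor_ext_right fun z => by
    rw [← Multiplier.L_mul, γl_mul, γl_mul, Δ_mul, mul_L_apply]

theorem lmulFst_γr (c f g : H) : lmulFst c (Q.γr (f ⊠ g)) = rmulSnd g (Q.ρl (c ⊠ f)) :=
  Q.tensor_ext_right fun z => Q.tensor_ext_left fun w => by
    rw [← lmulFst_mul, mul_lmulFst, γr_mul, Multiplier.mul_L, ← mul_lmulSnd, ← mul_assoc, mul_ρl]

theorem lmulSnd_γr (c f g : H) : lmulSnd c (Q.γr (f ⊠ g)) = rmulSnd g (Q.ρr (c ⊠ f)) :=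
  Q.tensor_ext_right fun z => Q.tensor_ext_left fun w => by
    rw [← lmulSnd_mul, mul_lmulSnd, γr_mul, Multiplier.mul_L, ← mul_lmulSnd, ← mul_assoc, mul_ρr]

theorem lmulSnd_γl (c f g : H) : lmulSnd c (Q.γl (f ⊠ g)) = rmulFst g (Q.ρr (c ⊠ f)) :=
  Q.tensor_ext_right fun z => Q.tensor_ext_left fun w => by
    rw [← lmulSnd_mul, mul_lmulSnd, γl_mul, Multiplier.mul_L, ← mul_lmulFst, ← mul_assoc, mul_ρr]

theorem lmulFst_γl (c f g : H) : lmulFst c (Q.γl (f ⊠ g)) = rmulFst g (Q.ρl (c ⊠ f)) :=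
  Q.tensor_ext_right fun z => Q.tensor_ext_left fun w => by
    rw [← lmulFst_mul, mul_lmulFst, γl_mul, Multiplier.mul_L, ← mul_lmulFst, ← mul_assoc, mul_ρl]

/-! ### Coassociativity -/

/-- The map `q ↦ Δ(q) s`, used to write `p ⊗ q ↦ p ⊗ Δ(q) s` as a map of tensor products. -/
def comulApply (s : BTensor H H) : BLin H (BTensor H H) := (LB.comp Q.Δ).flip s

@[simp] theorem comulApply_apply (s : BTensor H H) (q : H) : Q.comulApply s q = (Q.Δ q).L s := rfl

@[fun_prop] theorem isBLin_comulApply {V : Type*} [AddCommGroup V] [Module ℂ V] [Bornology V]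
    {F : V → BTensor H H} (hF : IsBLin F) : IsBLin (fun x => Q.comulApply (F x)) :=
  (IsBLin.blin (LB.comp Q.Δ).flip).comp hF

theorem extendsAt_Δ_ι_L {f : H} {m : Multiplier (BTensor (BTensor H H) H)}
    (hm : ExtendsAt (tensorHom Q.Δ (ι H)) (Q.Δ f) m) (y : H) :
    ∀ v, m.L (v ⊠ y) = map (Q.comulApply v) (BLin.id H) (Q.γr (f ⊠ y)) := by
  refine Q.comul.essential.ext_fun fun b t => ?_
  revert y
  refine Q.essential.ext_fun fun y y' => ?_
  have L_tmul := hm.1 (b ⊠ y) (t ⊠ y')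
  rw [tensorHom_tmul, tensor_L, map_tmul, ι_L, Δ_L_eq_γr] at L_tmul
  rw [L_tmul, γr_mul_right]
  generalize Q.γr (f ⊠ y) = u
  revert u
  exact ext_fun fun p q => by simp [Δ_mul]

theorem extendsAt_ι_Δ_L {f : H} {n : Multiplier (BTensor H (BTensor H H))}
    (hn : ExtendsAt (tensorHom (ι H) Q.Δ) (Q.Δ f) n) (g : H) (s : BTensor H H) :
    ∀ a, n.L (a ⊠ (Q.Δ g).L s) = rmulFst a (map (BLin.id H) (Q.comulApply s) (Q.γr (f ⊠ g))) := by
  refine Q.essential.ext_fun fun a a' => ?_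
  have L_tmul := hn.1 (a ⊠ g) (a' ⊠ s)
  rw [tensorHom_tmul, tensor_L, map_tmul, ι_L, Δ_L_eq_γr] at L_tmul
  rw [L_tmul]
  generalize Q.γr (f ⊠ g) = u
  revert u
  exact ext_fun fun p q => by simp [mul_assoc]

theorem assoc_map_comulApply (a x : H) : ∀ u, assoc (map (Q.comulApply (a ⊠ x)) (BLin.id H) u) =
    rmulFst a (leg12 Q.γr (insertMid x u)) :=
  ext_fun fun p q => by
    rw [map_tmul, comulApply_apply, Δ_L_eq_γr, BLin.id_apply, assoc_rmulFst, insertMid_tmul,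
      leg12_tmul]

/-- Coassociativity in terms of `γr`. -/
theorem map_comulApply_γr (f g : H) (s : BTensor H H) :
    map (BLin.id H) (Q.comulApply s) (Q.γr (f ⊠ g)) =
      leg12 Q.γr (leg13 Q.γr (f ⊠ (Q.Δ g).L s)) := by
  obtain ⟨m, n, hm, hn, hmn, -⟩ := Q.comul.coassoc f
  have n_L_tmul (a : H) : ∀ v, n.L (a ⊠ v) = rmulFst a (leg12 Q.γr (leg13 Q.γr (f ⊠ v))) :=
    ext_fun fun x y => by
      rw [← assoc_tmul, ← hmn, Q.extendsAt_Δ_ι_L hm, assoc_map_comulApply, leg13_tmul]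
  refine Q.faithful.ext_rmulFst Q.approximation Q.hasSeparatingDual_tensor fun a => ?_
  rw [← n_L_tmul, Q.extendsAt_ι_Δ_L hn]

theorem map_comulApply_ρl (c f : H) : ∀ s, map (BLin.id H) (Q.comulApply s) (Q.ρl (c ⊠ f)) =
    lmulFst c (leg12 Q.γr (leg13 Q.γr (f ⊠ s))) := by
  refine Q.comul.essential.ext_fun fun g t => ?_
  have lmulFst_map : ∀ u, lmulFst c (map (BLin.id H) (Q.comulApply t) u) =
      map (BLin.id H) (Q.comulApply t) (lmulFst c u) :=
    ext_fun fun p q => by simp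
  rw [← map_comulApply_γr, lmulFst_map, lmulFst_γr]
  generalize Q.ρl (c ⊠ f) = u
  revert u
  exact ext_fun fun p q => by simp [Δ_mul]

theorem map_rmulFst_map_γr_assoc (x y : H) : ∀ u,
    map (BLin.id H) (rmulFst x) (map (BLin.id H) Q.γr (assoc (u ⊠ y))) =
      map (BLin.id H) (Q.comulApply (x ⊠ y)) u :=
  ext_fun fun p q => by simp [Δ_L_eq_γr]

theorem leg12_ρl_γr (c f y : H) : leg12 Q.ρl (c ⊠ Q.γr (f ⊠ y)) =
    map (BLin.id H) Q.γr (assoc (Q.ρl (c ⊠ f) ⊠ y)) := by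
  refine Q.approximation.id_map_ext (F := fun x : H => (rmulFst x : BLin (BTensor H H) _))
    (fun t ht => Q.faithful.ext_rmulFst Q.approximation Q.faithful.hasSeparatingDual fun x => by
      rw [ht, map_zero]) fun x => ?_
  rw [map_rmulFst_map_γr_assoc, map_comulApply_ρl, leg13_tmul]
  generalize Q.γr (f ⊠ y) = u
  revert u
  refine ext_fun fun p q => ?_
  rw [leg12_tmul, insertMid_tmul, leg12_tmul, ← assoc_lmulFst, lmulFst_γr]
  generalize Q.ρl (c ⊠ p) = u
  revert u
  exact ext_fun fun p q => by simp

theorem leg12_ρl_ρr (c x f : H) : leg12 Q.ρl (c ⊠ Q.ρr (x ⊠ f)) =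
    map (BLin.id H) (Q.ρr.comp (tmul x)) (Q.ρl (c ⊠ f)) := by
  refine Q.approximation.id_map_ext (F := fun y : H => (rmulSnd y : BLin (BTensor H H) _))
    (fun t ht => Q.faithful.ext_rmulSnd Q.approximation Q.faithful.hasSeparatingDual fun x => by
      rw [ht, map_zero]) fun y => ?_
  rw [← leg12_rmulSnd, ← lmulSnd_γr, leg12_lmulSnd, leg12_ρl_γr]
  generalize Q.ρl (c ⊠ f) = u
  revert u
  exact ext_fun fun p q => by simp [lmulSnd_γr]

end BornQuantumGroup

/-! ### Characters -/

section Balanced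

variable {A V W : Type*} [AddCommGroup A] [Module ℂ A] [Bornology A] [AddCommGroup V] [Module ℂ V]
  [Bornology V] [AddCommGroup W] [Module ℂ W] [Bornology W]

local notation:75 x:76 " ⊠ " y:75 => BTensor.tmul x y

theorem BLin.exists_apply_eq_one {ω : BLin V ℂ} (hω : ω ≠ 0) : ∃ v, ω v = 1 := by
  contrapose! hω
  ext v
  by_contra hv
  exact hω ((ω v)⁻¹ • v) (by rw [map_smul, smul_eq_mul, inv_mul_cancel₀ hv])

theorem BTensor.smul_tmul (c : ℂ) (v : V) (w : W) : (c • v) ⊠ w = v ⊠ (c • w) := by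
  rw [map_smul, map_smul, BLin.smul_apply]

theorem BTensor.ext_fun_of_surjective {X Y : Type*} [AddCommGroup X] [Module ℂ X] [Bornology X]
    [CompleteBornSpace X] [AddCommGroup Y] [Module ℂ Y] [Bornology Y] {E : BLin (BTensor V W) Y}
    (hE : Function.Surjective E) {F G : Y → X} (h : ∀ v w, F (E (v ⊠ w)) = G (E (v ⊠ w)))
    (hF : IsBLin F := by fun_prop) (hG : IsBLin G := by fun_prop) (y : Y) : F y = G y := by
  obtain ⟨t, rfl⟩ := hE y
  exact BTensor.ext_fun h (hF.comp (IsBLin.blin E)) (hG.comp (IsBLin.blin E)) t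

theorem BalancedTensor.mk_balanced [CompleteBornSpace V] [CompleteBornSpace W]
    (ρ : BLin V (BLin A V)) (l : BLin A (BLin W W)) (v : V) (a : A) (w : W) :
    mk ρ l (ρ v a ⊠ w) = mk ρ l (v ⊠ l a w) := by
  rw [← sub_eq_zero, ← map_sub]
  exact (BQuot.mk_eq_zero _).2 (subset_closedSpan _ ⟨v, a, w, rfl⟩)

end Balanced

section Character

variable {A V : Type*} [NonUnitalRing A] [Module ℂ A] [IsScalarTower ℂ A A]
  [SMulCommClass ℂ A A] [Bornology A] [BornAlgebra A] [AddCommGroup V] [Module ℂ V] [Bornology V]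

open BTensor Multiplier

local notation:75 x:76 " ⊠ " y:75 => BTensor.tmul x y

variable {χ : BLin A ℂ}

theorem mk_lift_mulB_tmul (s : BTensor A A) (z : ℂ) :
    BalancedTensor.mk mulB (leftAction ((ι ℂ).comp χ)) (lift mulB s ⊠ z) =
      BalancedTensor.mk mulB (leftAction ((ι ℂ).comp χ)) (sliceRight χ s ⊠ z) := by
  revert s
  refine ext_fun fun a b => ?_
  rw [lift_tmul, BalancedTensor.mk_balanced, sliceRight_tmul, smul_tmul]
  rfl

theorem mk_tmul_lift_mulB (z : ℂ) (s : BTensor A A) :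
    BalancedTensor.mk (rightAction ((ι ℂ).comp χ)) mulB (z ⊠ lift mulB s) =
      BalancedTensor.mk (rightAction ((ι ℂ).comp χ)) mulB (z ⊠ sliceLeft χ s) := by
  revert s
  refine ext_fun fun a b => ?_
  rw [lift_tmul, ← BalancedTensor.mk_balanced, sliceLeft_tmul, ← smul_tmul, smul_eq_mul, mul_comm]
  rfl

theorem isEssentialHom_of_exists_lift_mulB_eq (hχ : ∀ a b, χ (a * b) = χ a * χ b) {e : A}
    (he : χ e = 1) (hl : ∀ a, ∃ s, lift mulB s = χ a • e ∧ sliceRight χ s = a)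
    (hr : ∀ a, ∃ s, lift mulB s = χ a • e ∧ sliceLeft χ s = a) :
    IsEssentialHom ((ι ℂ).comp χ) where
  map_mul a b := by
    ext z <;> simp [hχ, mul_comm, mul_left_comm]
  left := by
    refine ⟨(BalancedTensor.mk _ _).comp (tmul e), fun y => ?_, fun z => ?_⟩
    · obtain ⟨t, rfl⟩ := BalancedTensor.mk_surjective _ _ y
      rw [BalancedTensor.lift_mk]
      revert t
      refine ext_fun fun a z => ?_
      obtain ⟨s, hs, hsa⟩ := hl a
      calc _ = BalancedTensor.mk mulB (leftAction ((ι ℂ).comp χ)) ((χ a • e) ⊠ z) := by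
            rw [smul_tmul, lift_tmul]
            rfl
        _ = _ := by rw [← hs, mk_lift_mulB_tmul, hsa]
    · rw [BLin.comp_apply, BalancedTensor.lift_mk]
      simp [he]
  right := by
    refine ⟨(BalancedTensor.mk _ _).comp (tmul.flip e), fun y => ?_, fun z => ?_⟩
    · obtain ⟨t, rfl⟩ := BalancedTensor.mk_surjective _ _ y
      rw [BalancedTensor.lift_mk]
      revert t
      refine ext_fun fun z a => ?_
      obtain ⟨s, hs, hsa⟩ := hr a
      calc _ = BalancedTensor.mk (rightAction ((ι ℂ).comp χ)) mulB (z ⊠ (χ a • e)) := by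
            rw [← smul_tmul, lift_tmul, smul_eq_mul, mul_comm]
            rfl
        _ = _ := by rw [← hs, mk_tmul_lift_mulB, hsa]
    · rw [BLin.comp_apply, BalancedTensor.lift_mk]
      simp [he]

variable [CompleteBornSpace V]

theorem sliceRight_rmulSnd (hχ : ∀ a b, χ (a * b) = χ a * χ b) (a : A) :
    ∀ t : BTensor V A, sliceRight χ (rmulSnd a t) = χ a • sliceRight χ t :=
  ext_fun fun v b => by simp [hχ, mul_smul, smul_comm (χ a)]

theorem sliceRight_lmulSnd (hχ : ∀ a b, χ (a * b) = χ a * χ b) (a : A) :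
    ∀ t : BTensor V A, sliceRight χ (lmulSnd a t) = χ a • sliceRight χ t :=
  ext_fun fun v b => by simp [hχ, mul_smul]

theorem sliceLeft_lmulFst (hχ : ∀ a b, χ (a * b) = χ a * χ b) (a : A) :
    ∀ t : BTensor A V, sliceLeft χ (lmulFst a t) = χ a • sliceLeft χ t :=
  ext_fun fun b v => by simp [hχ, mul_smul]

end Character

/-! ### The counit -/

namespace BornQuantumGroup

variable {H X : Type*} [NonUnitalRing H] [Module ℂ H] [IsScalarTower ℂ H H] [SMulCommClass ℂ H H]
  [Bornology H] [BornAlgebra H] [AddCommGroup X] [Module ℂ X] [Bornology X] [CompleteBornSpace X]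
  (Q : BornQuantumGroup H)

open BTensor Multiplier

local notation:75 x:76 " ⊠ " y:75 => BTensor.tmul x y

/-- The inverse of the Galois map `γl`. -/
def γlInv : BLin (BTensor H H) (BTensor H H) := Q.γl_isIso.choose

/-- The inverse of the Galois map `γr`. -/
def γrInv : BLin (BTensor H H) (BTensor H H) := Q.γr_isIso.choose

/-- The inverse of the Galois map `ρl`. -/
def ρlInv : BLin (BTensor H H) (BTensor H H) := Q.ρl_isIso.choose

@[simp] theorem γlInv_γl (t : BTensor H H) : Q.γlInv (Q.γl t) = t := Q.γl_isIso.choose_spec.1 t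
@[simp] theorem γl_γlInv (t : BTensor H H) : Q.γl (Q.γlInv t) = t := Q.γl_isIso.choose_spec.2 t
@[simp] theorem γrInv_γr (t : BTensor H H) : Q.γrInv (Q.γr t) = t := Q.γr_isIso.choose_spec.1 t
@[simp] theorem γr_γrInv (t : BTensor H H) : Q.γr (Q.γrInv t) = t := Q.γr_isIso.choose_spec.2 t
@[simp] theorem ρlInv_ρl (t : BTensor H H) : Q.ρlInv (Q.ρl t) = t := Q.ρl_isIso.choose_spec.1 t
@[simp] theorem ρl_ρlInv (t : BTensor H H) : Q.ρl (Q.ρlInv t) = t := Q.ρl_isIso.choose_spec.2 t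

theorem γl_ext_fun {F G : BTensor H H → X} (h : ∀ f g, F (Q.γl (f ⊠ g)) = G (Q.γl (f ⊠ g)))
    (hF : IsBLin F := by fun_prop) (hG : IsBLin G := by fun_prop) (w : BTensor H H) :
    F w = G w :=
  ext_fun_of_surjective (fun w => ⟨_, Q.γl_γlInv w⟩) h hF hG w

theorem γr_ext_fun {F G : BTensor H H → X} (h : ∀ f g, F (Q.γr (f ⊠ g)) = G (Q.γr (f ⊠ g)))
    (hF : IsBLin F := by fun_prop) (hG : IsBLin G := by fun_prop) (w : BTensor H H) :
    F w = G w :=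
  ext_fun_of_surjective (fun w => ⟨_, Q.γr_γrInv w⟩) h hF hG w

theorem ρl_ext_fun {F G : BTensor H H → X} (h : ∀ f g, F (Q.ρl (f ⊠ g)) = G (Q.ρl (f ⊠ g)))
    (hF : IsBLin F := by fun_prop) (hG : IsBLin G := by fun_prop) (w : BTensor H H) :
    F w = G w :=
  ext_fun_of_surjective (fun w => ⟨_, Q.ρl_ρlInv w⟩) h hF hG w

theorem exists_φ_eq_one : ∃ e, Q.φ e = 1 := by
  obtain ⟨a, ha⟩ := @exists_ne H Q.essential.1 0
  refine BLin.exists_apply_eq_one fun hφ => ha (Q.faithful.1 a fun b => ?_)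
  rw [hφ, BLin.zero_apply]

theorem map_lift_γrInv_leg12_ρl (a : H) :
    ∀ w, map (BLin.id H) ((lift mulB).comp Q.γrInv) (leg12 Q.ρl (a ⊠ w)) = lmulFst a w := by
  refine Q.γr_ext_fun fun f g => ?_
  rw [leg12_ρl_γr, lmulFst_γr]
  generalize Q.ρl (a ⊠ f) = u
  revert u
  exact ext_fun fun p q => by simp

theorem tmul_lift_γrInv (x y c : H) :
    x ⊠ lift mulB (Q.γrInv (y ⊠ c)) = lift mulB (Q.ρlInv (x ⊠ y)) ⊠ c := by
  have map_lift_γrInv_ρl : ∀ t, map (BLin.id H) ((lift mulB).comp Q.γrInv) (assoc (Q.ρl t ⊠ c)) =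
      lift mulB t ⊠ c := ext_fun fun a b => by
    rw [← leg12_tmul, map_lift_γrInv_leg12_ρl]
    simp
  rw [← map_lift_γrInv_ρl, ρl_ρlInv]
  simp

/-- The counit `ε`, determined by `μ γr⁻¹ = ε ⊗ id` (and by `μ ρl⁻¹ = id ⊗ ε`); it is evaluated by
applying the Haar functional to the first leg of `e ⊗ μ γr⁻¹(y ⊗ c) = μ ρl⁻¹(e ⊗ y) ⊗ c`, where
`φ(e) = 1`. -/
def counit : BLin H ℂ :=
  Q.φ.comp ((lift mulB).comp (Q.ρlInv.comp (tmul Q.exists_φ_eq_one.choose)))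

theorem lift_γrInv : ∀ w, lift mulB (Q.γrInv w) = sliceLeft Q.counit w := by
  refine ext_fun fun y c => ?_
  have slice_eq := congrArg (sliceLeft Q.φ) (Q.tmul_lift_γrInv Q.exists_φ_eq_one.choose y c)
  rw [sliceLeft_tmul, sliceLeft_tmul, Q.exists_φ_eq_one.choose_spec, one_smul] at slice_eq
  rw [slice_eq, sliceLeft_tmul]
  rfl

theorem lift_ρlInv : ∀ w, lift mulB (Q.ρlInv w) = sliceRight Q.counit w := by
  obtain ⟨e, he⟩ := Q.exists_φ_eq_one
  refine ext_fun fun x y => ?_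
  have slice_eq := congrArg (sliceRight Q.φ) (Q.tmul_lift_γrInv x y e)
  rw [lift_γrInv, sliceLeft_tmul, map_smul, map_smul, sliceRight_tmul, sliceRight_tmul, he,
    one_smul, one_smul] at slice_eq
  rw [← slice_eq, sliceRight_tmul]

theorem counit_γr (t : BTensor H H) : sliceLeft Q.counit (Q.γr t) = lift mulB t := by
  rw [← lift_γrInv, γrInv_γr]

theorem counit_ρl (t : BTensor H H) : sliceRight Q.counit (Q.ρl t) = lift mulB t := by
  rw [← lift_ρlInv, ρlInv_ρl]

theorem counit_ρr : ∀ t, sliceLeft Q.counit (Q.ρr t) = lift mulB t := by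
  refine ext_fun fun f g => Q.faithful.eq_of_mul_right fun b => ?_
  rw [← sliceLeft_rmulSnd, ← lmulSnd_γr, sliceLeft_lmulSnd, counit_γr]
  simp [mul_assoc]

theorem counit_γl : ∀ t, sliceRight Q.counit (Q.γl t) = lift mulB t := by
  refine ext_fun fun f g => Q.faithful.eq_of_mul_left fun b => ?_
  rw [← sliceRight_lmulFst, lmulFst_γl, sliceRight_rmulFst, counit_ρl]
  simp [mul_assoc]

theorem sliceLeft_counit_Δ_L (c : H) :
    ∀ w, sliceLeft Q.counit ((Q.Δ c).L w) = c * sliceLeft Q.counit w :=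
  Q.γr_ext_fun fun f g => by
    rw [← γr_mul_left, counit_γr, counit_γr, lift_tmul, lift_tmul, mulB_apply, mulB_apply,
      mul_assoc]

theorem counit_mul (a b : H) : Q.counit (a * b) = Q.counit a * Q.counit b := by
  have slice_rmulFst : ∀ w : BTensor H H,
      sliceLeft Q.counit (rmulFst b w) = Q.counit b • sliceLeft Q.counit w :=
    Q.γr_ext_fun fun c d => by
      rw [← Δ_L_eq_γr, sliceLeft_counit_Δ_L, counit_γr]
      simp [mul_smul_comm]
  obtain ⟨e, he⟩ := Q.exists_φ_eq_one
  simpa [he, mul_comm] using congrArg Q.φ (slice_rmulFst (a ⊠ e))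

theorem exists_counit_eq_one : ∃ e, Q.counit e = 1 := by
  obtain ⟨a, ha⟩ := @exists_ne H Q.essential.1 0
  refine BLin.exists_apply_eq_one fun hε => ha (Q.faithful.eq_zero_of_mul_right a fun b => ?_)
  have slice_eq_zero : ∀ w, sliceLeft Q.counit w = (0 : BLin (BTensor H H) H) w :=
    ext_fun fun p q => by simp [hε]
  have mul_eq := Q.counit_γr (a ⊠ b)
  rwa [slice_eq_zero, BLin.zero_apply, lift_tmul, mulB_apply, eq_comm] at mul_eq

theorem sliceRight_counit_γr :
    ∀ t, sliceRight Q.counit (Q.γr t) = sliceRight Q.counit t := by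
  refine ext_fun fun a b => Q.faithful.eq_of_mul_right fun x => ?_
  rw [← sliceRight_rmulFst, ← Δ_L_eq_γr, Δ_L_eq_γl, sliceRight_rmulSnd Q.counit_mul, counit_γl]
  simp [smul_mul_assoc]

theorem sliceLeft_counit_ρl :
    ∀ t, sliceLeft Q.counit (Q.ρl t) = sliceLeft Q.counit t := by
  refine ext_fun fun a b => Q.faithful.eq_of_mul_left fun x => ?_
  rw [← sliceLeft_lmulSnd, ← Δ_R_eq_ρl, Δ_R_eq_ρr, sliceLeft_lmulFst Q.counit_mul, counit_ρr]
  simp [mul_smul_comm]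

theorem sliceRight_counit_ρr :
    ∀ t, sliceRight Q.counit (Q.ρr t) = sliceLeft Q.counit t := by
  refine ext_fun fun a b => Q.faithful.eq_of_mul_left fun x => ?_
  rw [← sliceRight_lmulFst, ← Δ_R_eq_ρr, Δ_R_eq_ρl, sliceRight_lmulSnd Q.counit_mul, counit_ρl]
  simp [mul_smul_comm]

theorem isEssentialHom_counit : IsEssentialHom ((ι ℂ).comp Q.counit) := by
  obtain ⟨e, he⟩ := Q.exists_counit_eq_one
  refine isEssentialHom_of_exists_lift_mulB_eq Q.counit_mul he
    (fun f => ⟨Q.γrInv (f ⊠ e), ?_, ?_⟩) fun f => ⟨Q.ρlInv (e ⊠ f), ?_, ?_⟩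
  · rw [lift_γrInv, sliceLeft_tmul]
  · rw [← sliceRight_counit_γr, γr_γrInv, sliceRight_tmul, he, one_smul]
  · rw [lift_ρlInv, sliceRight_tmul]
  · rw [← sliceLeft_counit_ρl, ρl_ρlInv, sliceLeft_tmul, he, one_smul]

theorem isCounit_counit : Q.IsCounit Q.counit where
  essential := Q.isEssentialHom_counit
  left f g := ⟨by simp [counit_γr], by simp [counit_ρr]⟩
  right f g := ⟨by simp [counit_γl], by simp [counit_ρl]⟩

theorem IsCounit.eq_counit {ε : BLin H ℂ} (hε : Q.IsCounit ε) : ε = Q.counit := by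
  have slice_eq : ∀ w, sliceLeft ε w = sliceLeft Q.counit w := Q.γr_ext_fun fun f g => by
    rw [← (hε.left f g).1, counit_γr, lift_tmul, mulB_apply, ι_L]
  obtain ⟨e, he⟩ := Q.exists_φ_eq_one
  ext a
  simpa [he] using congrArg Q.φ (slice_eq (a ⊠ e))

end BornQuantumGroup

namespace BornQuantumGroup

variable {H : Type*} [NonUnitalRing H] [Module ℂ H] [IsScalarTower ℂ H H] [SMulCommClass ℂ H H]
  [Bornology H] [BornAlgebra H] (Q : BornQuantumGroup H)

open BTensor Multiplier

local notation:75 x:76 " ⊠ " y:75 => BTensor.tmul x y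

/-! ### The antipode -/

/-- The map `f ⊗ g ↦ S(f) g`, constructed from the inverse of `γr`. -/
def antipodeMul : BLin (BTensor H H) H := (sliceLeft Q.counit).comp Q.γrInv

/-- The map `f ⊗ g ↦ f S(g)`, constructed from the inverse of `ρl`. -/
def mulAntipode : BLin (BTensor H H) H := (sliceRight Q.counit).comp Q.ρlInv

/-- The map `g ⊗ f ↦ S⁻¹(f) g`, constructed from the inverse of `γl`. -/
def antipodeInvMul : BLin (BTensor H H) H := (sliceLeft Q.counit).comp Q.γlInv

theorem antipodeMul_γr (t : BTensor H H) : Q.antipodeMul (Q.γr t) = sliceLeft Q.counit t := by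
  simp [antipodeMul]

theorem mulAntipode_ρl (t : BTensor H H) : Q.mulAntipode (Q.ρl t) = sliceRight Q.counit t := by
  simp [mulAntipode]

theorem antipodeInvMul_γl (t : BTensor H H) :
    Q.antipodeInvMul (Q.γl t) = sliceLeft Q.counit t := by
  simp [antipodeInvMul]

theorem antipodeMul_rmulSnd (b : H) :
    ∀ w, Q.antipodeMul (rmulSnd b w) = Q.antipodeMul w * b :=
  Q.γr_ext_fun fun f g => by
    rw [← γr_mul_right, antipodeMul_γr, antipodeMul_γr]
    simp [smul_mul_assoc]

theorem antipodeMul_Δ_L (h : H) :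
    ∀ w, Q.antipodeMul ((Q.Δ h).L w) = Q.counit h • Q.antipodeMul w :=
  Q.γr_ext_fun fun f g => by
    rw [← γr_mul_left, antipodeMul_γr, antipodeMul_γr]
    simp [counit_mul, mul_smul]

theorem antipodeInvMul_rmulFst (b : H) :
    ∀ w, Q.antipodeInvMul (rmulFst b w) = Q.antipodeInvMul w * b :=
  Q.γl_ext_fun fun f g => by
    rw [← γl_mul_right, antipodeInvMul_γl, antipodeInvMul_γl]
    simp [smul_mul_assoc]

theorem antipodeInvMul_Δ_L (h : H) :
    ∀ w, Q.antipodeInvMul ((Q.Δ h).L w) = Q.counit h • Q.antipodeInvMul w :=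
  Q.γl_ext_fun fun f g => by
    rw [← γl_mul_left, antipodeInvMul_γl, antipodeInvMul_γl]
    simp [counit_mul, mul_smul]

/-- The antipode `S`, read off from `ε(h) S(x) = antipodeMul (γl (h ⊗ x))` at some `h` with
`ε(h) = 1`. -/
def antipode : BLin H H :=
  Q.antipodeMul.comp (Q.γl.comp (tmul Q.exists_counit_eq_one.choose))

/-- The inverse of the antipode, read off from `ε(h) S⁻¹(x) = antipodeInvMul (γr (h ⊗ x))` at some
`h` with `ε(h) = 1`. -/
def antipodeInv : BLin H H :=
  Q.antipodeInvMul.comp (Q.γr.comp (tmul Q.exists_counit_eq_one.choose))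

theorem antipodeMul_γl_mul (h x b : H) :
    Q.antipodeMul (Q.γl (h ⊠ x)) * b = Q.counit h • Q.antipodeMul (x ⊠ b) := by
  rw [← antipodeMul_rmulSnd, ← Δ_L_eq_γl, antipodeMul_Δ_L]

theorem antipodeInvMul_γr_mul (h x b : H) :
    Q.antipodeInvMul (Q.γr (h ⊠ x)) * b = Q.counit h • Q.antipodeInvMul (b ⊠ x) := by
  rw [← antipodeInvMul_rmulFst, ← Δ_L_eq_γr, antipodeInvMul_Δ_L]

theorem antipode_mul (x b : H) : Q.antipode x * b = Q.antipodeMul (x ⊠ b) := by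
  have mul_eq := Q.antipodeMul_γl_mul Q.exists_counit_eq_one.choose x b
  rwa [Q.exists_counit_eq_one.choose_spec, one_smul] at mul_eq

theorem antipodeInv_mul (x b : H) : Q.antipodeInv x * b = Q.antipodeInvMul (b ⊠ x) := by
  have mul_eq := Q.antipodeInvMul_γr_mul Q.exists_counit_eq_one.choose x b
  rwa [Q.exists_counit_eq_one.choose_spec, one_smul] at mul_eq

theorem lift_map_antipode_id :
    ∀ w, lift mulB (map Q.antipode (BLin.id H) w) = Q.antipodeMul w :=
  ext_fun fun x y => by simp [antipode_mul]

theorem antipodeMul_γl (h x : H) : Q.antipodeMul (Q.γl (h ⊠ x)) = Q.counit h • Q.antipode x :=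
  Q.faithful.eq_of_mul_right fun b => by
    rw [antipodeMul_γl_mul, smul_mul_assoc, antipode_mul]

theorem antipodeInvMul_γr (h x : H) :
    Q.antipodeInvMul (Q.γr (h ⊠ x)) = Q.counit h • Q.antipodeInv x :=
  Q.faithful.eq_of_mul_right fun b => by
    rw [antipodeInvMul_γr_mul, smul_mul_assoc, antipodeInv_mul]

theorem lift_mulAntipode_leg12_ρl (c : H) : ∀ w,
    lift mulB (map Q.mulAntipode (BLin.id H) (assocSymm (leg12 Q.ρl (c ⊠ w)))) =
      c * sliceLeft Q.counit w :=
  ext_fun fun p q => by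
    rw [leg12_tmul, assocSymm_assoc, map_tmul, mulAntipode_ρl]
    simp [mul_smul_comm]

theorem lift_mulAntipode_γr (y : H) : ∀ u,
    lift mulB (map Q.mulAntipode (BLin.id H)
      (assocSymm (map (BLin.id H) Q.γr (assoc (u ⊠ y))))) = sliceRight Q.counit u * y :=
  Q.ρl_ext_fun fun c f => by
    rw [← leg12_ρl_γr, lift_mulAntipode_leg12_ρl, counit_γr, counit_ρl]
    simp [mul_assoc]

theorem lift_mulAntipode_assocSymm (a : H) : ∀ w,
    lift mulB (map Q.mulAntipode (BLin.id H) (assocSymm (a ⊠ w))) = a * Q.antipodeMul w :=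
  Q.γr_ext_fun fun g y => by
    have slice_eq := Q.lift_mulAntipode_γr y (a ⊠ g)
    simp only [assoc_tmul, map_tmul, BLin.id_apply] at slice_eq
    rw [slice_eq, antipodeMul_γr]
    simp [smul_mul_assoc, mul_smul_comm]

theorem mul_antipode (a x : H) : a * Q.antipode x = Q.mulAntipode (a ⊠ x) :=
  Q.faithful.eq_of_mul_right fun b => by
    rw [mul_assoc, antipode_mul, ← lift_mulAntipode_assocSymm]
    simp

theorem lift_map_id_antipode :
    ∀ w, lift mulB (map (BLin.id H) Q.antipode w) = Q.mulAntipode w :=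
  ext_fun fun x y => by simp [mul_antipode]

theorem antipodeMul_rmulFst (x : H) :
    ∀ w, Q.antipodeMul (rmulFst x w) = Q.antipode x * Q.antipodeMul w :=
  Q.γr_ext_fun fun h b => by
    rw [← Δ_L_eq_γr, antipodeMul_Δ_L, antipodeMul_γr, ← antipode_mul]
    simp [mul_smul_comm]

theorem antipode_map_mul (y x : H) : Q.antipode (y * x) = Q.antipode x * Q.antipode y :=
  Q.faithful.eq_of_mul_right fun c => by
    rw [mul_assoc, antipode_mul Q y, ← antipodeMul_rmulFst, rmulFst_tmul, antipode_mul]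

theorem antipode_antipodeInvMul : ∀ w, Q.antipode (Q.antipodeInvMul w) = Q.antipodeMul w :=
  Q.γl_ext_fun fun f g => by
    rw [antipodeInvMul_γl, antipodeMul_γl]
    simp

theorem antipodeInv_antipodeMul : ∀ w, Q.antipodeInv (Q.antipodeMul w) = Q.antipodeInvMul w :=
  Q.γr_ext_fun fun f g => by
    rw [antipodeMul_γr, antipodeInvMul_γr]
    simp

@[simp] theorem antipode_antipodeInv (a : H) : Q.antipode (Q.antipodeInv a) = a := by
  have antipode_mul_eq (b : H) :
      Q.antipode b * Q.antipode (Q.antipodeInv a) = Q.antipode b * a := by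
    rw [← antipode_map_mul, antipodeInv_mul, antipode_antipodeInvMul, antipode_mul]
  have mulAntipode_mul_eq :
      ∀ t, Q.mulAntipode t * Q.antipode (Q.antipodeInv a) = Q.mulAntipode t * a :=
    ext_fun fun c b => by rw [← mul_antipode, mul_assoc, antipode_mul_eq, mul_assoc]
  refine Q.faithful.eq_of_mul_left fun c => ?_
  obtain ⟨e, he⟩ := Q.exists_counit_eq_one
  have mul_eq := mulAntipode_mul_eq (Q.ρl (c ⊠ e))
  rwa [mulAntipode_ρl, sliceRight_tmul, he, one_smul] at mul_eq

theorem antipode_injective : Function.Injective Q.antipode := by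
  refine (injective_iff_map_eq_zero Q.antipode).2 fun z hz => ?_
  have antipodeInvMul_eq_zero :
      ∀ w, Q.antipodeInvMul (rmulFst z w) = (0 : BLin (BTensor H H) H) w :=
    ext_fun fun g b => by
      rw [rmulFst_tmul, ← antipodeInv_antipodeMul, ← antipode_mul, antipode_map_mul, hz]
      simp
  obtain ⟨e, he⟩ := Q.exists_counit_eq_one
  refine Q.faithful.eq_zero_of_mul_left z fun g => ?_
  have mul_eq := antipodeInvMul_eq_zero (Q.γl (e ⊠ g))
  rwa [← γl_mul_right, antipodeInvMul_γl, sliceLeft_tmul, he, one_smul, BLin.zero_apply] at mul_eq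

@[simp] theorem antipodeInv_antipode (a : H) : Q.antipodeInv (Q.antipode a) = a :=
  Q.antipode_injective (by rw [antipode_antipodeInv])

end BornQuantumGroup

namespace BornQuantumGroup

variable {H : Type*} [NonUnitalRing H] [Module ℂ H] [IsScalarTower ℂ H H] [SMulCommClass ℂ H H]
  [Bornology H] [BornAlgebra H] (Q : BornQuantumGroup H)

open BTensor Multiplier

local notation:75 x:76 " ⊠ " y:75 => BTensor.tmul x y

/-! ### The antipode is a coalgebra antihomomorphism -/

theorem map_rmulFst_leg12_leg13_γr (x f : H) : ∀ w,
    map (BLin.id H) (rmulFst x) (leg12 Q.γr (leg13 Q.γr (f ⊠ w))) =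
      leg12 Q.γr (leg13 Q.γr (f ⊠ rmulFst x w)) := by
  refine ext_fun fun p q => ?_
  rw [rmulFst_tmul, leg13_tmul, leg13_tmul]
  generalize Q.γr (f ⊠ q) = u
  revert u
  refine ext_fun fun a b => ?_
  rw [insertMid_tmul, insertMid_tmul, leg12_tmul, leg12_tmul, γr_mul_right]
  generalize Q.γr (a ⊠ p) = v
  revert v
  exact ext_fun fun c d => by simp

theorem map_rmulSnd_leg12_leg13_γr (y f : H) : ∀ w,
    map (BLin.id H) (rmulSnd y) (leg12 Q.γr (leg13 Q.γr (f ⊠ w))) =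
      leg12 Q.γr (leg13 Q.γr (f ⊠ rmulSnd y w)) := by
  refine ext_fun fun p q => ?_
  rw [rmulSnd_tmul, leg13_tmul, leg13_tmul, γr_mul_right]
  generalize Q.γr (f ⊠ q) = u
  revert u
  refine ext_fun fun a b => ?_
  rw [rmulSnd_tmul, insertMid_tmul, insertMid_tmul, leg12_tmul, leg12_tmul]
  generalize Q.γr (a ⊠ p) = v
  revert v
  exact ext_fun fun c d => by simp

theorem γr_pentagon (f g y : H) : map (BLin.id H) Q.γr (assoc (Q.γr (f ⊠ g) ⊠ y)) =
    leg12 Q.γr (leg13 Q.γr (f ⊠ Q.γr (g ⊠ y))) := by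
  refine Q.approximation.id_map_ext (F := fun x : H => (rmulFst x : BLin (BTensor H H) _))
    (fun t ht => Q.faithful.ext_rmulFst Q.approximation Q.faithful.hasSeparatingDual fun x => by
      rw [ht, map_zero]) fun x => ?_
  rw [map_rmulFst_map_γr_assoc, map_rmulFst_leg12_leg13_γr, ← Δ_L_eq_γr, map_comulApply_γr]

theorem map_γl_γr (f g c : H) : map (BLin.id H) (Q.γl.comp (tmul.flip c)) (Q.γr (f ⊠ g)) =
    leg12 Q.γr (leg13 Q.γr (f ⊠ Q.γl (g ⊠ c))) := by
  refine Q.approximation.id_map_ext (F := fun x : H => (rmulSnd x : BLin (BTensor H H) _))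
    (fun t ht => Q.faithful.ext_rmulSnd Q.approximation Q.faithful.hasSeparatingDual fun x => by
      rw [ht, map_zero]) fun y => ?_
  have map_rmulSnd_map_γl : ∀ u,
      map (BLin.id H) (rmulSnd y) (map (BLin.id H) (Q.γl.comp (tmul.flip c)) u) =
        map (BLin.id H) (Q.comulApply (c ⊠ y)) u :=
    ext_fun fun p q => by simp [Δ_L_eq_γl]
  rw [map_rmulSnd_map_γl, map_rmulSnd_leg12_leg13_γr, ← Δ_L_eq_γl, map_comulApply_γr]

theorem lift_map_id_antipode_ρr (d x f : H) :
    lift mulB (map (BLin.id H) Q.antipode (lmulFst d (Q.ρr (x ⊠ f)))) =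
      Q.counit f • (d * Q.antipode x) := by
  have lift_lmulSnd : ∀ u : BTensor H H, lift mulB (map (BLin.id H) Q.antipode (lmulSnd x u)) =
      lift mulB (map (BLin.id H) Q.antipode u) * Q.antipode x :=
    ext_fun fun a b => by simp [antipode_map_mul, mul_assoc]
  rw [← Δ_R_eq_ρr, Δ_R_eq_ρl, lift_lmulSnd, lift_map_id_antipode, mulAntipode_ρl, sliceRight_tmul,
    smul_mul_assoc]

theorem γr_map_antipode_ρr (x f : H) :
    Q.γr (map (BLin.id H) Q.antipode (Q.ρr (x ⊠ f))) = f ⊠ Q.antipode x := by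
  refine Q.faithful.ext_lmulFst Q.approximation Q.faithful.hasSeparatingDual fun c =>
    Q.faithful.ext_lmulSnd Q.approximation Q.faithful.hasSeparatingDual fun d => ?_
  set mulS : BLin (BTensor H H) H :=
    (lift mulB).comp ((map (BLin.id H) Q.antipode).comp (lmulFst d)) with mulS_def
  have lmul_γr : ∀ w, lmulSnd d (lmulFst c (Q.γr (map (BLin.id H) Q.antipode w))) =
      map (BLin.id H) mulS (leg12 Q.ρl (c ⊠ w)) := ext_fun fun p q => by
    rw [map_tmul, BLin.id_apply, lmulFst_γr, leg12_tmul]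
    generalize Q.ρl (c ⊠ p) = u
    revert u
    exact ext_fun fun a b => by simp [mulS_def, mul_assoc]
  have map_mulS : ∀ u, map (BLin.id H) mulS (map (BLin.id H) (Q.ρr.comp (tmul x)) u) =
      sliceRight Q.counit u ⊠ (d * Q.antipode x) :=
    ext_fun fun p q => by simp [mulS_def, lift_map_id_antipode_ρr]
  rw [lmul_γr, leg12_ρl_ρr, map_mulS, counit_ρl]
  simp

/-- The map `(p ⊗ q) ⊗ y ↦ q ⊗ S(p) y`. -/
def sndAntipodeMul : BLin (BTensor (BTensor H H) H) (BTensor H H) :=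
  (map (BLin.id H) Q.antipodeMul).comp (assoc.comp (map swap (BLin.id H)))

@[simp] theorem sndAntipodeMul_tmul (p q y : H) :
    Q.sndAntipodeMul ((p ⊠ q) ⊠ y) = q ⊠ Q.antipodeMul (p ⊠ y) := by
  simp [sndAntipodeMul]

theorem sndAntipodeMul_leg13_γr (f : H) : ∀ w,
    Q.sndAntipodeMul (assocSymm (leg13 Q.γr (f ⊠ w))) = Q.counit f • w :=
  ext_fun fun x y => by
    have sndAntipodeMul_insertMid : ∀ u,
        Q.sndAntipodeMul (assocSymm (insertMid x u)) = x ⊠ Q.antipodeMul u :=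
      ext_fun fun p q => by simp
    rw [leg13_tmul, sndAntipodeMul_insertMid, antipodeMul_γr]
    simp

theorem lift_Δ_antipode_map_γr (f g y : H) :
    lift ((LB.comp Q.Δ).comp Q.antipode) (map (BLin.id H) Q.γr (assoc (Q.γr (f ⊠ g) ⊠ y))) =
      Q.counit f • Q.γr (g ⊠ y) := by
  have lift_map_assoc : ∀ w, lift ((LB.comp Q.Δ).comp Q.antipode)
      (map (BLin.id H) Q.γr (assoc (w ⊠ y))) = Q.γr (Q.antipodeMul w ⊠ y) :=
    ext_fun fun p q => by simp [← γr_mul_left, antipode_mul]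
  rw [lift_map_assoc, antipodeMul_γr]
  simp

/-- In Sweedler notation this reads `Δ(S(p₍₁₎)) (p₍₂₎ q ⊗ y) = q ⊗ S(p) y`. -/
theorem lift_Δ_antipode_leg12_γr : ∀ T : BTensor H (BTensor H H),
    lift ((LB.comp Q.Δ).comp Q.antipode) (leg12 Q.γr T) = Q.sndAntipodeMul (assocSymm T) := by
  refine ext_fun_of_surjective (E := leg13 Q.γr)
    (fun T => ⟨leg13 Q.γrInv T, leg13_leg13 Q.γr_γrInv T⟩) fun f => ?_
  refine Q.γr_ext_fun fun g y => ?_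
  rw [← γr_pentagon, lift_Δ_antipode_map_γr, sndAntipodeMul_leg13_γr]

/-- The antiautomorphism `(S ⊗ S) τ` of `H ⊗ H`. -/
def antipodeTensor : BLin (BTensor H H) (BTensor H H) :=
  (map Q.antipode Q.antipode).comp swap

@[simp] theorem antipodeTensor_tmul (x y : H) :
    Q.antipodeTensor (x ⊠ y) = Q.antipode y ⊠ Q.antipode x := by
  simp [antipodeTensor]

theorem antipodeTensor_mul (s t : BTensor H H) :
    Q.antipodeTensor (s * t) = Q.antipodeTensor t * Q.antipodeTensor s := by
  revert s
  refine ext_fun fun a b => ?_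
  revert t
  exact ext_fun fun c d => by simp [antipode_map_mul]

theorem antipodeTensor_surjective : Function.Surjective Q.antipodeTensor := by
  refine fun t => ⟨swap (map Q.antipodeInv Q.antipodeInv t), ?_⟩
  revert t
  exact ext_fun fun a b => by simp

theorem Δ_antipode_L (f : H) : ∀ t,
    (Q.Δ (Q.antipode f)).L (Q.antipodeTensor t) = Q.antipodeTensor ((Q.Δ f).R t) := by
  refine ext_fun fun y x => ?_
  have leg12_γr : leg12 Q.γr (assoc (map (BLin.id H) Q.antipode (Q.ρr (x ⊠ f)) ⊠ Q.antipode y)) =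
      f ⊠ (Q.antipode x ⊠ Q.antipode y) := by
    rw [leg12_assoc, γr_map_antipode_ρr, assoc_tmul]
  have sndAntipodeMul_antipode : ∀ w,
      Q.sndAntipodeMul (map (BLin.id H) Q.antipode w ⊠ Q.antipode y) =
        Q.antipodeTensor (lmulFst y w) :=
    ext_fun fun p q => by simp [← antipode_mul, antipode_map_mul]
  calc (Q.Δ (Q.antipode f)).L (Q.antipodeTensor (y ⊠ x))
      = lift ((LB.comp Q.Δ).comp Q.antipode) (f ⊠ (Q.antipode x ⊠ Q.antipode y)) := by simp
    _ = Q.antipodeTensor (lmulFst y (Q.ρr (x ⊠ f))) := by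
        rw [← leg12_γr, lift_Δ_antipode_leg12_γr, assocSymm_assoc, sndAntipodeMul_antipode]
    _ = _ := by rw [Δ_R_eq_ρr]

theorem Δ_antipode_R (f : H) (t : BTensor H H) :
    (Q.Δ (Q.antipode f)).R (Q.antipodeTensor t) = Q.antipodeTensor ((Q.Δ f).L t) := by
  refine Q.tensor_ext_right fun z => ?_
  obtain ⟨s, rfl⟩ := Q.antipodeTensor_surjective z
  rw [← Multiplier.mul_L, Δ_antipode_L, ← antipodeTensor_mul, ← antipodeTensor_mul,
    Multiplier.mul_L]

theorem isAntipode_antipode : Q.IsAntipode Q.counit Q.antipode where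
  isIso := ⟨Q.antipodeInv, Q.antipodeInv_antipode, Q.antipode_antipodeInv⟩
  map_mul := Q.antipode_map_mul
  comul f := ⟨Q.Δ_antipode_L f, Q.Δ_antipode_R f⟩
  left t := by rw [lift_map_antipode_id, antipodeMul_γr]
  right t := by rw [lift_map_id_antipode, mulAntipode_ρl]

theorem IsAntipode.eq_antipode {S : BLin H H} (hS : Q.IsAntipode Q.counit S) :
    S = Q.antipode := by
  ext a
  refine Q.faithful.eq_of_mul_right fun b => ?_
  have left_eq := hS.left (Q.γrInv (a ⊠ b))
  rw [γr_γrInv, map_tmul, lift_tmul] at left_eq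
  rw [antipode_mul]
  exact left_eq

end BornQuantumGroup

theorem Multiplier.ext_of_L {A : Type*} [NonUnitalRing A] [Module ℂ A] [IsScalarTower ℂ A A]
    [SMulCommClass ℂ A A] [Bornology A] [BornAlgebra A]
    (hA : ∀ {a a' : A}, (∀ b, a * b = a' * b) → a = a') {m n : Multiplier A}
    (h : ∀ a, m.L a = n.L a) : m = n :=
  Multiplier.ext h fun a => hA fun b => by rw [← mul_L, h, mul_L]

namespace BornQuantumGroup

variable {H : Type*} [NonUnitalRing H] [Module ℂ H] [IsScalarTower ℂ H H] [SMulCommClass ℂ H H]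
  [Bornology H] [BornAlgebra H] (Q : BornQuantumGroup H)

open BTensor Multiplier

local notation:75 x:76 " ⊠ " y:75 => BTensor.tmul x y

/-! ### Invariance of the Haar functional -/

theorem γl_antipode (f x : H) :
    Q.γl (Q.antipode f ⊠ Q.antipode x) = Q.antipodeTensor (Q.ρr (x ⊠ f)) := by
  refine Q.faithful.ext_rmulSnd Q.approximation Q.faithful.hasSeparatingDual fun b => ?_
  obtain ⟨y, rfl⟩ : ∃ y, Q.antipode y = b := ⟨_, Q.antipode_antipodeInv b⟩
  have rmulSnd_antipodeTensor :
      ∀ w, rmulSnd (Q.antipode y) (Q.antipodeTensor w) = Q.antipodeTensor (lmulFst y w) :=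
    ext_fun fun p q => by simp [antipode_map_mul]
  rw [rmulSnd_antipodeTensor, ← Δ_L_eq_γl, ← antipodeTensor_tmul, Δ_antipode_L, Δ_R_eq_ρr]

/-- The right Haar functional `φ S`. -/
def ψ : BLin H ℂ := Q.φ.comp Q.antipode

theorem sliceLeft_ψ_ρr (x f : H) : sliceLeft Q.ψ (Q.ρr (x ⊠ f)) = Q.ψ f • x := by
  refine Q.antipode_injective ?_
  have antipode_sliceLeft :
      ∀ w, Q.antipode (sliceLeft Q.ψ w) = sliceRight Q.φ (Q.antipodeTensor w) :=
    ext_fun fun p q => by simp [ψ]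
  rw [antipode_sliceLeft, ← γl_antipode, (Q.left_invariant _ _).1, map_smul]
  rfl

theorem mul_sliceLeft_γr (ω : BLin H ℂ) (x f g : H) :
    x * sliceLeft ω (Q.γr (f ⊠ g)) = sliceLeft ω (Q.ρr (x ⊠ f)) * g := by
  rw [← sliceLeft_lmulSnd, lmulSnd_γr, sliceLeft_rmulSnd]

theorem sliceLeft_ψ_γr (f g : H) : sliceLeft Q.ψ (Q.γr (f ⊠ g)) = Q.ψ f • g :=
  Q.faithful.eq_of_mul_left fun x => by
    rw [mul_sliceLeft_γr, sliceLeft_ψ_ρr, smul_mul_assoc, mul_smul_comm]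

theorem antipodeMul_map_sliceRight_leg12_γr (x : H) : ∀ u,
    Q.antipodeMul (map (BLin.id H) (sliceRight Q.φ) (leg12 Q.γr (insertMid x u))) =
      Q.φ (sliceLeft Q.counit u) • x := by
  refine ext_fun fun a b => ?_
  have map_sliceRight_assoc : ∀ v : BTensor H H,
      map (BLin.id H) (sliceRight Q.φ) (assoc (v ⊠ b)) = Q.φ b • v :=
    ext_fun fun p q => by simp
  rw [insertMid_tmul, leg12_tmul, map_sliceRight_assoc, map_smul, antipodeMul_γr]
  simp [mul_smul, smul_comm (Q.φ b)]

theorem antipodeMul_map_sliceRight_leg12_leg13_γr (f : H) : ∀ v,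
    Q.antipodeMul (map (BLin.id H) (sliceRight Q.φ) (leg12 Q.γr (leg13 Q.γr (f ⊠ v)))) =
      sliceRight Q.φ (lmulSnd f v) :=
  ext_fun fun x y => by
    rw [leg13_tmul, antipodeMul_map_sliceRight_leg12_γr, counit_γr]
    simp

/-- Strong left invariance of the Haar functional. -/
theorem antipode_sliceRight_γr (f g : H) :
    Q.antipode (sliceRight Q.φ (Q.γr (f ⊠ g))) = sliceRight Q.φ (Q.ρr (f ⊠ g)) := by
  refine Q.faithful.eq_of_mul_right fun c => ?_
  have antipode_sliceRight_mul : ∀ w, Q.antipode (sliceRight Q.φ w) * c =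
      Q.antipodeMul (map (BLin.id H) (sliceRight Q.φ)
        (map (BLin.id H) (Q.γl.comp (tmul.flip c)) w)) :=
    ext_fun fun p q => by
      simp [(Q.left_invariant _ _).1, smul_mul_assoc, antipode_mul]
  rw [antipode_sliceRight_mul, map_γl_γr, antipodeMul_map_sliceRight_leg12_leg13_γr, lmulSnd_γl,
    sliceRight_rmulFst]

theorem φ_sliceLeft_φ_ρr (f g : H) : Q.φ (sliceLeft Q.φ (Q.ρr (f ⊠ g))) = Q.ψ f * Q.φ g :=
  calc Q.φ (sliceLeft Q.φ (Q.ρr (f ⊠ g)))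
      = Q.ψ (sliceRight Q.φ (Q.γr (f ⊠ g))) := by
        rw [← apply_sliceRight, ← antipode_sliceRight_γr]
        rfl
    _ = Q.ψ f * Q.φ g := by
        rw [apply_sliceRight, sliceLeft_ψ_γr, map_smul, smul_eq_mul]

theorem sliceLeft_φ_ρr (h g : H) {e : H} (he : Q.φ e = 1) :
    sliceLeft Q.φ (Q.ρr (h ⊠ g)) = Q.φ g • sliceLeft Q.φ (Q.ρr (h ⊠ e)) := by
  rw [← sub_eq_zero]
  refine Q.faithful.2 _ fun f => ?_
  rw [mul_sub, mul_smul_comm, map_sub, map_smul, ← sliceLeft_lmulSnd, ← sliceLeft_lmulSnd,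
    ← ρr_mul_left, ← ρr_mul_left, φ_sliceLeft_φ_ρr, φ_sliceLeft_φ_ρr, he, smul_eq_mul]
  ring

/-! ### The modular element -/

/-- The slice `(ω ⊗ id) Δ(f)`. -/
def leftSlice (ω : BLin H ℂ) (f : H) : Multiplier H where
  L := (sliceLeft ω).comp (Q.γr.comp (tmul f))
  R := (sliceLeft ω).comp (Q.ρr.comp (tmul.flip f))
  L_mul a b := by
    simp only [BLin.comp_apply]
    rw [γr_mul_right, sliceLeft_rmulSnd]
  R_mul a b := by
    simp only [BLin.comp_apply, BLin.flip_apply]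
    rw [ρr_mul_left, sliceLeft_lmulSnd]
  mul_L a b := Q.mul_sliceLeft_γr ω a f b

theorem isModularElement_leftSlice {e : H} (he : Q.φ e = 1) :
    Q.IsModularElement (Q.leftSlice Q.φ e) := by
  refine fun f g => ⟨Q.faithful.eq_of_mul_left fun x => ?_, (Q.sliceLeft_φ_ρr g f he).symm⟩
  rw [mul_sliceLeft_γr, Q.sliceLeft_φ_ρr x f he, smul_L, mul_smul_comm, smul_mul_assoc,
    Multiplier.mul_L]
  rfl

namespace IsModularElement

variable {Q} {δ δ' : Multiplier H}

theorem isLeftSlice (hδ : Q.IsModularElement δ) {e : H} (he : Q.φ e = 1) :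
    Q.IsLeftSlice Q.φ e δ := by
  simpa only [he, one_smul] using hδ e

theorem eq (hδ : Q.IsModularElement δ) (hδ' : Q.IsModularElement δ') : δ = δ' := by
  obtain ⟨e, he⟩ := Q.exists_φ_eq_one
  exact Multiplier.ext (fun a => (hδ.isLeftSlice he a).1.trans (hδ'.isLeftSlice he a).1.symm)
    fun a => (hδ.isLeftSlice he a).2.trans (hδ'.isLeftSlice he a).2.symm

theorem sliceLeft_leg12_γr (hδ : Q.IsModularElement δ) (x : H) : ∀ u : BTensor H H,
    sliceLeft Q.φ (leg12 Q.γr (insertMid x u)) = δ.L x ⊠ sliceLeft Q.φ u := by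
  refine ext_fun fun p q => ?_
  have sliceLeft_assoc : ∀ v : BTensor H H,
      sliceLeft Q.φ (assoc (v ⊠ q)) = sliceLeft Q.φ v ⊠ q :=
    ext_fun fun a b => by simp
  rw [insertMid_tmul, leg12_tmul, sliceLeft_assoc, ← (hδ p x).1]
  simp

theorem Δ_L (hδ : Q.IsModularElement δ) (a : H) (t : BTensor H H) :
    (Q.Δ (δ.L a)).L t = (tensor δ δ).L ((Q.Δ a).L t) := by
  obtain ⟨e, he⟩ := Q.exists_φ_eq_one
  have comulApply_sliceLeft : ∀ u, Q.comulApply t (sliceLeft Q.φ u) =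
      sliceLeft Q.φ (map (BLin.id H) (Q.comulApply t) u) :=
    ext_fun fun p q => by simp
  have sliceLeft_leg12_leg13 :
      ∀ s, sliceLeft Q.φ (leg12 Q.γr (leg13 Q.γr (e ⊠ s))) = (tensor δ δ).L s :=
    ext_fun fun x y => by
      rw [leg13_tmul, hδ.sliceLeft_leg12_γr, ← (hδ.isLeftSlice he y).1, tensor_L, map_tmul]
  calc (Q.Δ (δ.L a)).L t
      = Q.comulApply t (sliceLeft Q.φ (Q.γr (e ⊠ a))) := by
        rw [← (hδ.isLeftSlice he a).1, comulApply_apply]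
    _ = (tensor δ δ).L ((Q.Δ a).L t) := by
        rw [comulApply_sliceLeft, map_comulApply_γr, sliceLeft_leg12_leg13]

theorem extendsAt_Δ (hδ : Q.IsModularElement δ) : ExtendsAt Q.Δ δ (tensor δ δ) := by
  obtain ⟨n, hn, -⟩ := Q.comul.essential.existsUnique_extendsAt δ
  have n_eq : n = tensor δ δ := Multiplier.ext_of_L Q.tensor_ext_right
    (Q.comul.essential.ext_fun fun a t => by rw [hn.1, hδ.Δ_L])
  rwa [← n_eq]

theorem counit_L (hδ : Q.IsModularElement δ) (a : H) : Q.counit (δ.L a) = Q.counit a := by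
  obtain ⟨e, he⟩ := Q.exists_φ_eq_one
  rw [(hδ.isLeftSlice he a).1, ← apply_sliceRight, sliceRight_counit_γr]
  simp [he]

theorem counit_R (hδ : Q.IsModularElement δ) (a : H) : Q.counit (δ.R a) = Q.counit a := by
  obtain ⟨e, he⟩ := Q.exists_φ_eq_one
  rw [(hδ.isLeftSlice he a).2, ← apply_sliceRight, sliceRight_counit_ρr]
  simp [he]

theorem extendsAt_counit (hδ : Q.IsModularElement δ) :
    ExtendsAt ((ι ℂ).comp Q.counit) δ 1 := by
  refine ⟨fun a b => ?_, fun a b => ?_⟩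
  · rw [BLin.comp_apply, BLin.comp_apply, hδ.counit_L, one_L]
  · rw [BLin.comp_apply, BLin.comp_apply, hδ.counit_R, one_R]

theorem antipodeMul_tensor_L (hδ : Q.IsModularElement δ) :
    ∀ w, Q.antipodeMul ((tensor δ δ).L w) = Q.antipodeMul w :=
  Q.γr_ext_fun fun f g => by
    have tensor_L_γr : (tensor δ δ).L (Q.γr (f ⊠ g)) = Q.γr (δ.L f ⊠ g) :=
      Q.tensor_ext_right fun z => by
        rw [← Multiplier.L_mul, γr_mul, γr_mul, hδ.Δ_L]
    rw [tensor_L_γr, antipodeMul_γr, antipodeMul_γr]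
    simp [hδ.counit_L]

theorem mulAntipode_tensor_R (hδ : Q.IsModularElement δ) :
    ∀ w, Q.mulAntipode ((tensor δ δ).R w) = Q.mulAntipode w :=
  Q.ρl_ext_fun fun f g => by
    have tensor_R_ρl : (tensor δ δ).R (Q.ρl (f ⊠ g)) = Q.ρl (f ⊠ δ.R g) :=
      Q.tensor_ext_left fun z => by
        rw [← Multiplier.R_mul, mul_ρl, mul_ρl, hδ.extendsAt_Δ.2]
    rw [tensor_R_ρl, mulAntipode_ρl, mulAntipode_ρl]
    simp [hδ.counit_R]

theorem antipode_L_mul_L (hδ : Q.IsModularElement δ) (a b : H) :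
    Q.antipode (δ.L a) * δ.L b = Q.antipode a * b := by
  rw [antipode_mul, antipode_mul, ← hδ.antipodeMul_tensor_L (a ⊠ b), tensor_L, map_tmul]

theorem R_mul_antipode_R (hδ : Q.IsModularElement δ) (a b : H) :
    δ.R a * Q.antipode (δ.R b) = a * Q.antipode b := by
  rw [mul_antipode, mul_antipode, ← hδ.mulAntipode_tensor_R (a ⊠ b), tensor_R, map_tmul]

end IsModularElement

/-! ### The antipode of a multiplier -/

theorem antipodeInv_map_mul (a b : H) :
    Q.antipodeInv (a * b) = Q.antipodeInv b * Q.antipodeInv a :=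
  Q.antipode_injective (by simp [antipode_map_mul])

/-- The extension of the antipode to multipliers. -/
def antipodeMultiplier (m : Multiplier H) : Multiplier H where
  L := Q.antipode.comp (m.R.comp Q.antipodeInv)
  R := Q.antipode.comp (m.L.comp Q.antipodeInv)
  L_mul a b := by simp [antipodeInv_map_mul, m.R_mul, antipode_map_mul]
  R_mul a b := by simp [antipodeInv_map_mul, m.L_mul, antipode_map_mul]
  mul_L a b := by
    obtain ⟨a, rfl⟩ : ∃ x, Q.antipode x = a := ⟨_, Q.antipode_antipodeInv a⟩
    obtain ⟨b, rfl⟩ : ∃ x, Q.antipode x = b := ⟨_, Q.antipode_antipodeInv b⟩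
    simp only [BLin.comp_apply, antipodeInv_antipode]
    rw [← antipode_map_mul, ← antipode_map_mul, m.mul_L]

theorem antiExtendsAt_antipodeMultiplier (m : Multiplier H) :
    AntiExtendsAt Q.antipode m (Q.antipodeMultiplier m) :=
  ⟨fun a => by simp [antipodeMultiplier], fun a => by simp [antipodeMultiplier]⟩

variable {Q} {δ : Multiplier H}

theorem IsModularElement.antipodeMultiplier_mul (hδ : Q.IsModularElement δ) :
    Q.antipodeMultiplier δ * δ = 1 := by
  refine Multiplier.ext_of_L Q.faithful.eq_of_mul_right fun b =>
    Q.faithful.eq_of_mul_left fun x => ?_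
  obtain ⟨a, rfl⟩ : ∃ a, Q.antipode a = x := ⟨_, Q.antipode_antipodeInv x⟩
  rw [mul_L_apply, Multiplier.mul_L, (Q.antiExtendsAt_antipodeMultiplier δ).2,
    hδ.antipode_L_mul_L, one_L]

theorem IsModularElement.mul_antipodeMultiplier (hδ : Q.IsModularElement δ) :
    δ * Q.antipodeMultiplier δ = 1 := by
  refine Multiplier.ext_of_L Q.faithful.eq_of_mul_right fun y =>
    Q.faithful.eq_of_mul_left fun x => ?_
  obtain ⟨b, rfl⟩ : ∃ b, Q.antipode b = y := ⟨_, Q.antipode_antipodeInv y⟩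
  rw [mul_L_apply, Multiplier.mul_L, (Q.antiExtendsAt_antipodeMultiplier δ).1,
    hδ.R_mul_antipode_R, one_L]

end BornQuantumGroup

end BornQG

end

theorem mainTheorem9 {H : Type*} [NonUnitalRing H] [Module ℂ H] [IsScalarTower ℂ H H]
    [SMulCommClass ℂ H H] [Bornology H] [BornAlgebra H] (Q : BornQuantumGroup H) :
    (∃! p : BLin H ℂ × BLin H H, Q.IsCounit p.1 ∧ Q.IsAntipode p.1 p.2) ∧
    (∃! δ : Multiplier H, Q.IsModularElement δ) ∧
    ∀ (ε : BLin H ℂ) (S : BLin H H) (δ : Multiplier H),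
      Q.IsCounit ε → Q.IsAntipode ε S → Q.IsModularElement δ →
        ∃ u : (Multiplier H)ˣ, (u : Multiplier H) = δ ∧
          ExtendsAt Q.Δ δ (Multiplier.tensor δ δ) ∧
          ExtendsAt ((Multiplier.ι ℂ).comp ε) δ 1 ∧
          AntiExtendsAt S δ ((u⁻¹ : (Multiplier H)ˣ) : Multiplier H) := by
  refine ⟨⟨(Q.counit, Q.antipode), ⟨Q.isCounit_counit, Q.isAntipode_antipode⟩, ?_⟩, ?_, ?_⟩
  · rintro ⟨ε, S⟩ ⟨hε, hS⟩
    obtain rfl := hε.eq_counit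
    obtain rfl := hS.eq_antipode
    rfl
  · obtain ⟨e, he⟩ := Q.exists_φ_eq_one
    exact ⟨_, Q.isModularElement_leftSlice he, fun δ hδ => hδ.eq (Q.isModularElement_leftSlice he)⟩
  · intro ε S δ hε hS hδ
    obtain rfl := hε.eq_counit
    obtain rfl := hS.eq_antipode
    exact ⟨⟨δ, Q.antipodeMultiplier δ, hδ.mul_antipodeMultiplier, hδ.antipodeMultiplier_mul⟩, rfl,
      hδ.extendsAt_Δ, hδ.extendsAt_counit, Q.antiExtendsAt_antipodeMultiplier δ⟩
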